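/- \textbf{Theorem 1.} The Fixed MCR problem is 3SUM-hard, in the following precise sense. \emph{Fixed MCR.} An instance consists of a point $r$ in the plane, a simple polygon $P$ with $m$ vertices (listed in cyclic order), and a set $S$ of $n$ points in the plane (listed in arbitrary order); its size is $n+m$. The task is to output an angle $\theta\in[0,2\pi)$ such that the number of points of $S$ contained in the closed region bounded by $P$, after rotating $P$ clockwise around $r$ by $\theta$, is maximum over all angles in $[0,2\pi)$. \emph{3SUM.} Given a set $S$ of $n$ real numbers (listed in arbitrary order), decide whether there are $a,b,c\in S$, not necessarily distinct, with $a+b+c=0$. \emph{Model and terminology.} Algorithms are programs of a real RAM with unit-cost arithmetic and comparisons of real numbers, a fixed set $F$ of unit-cost unary real functions, and indices that are natural numbers. A function $f:\mathbb N\to\mathbb N$ is subquadratic if $f(n)=O(n^{2-\delta})$ for some $\delta>0$. Let $F$ be any set of functions $\mathbb R\to\mathbb R$ that contains $\sin$ and $\cos$. (i) 3SUM reduces to Fixed MCR: there are a real-RAM program with access to an oracle for Fixed MCR, constants $k$ and $C$, and a subquadratic function $f$, such that, for every instance of 3SUM of size $n$ and for every choice of optimal angles that the oracle returns, the program halts with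 the correct answer within $f(n)$ steps (counting for an oracle call only the passing of its input), after at most $k$ oracle calls, all of them on instances of Fixed MCR of size at most $C(n+1)$. (ii) Consequently, if Fixed MCR can be solved on the real RAM in time subquadratic in $n+m$, then 3SUM can be solved on the real RAM in time subquadratic in $n$. -/

import Mathlib

open Filter Asymptotics

/-! ## The real RAM

A real RAM has index registers and index arrays holding natural numbers, and real registers and
real arrays holding exact real numbers. Every elementary operation has unit cost. Besides the four
arithmetic operations on reals, the unary functions in a set `F` are available as primitives. -/

/-- The memory of the machine: index registers, real registers, and numbered arrays. -/
structure RamState where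
  idx : ℕ → ℕ
  val : ℕ → ℝ
  iarr : ℕ → ℕ → ℕ
  rarr : ℕ → ℕ → ℝ

/-- Expressions with natural-number value. `get a e` is entry `e` of index array `a`;
`sub` is truncated subtraction. -/
inductive IExp : Type
  | const (c : ℕ)
  | reg (i : ℕ)
  | get (a : ℕ) (e : IExp)
  | add (e₁ e₂ : IExp)
  | sub (e₁ e₂ : IExp)

/-- Expressions with real value. `get a e` is entry `e` of real array `a`; `cast` converts an
index to a real; `app f e` applies the primitive `f ∈ F`. -/
inductive RExp (F : Set (ℝ → ℝ)) : Type
  | const (c : ℤ)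
  | reg (x : ℕ)
  | cast (e : IExp)
  | get (a : ℕ) (e : IExp)
  | add (e₁ e₂ : RExp F)
  | sub (e₁ e₂ : RExp F)
  | mul (e₁ e₂ : RExp F)
  | div (e₁ e₂ : RExp F)
  | app (f : F) (e : RExp F)

/-- Comparisons of indices and of reals. -/
inductive Test (F : Set (ℝ → ℝ)) : Type
  | ilt (e₁ e₂ : IExp)
  | rlt (e₁ e₂ : RExp F)

/-- Programs. `call body args x` runs `body` as a subroutine on fresh memory, and
`query args x` asks the oracle; in both cases the input consists of the real arrays listed in
`args` (each given by the number of the array and the index register holding its length), passed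
by value, and the real number returned is stored in real register `x`. -/
inductive Prog (F : Set (ℝ → ℝ)) : Type
  | skip
  | iset (i : ℕ) (e : IExp)
  | rset (x : ℕ) (e : RExp F)
  | iput (a : ℕ) (pos e : IExp)
  | rput (a : ℕ) (pos : IExp) (e : RExp F)
  | seq (p q : Prog F)
  | ite (b : Test F) (p q : Prog F)
  | while (b : Test F) (p : Prog F)
  | call (body : Prog F) (args : List (ℕ × ℕ)) (x : ℕ)
  | query (args : List (ℕ × ℕ)) (x : ℕ)

/-- The value of an index expression. -/
def IExp.eval (s : RamState) : IExp → ℕ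
  | .const c => c
  | .reg i => s.idx i
  | .get a e => s.iarr a (e.eval s)
  | .add e₁ e₂ => e₁.eval s + e₂.eval s
  | .sub e₁ e₂ => e₁.eval s - e₂.eval s

/-- The cost of an index expression: its number of nodes. -/
def IExp.cost : IExp → ℕ
  | .const _ => 1
  | .reg _ => 1
  | .get _ e => e.cost + 1
  | .add e₁ e₂ => e₁.cost + e₂.cost + 1
  | .sub e₁ e₂ => e₁.cost + e₂.cost + 1

/-- The value of a real expression. -/
noncomputable def RExp.eval {F : Set (ℝ → ℝ)} (s : RamState) : RExp F → ℝ
  | .const c => (c : ℝ)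
  | .reg x => s.val x
  | .cast e => (e.eval s : ℝ)
  | .get a e => s.rarr a (e.eval s)
  | .add e₁ e₂ => e₁.eval s + e₂.eval s
  | .sub e₁ e₂ => e₁.eval s - e₂.eval s
  | .mul e₁ e₂ => e₁.eval s * e₂.eval s
  | .div e₁ e₂ => e₁.eval s / e₂.eval s
  | .app f e => (f : ℝ → ℝ) (e.eval s)

/-- The cost of a real expression: its number of nodes. -/
def RExp.cost {F : Set (ℝ → ℝ)} : RExp F → ℕ
  | .const _ => 1
  | .reg _ => 1
  | .cast e => e.cost + 1
  | .get _ e => e.cost + 1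
  | .add e₁ e₂ => e₁.cost + e₂.cost + 1
  | .sub e₁ e₂ => e₁.cost + e₂.cost + 1
  | .mul e₁ e₂ => e₁.cost + e₂.cost + 1
  | .div e₁ e₂ => e₁.cost + e₂.cost + 1
  | .app _ e => e.cost + 1

/-- The truth value of a test. -/
def Test.holds {F : Set (ℝ → ℝ)} (s : RamState) : Test F → Prop
  | .ilt e₁ e₂ => e₁.eval s < e₂.eval s
  | .rlt e₁ e₂ => e₁.eval s < e₂.eval s

/-- The cost of a test. -/
def Test.cost {F : Set (ℝ → ℝ)} : Test F → ℕ
  | .ilt e₁ e₂ => e₁.cost + e₂.cost + 1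
  | .rlt e₁ e₂ => e₁.cost + e₂.cost + 1

/-- The memory at the start of a program whose input is the list `L` of real arrays: array `k` is
stored in real array `k`, its length in index register `k`, and everything else is `0`. -/
noncomputable def RamState.init (L : List (List ℝ)) : RamState where
  idx k := (L.getD k []).length
  val _ := 0
  iarr _ _ := 0
  rarr k j := (L.getD k []).getD j 0

/-- The arrays passed to a subroutine or to the oracle. -/
def RamState.pass (s : RamState) (args : List (ℕ × ℕ)) : List (List ℝ) :=
  args.map fun a => (List.range (s.idx a.2)).map (s.rarr a.1)

/-- The cost of passing arrays: their number plus their total length. -/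
def passCost (L : List (List ℝ)) : ℕ := L.length + (L.map List.length).sum

/-- Store a real number in a real register. -/
def RamState.setVal (s : RamState) (x : ℕ) (y : ℝ) : RamState :=
  { s with val := Function.update s.val x y }

/-- Store a natural number in an index register. -/
def RamState.setIdx (s : RamState) (i : ℕ) (k : ℕ) : RamState :=
  { s with idx := Function.update s.idx i k }

/-- Store a natural number in an index array. -/
def RamState.setIarr (s : RamState) (a j : ℕ) (k : ℕ) : RamState :=
  { s with iarr := Function.update s.iarr a (Function.update (s.iarr a) j k) }

/-- Store a real number in a real array. -/
def RamState.setRarr (s : RamState) (a j : ℕ) (y : ℝ) : RamState :=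
  { s with rarr := Function.update s.rarr a (Function.update (s.rarr a) j y) }

/-- An oracle maps an input to an answer, or to `none` when it does not answer; a program that
asks a question without answer is stuck. -/
abbrev Oracle : Type := List (List ℝ) → Option ℝ

/-- `Exec O p s s' t Q`: with oracle `O`, the program `p` started in `s` halts in `s'` after `t`
steps, and `Q` is the list of the questions that it put to the oracle. -/
inductive Exec {F : Set (ℝ → ℝ)} (O : Oracle) :
    Prog F → RamState → RamState → ℕ → List (List (List ℝ)) → Prop
  | skip (s : RamState) : Exec O .skip s s 1 []
  | iset (s : RamState) (i : ℕ) (e : IExp) :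
      Exec O (.iset i e) s (s.setIdx i (e.eval s)) (e.cost + 1) []
  | rset (s : RamState) (x : ℕ) (e : RExp F) :
      Exec O (.rset x e) s (s.setVal x (e.eval s)) (e.cost + 1) []
  | iput (s : RamState) (a : ℕ) (pos e : IExp) :
      Exec O (.iput a pos e) s (s.setIarr a (pos.eval s) (e.eval s)) (pos.cost + e.cost + 1) []
  | rput (s : RamState) (a : ℕ) (pos : IExp) (e : RExp F) :
      Exec O (.rput a pos e) s (s.setRarr a (pos.eval s) (e.eval s)) (pos.cost + e.cost + 1) []
  | seq {p q : Prog F} {s s' s'' : RamState} {t t' : ℕ} {Q Q' : List (List (List ℝ))}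
      (hp : Exec O p s s' t Q) (hq : Exec O q s' s'' t' Q') :
      Exec O (.seq p q) s s'' (t + t') (Q ++ Q')
  | ite_true {b : Test F} {p q : Prog F} {s s' : RamState} {t : ℕ} {Q : List (List (List ℝ))}
      (hb : b.holds s) (hp : Exec O p s s' t Q) :
      Exec O (.ite b p q) s s' (b.cost + t) Q
  | ite_false {b : Test F} {p q : Prog F} {s s' : RamState} {t : ℕ} {Q : List (List (List ℝ))}
      (hb : ¬ b.holds s) (hq : Exec O q s s' t Q) :
      Exec O (.ite b p q) s s' (b.cost + t) Q
  | while_false {b : Test F} {p : Prog F} {s : RamState} (hb : ¬ b.holds s) :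
      Exec O (.while b p) s s b.cost []
  | while_true {b : Test F} {p : Prog F} {s s' s'' : RamState} {t t' : ℕ}
      {Q Q' : List (List (List ℝ))} (hb : b.holds s) (hp : Exec O p s s' t Q)
      (hw : Exec O (.while b p) s' s'' t' Q') :
      Exec O (.while b p) s s'' (b.cost + t + t') (Q ++ Q')
  | call {body : Prog F} {s s' : RamState} {t : ℕ} {Q : List (List (List ℝ))}
      (args : List (ℕ × ℕ)) (x : ℕ) (hp : Exec O body (RamState.init (s.pass args)) s' t Q) :
      Exec O (.call body args x) s (s.setVal x (s'.val 0)) (passCost (s.pass args) + t + 1) Q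
  | query {s : RamState} {y : ℝ} (args : List (ℕ × ℕ)) (x : ℕ) (hy : O (s.pass args) = some y) :
      Exec O (.query args x) s (s.setVal x y) (passCost (s.pass args) + 1) [s.pass args]

/-! ## Problems, subquadratic algorithms and 3SUM-hardness -/

/-- A computational problem: its instances, their encoding as input of a real RAM, their size, and
the relation saying which real numbers are correct answers to an instance. -/
structure RamProblem where
  Inst : Type
  encode : Inst → List (List ℝ)
  size : Inst → ℕ
  Correct : Inst → ℝ → Prop

/-- `f` is a (truly) subquadratic function: `f n = O(n ^ (2 - δ))` for some `δ > 0`. -/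
def Subquadratic (f : ℕ → ℕ) : Prop :=
  ∃ δ : ℝ, 0 < δ ∧ (fun n => (f n : ℝ)) =O[atTop] fun n => (n : ℝ) ^ (2 - δ)

/-- Some program that uses no oracle solves all instances of `A` in subquadratic worst-case time.
The answer is read off real register `0`. -/
def SolvableInSubquadraticTime (F : Set (ℝ → ℝ)) (A : RamProblem) : Prop :=
  ∃ (p : Prog F) (f : ℕ → ℕ), Subquadratic f ∧
    ∀ I : A.Inst, ∃ (s : RamState) (t : ℕ),
      Exec (fun _ => none) p (RamState.init (A.encode I)) s t [] ∧
      A.Correct I (s.val 0) ∧ t ≤ f (A.size I)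

/-- The oracle `O` answers every instance of `B` correctly. -/
def IsOracleFor (O : Oracle) (B : RamProblem) : Prop :=
  ∀ J : B.Inst, ∃ y, O (B.encode J) = some y ∧ B.Correct J y

/-- Every instance of `A` of size `n` can be solved by using a constant number of instances of `B`
of size `O(n)` and subquadratic additional time, whichever correct answers are given. -/
def SubquadraticallyReducible (F : Set (ℝ → ℝ)) (A B : RamProblem) : Prop :=
  ∃ (p : Prog F) (f : ℕ → ℕ) (k C : ℕ), Subquadratic f ∧
    ∀ O : Oracle, IsOracleFor O B → ∀ I : A.Inst,
      ∃ (s : RamState) (t : ℕ) (Q : List (List (List ℝ))),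
        Exec O p (RamState.init (A.encode I)) s t Q ∧
        A.Correct I (s.val 0) ∧ t ≤ f (A.size I) ∧ Q.length ≤ k ∧
        ∀ L ∈ Q, ∃ J : B.Inst, L = B.encode J ∧ B.size J ≤ C * (A.size I + 1)

/-- The 3SUM problem: given a finite set `S` of reals, listed in arbitrary order, are there
`a, b, c ∈ S` with `a + b + c = 0`? The answer is `1` for yes and `0` for no. -/
def threeSum : RamProblem where
  Inst := {S : List ℝ // S.Nodup}
  encode S := [S.1]
  size S := S.1.length
  Correct S y :=
    (y = 1 ∧ ∃ a ∈ S.1, ∃ b ∈ S.1, ∃ c ∈ S.1, a + b + c = 0) ∨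
    (y = 0 ∧ ¬ ∃ a ∈ S.1, ∃ b ∈ S.1, ∃ c ∈ S.1, a + b + c = 0)

/-- 3SUM-hardness. -/
def IsThreeSumHard (F : Set (ℝ → ℝ)) (B : RamProblem) : Prop :=
  SubquadraticallyReducible F threeSum B

/-! ## The Fixed MCR problem

The plane is identified with `ℂ`. -/

/-- A polygon is simple if it has at least three vertices, its vertices are distinct, and distinct
edges have no common points except common endpoints. -/
def IsSimplePolygon {m : ℕ} (P : Polygon ℂ m) : Prop :=
  3 ≤ m ∧ Function.Injective P.vertices ∧
    ∀ i j : Fin m, i ≠ j → P.edgeSet ℝ i ∩ P.edgeSet ℝ j ⊆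
      {P.vertices i, P.vertices (finRotate m i)} ∩ {P.vertices j, P.vertices (finRotate m j)}

/-- The closed region bounded by a polygon: the boundary together with all points whose connected
component in the complement of the boundary is bounded. -/
def polygonRegion {m : ℕ} (P : Polygon ℂ m) : Set ℂ :=
  P.boundary ℝ ∪
    {z | z ∉ P.boundary ℝ ∧ Bornology.IsBounded (connectedComponentIn (P.boundary ℝ)ᶜ z)}

/-- Clockwise rotation around `r` by the angle `θ`. -/
noncomputable def rotateCW (r : ℂ) (θ : ℝ) (z : ℂ) : ℂ :=
  r + Complex.exp (-(θ * Complex.I)) * (z - r)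

/-- An instance of Fixed MCR: a center, a simple polygon, and a finite point set, listed in
arbitrary order. -/
structure FixedMCRInst where
  center : ℂ
  m : ℕ
  polygon : Polygon ℂ m
  simple : IsSimplePolygon polygon
  points : List ℂ
  nodup : points.Nodup

/-- The number of given points contained in the polygon after it is rotated clockwise by `θ`. -/
noncomputable def FixedMCRInst.covered (J : FixedMCRInst) (θ : ℝ) : ℕ :=
  {z | z ∈ J.points ∧ z ∈ rotateCW J.center θ '' polygonRegion J.polygon}.ncard

/-- The Fixed MCR problem. The input consists of the coordinates of the center, the abscissas and
the ordinates of the polygon's vertices in cyclic order, and those of the points; its size is the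
number of points plus the number of vertices. -/
noncomputable def fixedMCR : RamProblem where
  Inst := FixedMCRInst
  encode J :=
    [[J.center.re, J.center.im],
      List.ofFn fun i => (J.polygon.vertices i).re,
      List.ofFn fun i => (J.polygon.vertices i).im,
      J.points.map Complex.re,
      J.points.map Complex.im]
  size J := J.points.length + J.m
  Correct J θ :=
    θ ∈ Set.Ico 0 (2 * Real.pi) ∧
    ∀ φ ∈ Set.Ico 0 (2 * Real.pi), J.covered φ ≤ J.covered θ

/-! 3SUM is first encoded by translations of a line. The line is then wrapped onto a short arc of
the unit circle around the center of rotation, where translation by v becomes rotation by `angle n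
v`.

After sorting and scaling, the numbers are a_0 < ... < a_{n-1} with |a_i| ≤ 1/10. The good positions
are three windows [-n-1.3, -0.6], [0.6, n+1.4], [n+2.6, 2n+4] and, in the two gaps between them, the
isolated positions a_j (around 0) and n+2-a_l (around n+2). The points are i+1 and its partner
n+3+i+a_i for each i < n, and guards at -1 and 2n+4.7. Suppose that translation by -v makes all
points good. The guards force 0.7 ≤ v ≤ n+0.3, so some point i+1 lands within 1/2 of 0 and must hit
an isolated position: i+1-v = a_j. Its partner then lands at n+2+a_i+a_j, inside the second gap, and
must equal some n+2-a_l, whence a_i+a_j+a_l = 0. Conversely, v = i+1-a_j sends all other points into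
windows. Hence all 2n+2 points can be covered exactly when there is a zero triple
(`IsScaled.exists_triple_of_allGood`, `IsScaled.allGood_of_triple`).

The good set is realized as the trace of a polygon on the circle. Between consecutive isolated
positions the polygon follows a chord, which meets the circle only in its ends; over a window it
follows two tangents, which leave the whole arc inside (`IsTips.circ_mem_region_iff`). The polygon
is an arch over the real axis, so its simplicity and its region can be determined by hand
(`IsArch.isSimplePolygon`, `IsArch.mem_region`).

An oracle for Fixed MCR returns an angle, not a count. The program therefore reads i and a_j off the
angle and tests in linear time whether they extend to a zero triple. The test is sound for every
angle, and an optimal angle passes it whenever a triple exists. Sorting is needed because the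
vertices must be listed in cyclic order; selection with blocks of length about √n does it in time
O(n^(3/2)), and the rest is linear. For the second claim, a deterministic program for Fixed MCR
defines an oracle, and calls of the program replace the questions
(`SubquadraticallyReducible.solvable`). -/

/-! ### Arch polygons: simplicity and the enclosed region. -/

/-- The vertices `v 0, …, v K` form a chain with increasing abscissas above the real axis that
starts and ends on the real axis. -/
structure IsArch (v : ℕ → ℂ) (K : ℕ) : Prop where
  two_le : 2 ≤ K
  re_lt : ∀ k < K, (v k).re < (v (k + 1)).re
  im_zero : (v 0).im = 0
  im_last : (v K).im = 0
  im_pos : ∀ k, 0 < k → k < K → 0 < (v k).im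

/-- The polygon with vertices `v 0, …, v K`. -/
def archPolygon (v : ℕ → ℂ) (K : ℕ) : Polygon ℂ (K + 1) := ⟨fun i => v i⟩

theorem archPolygon_edgeSet_of_lt (v : ℕ → ℂ) (K : ℕ) (i : Fin (K + 1)) (h : (i : ℕ) < K) :
    (archPolygon v K).edgeSet ℝ i = segment ℝ (v i) (v (i + 1)) := by
  have : ((finRotate (K + 1) i : Fin (K + 1)) : ℕ) = i + 1 :=
    coe_finRotate_of_ne_last (by rintro rfl; simp at h)
  simp [Polygon.edgeSet, archPolygon, affineSegment_eq_segment, this, -finRotate_apply]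

theorem archPolygon_edgeSet_last (v : ℕ → ℂ) (K : ℕ) :
    (archPolygon v K).edgeSet ℝ (Fin.last K) = segment ℝ (v K) (v 0) := by
  simp [Polygon.edgeSet, archPolygon, affineSegment_eq_segment]

theorem exists_mem_segment_re {z w : ℂ} (h : z.re < w.re) {x : ℝ} (hx : z.re ≤ x) (hx' : x ≤ w.re) :
    ∃ u ∈ segment ℝ z w, u.re = x := by
  have hd : 0 < w.re - z.re := by linarith
  have ht : 0 ≤ (x - z.re) / (w.re - z.re) := by apply div_nonneg <;> linarith
  have ht' : (x - z.re) / (w.re - z.re) ≤ 1 := by rw [div_le_one hd]; linarith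
  refine ⟨_, ⟨1 - (x - z.re) / (w.re - z.re), _, by linarith, ht, by ring, rfl⟩, ?_⟩
  simp only [Complex.add_re, Complex.real_smul, Complex.mul_re, Complex.ofReal_re,
    Complex.ofReal_im, zero_mul, sub_zero]
  field_simp
  ring

theorem re_mem_Icc_of_mem_segment {z w u : ℂ} (h : z.re ≤ w.re) (hu : u ∈ segment ℝ z w) :
    z.re ≤ u.re ∧ u.re ≤ w.re := by
  obtain ⟨a, b, ha, hb, hab, rfl⟩ := hu
  have : a = 1 - b := by linarith
  subst this
  constructor <;> simp <;> nlinarith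

/-- The chain of an arch is the graph of a continuous function. -/
theorem exists_chain_function (v : ℕ → ℂ) (K : ℕ) (hv : ∀ k < K, (v k).re < (v (k + 1)).re) :
    ∃ h : ℝ → ℝ, Continuous h ∧ (h (v K).re = (v K).im) ∧
      ∀ i < K, ∀ w ∈ segment ℝ (v i) (v (i + 1)), h w.re = w.im := by
  induction K with
  | zero => exact ⟨fun _ => (v 0).im, continuous_const, rfl, by simp⟩
  | succ K ih =>
    obtain ⟨h, hc, hK, hh⟩ := ih fun k hk => hv k (by omega)
    have hlt := hv K (by omega)
    have hmono : ∀ i, i ≤ K → (v i).re ≤ (v K).re := by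
      intro i hi
      induction hi using Nat.decreasingInduction with
      | self => exact le_rfl
      | of_succ k hk ih => exact (hv k (by omega)).le.trans ih
    let l : ℝ → ℝ := fun x =>
      (v K).im + (x - (v K).re) * (((v (K + 1)).im - (v K).im) / ((v (K + 1)).re - (v K).re))
    have hl : ∀ w ∈ segment ℝ (v K) (v (K + 1)), l w.re = w.im := by
      rintro w ⟨a, b, ha, hb, hab, rfl⟩
      have : a = 1 - b := by linarith
      subst this
      have : (v (K + 1)).re - (v K).re ≠ 0 := by linarith
      simp [l]
      field_simp
      ring
    -- The line through the new edge continues the old function; the two agree at the vertex `v K`.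
    -- Being defined on all of ℝ, the function is continuous without any restriction of the domain.
    refine ⟨fun x => if x ≤ (v K).re then h x else l x, ?_, ?_, ?_⟩
    · refine Continuous.if_le hc (by fun_prop) continuous_id continuous_const ?_
      rintro x rfl
      rw [hK, hl _ (left_mem_segment _ _ _)]
    · simp only [not_le.mpr hlt, if_false]
      exact hl _ (right_mem_segment _ _ _)
    · intro i hi w hw
      have hre := re_mem_Icc_of_mem_segment (hv i hi).le hw
      rcases Nat.lt_succ_iff_lt_or_eq.mp hi with hi | rfl
      · have := hmono (i + 1) hi
        simp only [hre.2.trans this, if_true]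
        exact hh i hi w hw
      · simp only
        split_ifs with h1
        · have h2 : w.re = (v i).re := le_antisymm h1 hre.1
          rw [h2, hK, ← hl _ hw, h2, hl _ (left_mem_segment _ _ _)]
        · exact hl _ hw

namespace IsArch

variable {v : ℕ → ℂ} {K : ℕ}

theorem re_mono (A : IsArch v K) {i j : ℕ} (hij : i ≤ j) (hj : j ≤ K) : (v i).re ≤ (v j).re := by
  induction hij using Nat.decreasingInduction with
  | self => exact le_rfl
  | of_succ k hk ih => exact (A.re_lt k (by omega)).le.trans ih

theorem re_strictMono (A : IsArch v K) {i j : ℕ} (hij : i < j) (hj : j ≤ K) :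
    (v i).re < (v j).re :=
  (A.re_lt i (by omega)).trans_le (A.re_mono hij hj)

theorem mem_base (A : IsArch v K) {z : ℂ} :
    z ∈ segment ℝ (v K) (v 0) ↔ z.im = 0 ∧ (v 0).re ≤ z.re ∧ z.re ≤ (v K).re := by
  have hlt := A.re_strictMono (by have := A.two_le; omega : 0 < K) le_rfl
  rw [segment_symm]
  have him : ∀ u ∈ segment ℝ (v 0) (v K), u.im = 0 := by
    rintro u ⟨a, b, ha, hb, hab, rfl⟩
    simp [A.im_zero, A.im_last]
  refine ⟨fun h => ⟨him z h, re_mem_Icc_of_mem_segment hlt.le h⟩, ?_⟩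
  rintro ⟨h1, h2, h3⟩
  obtain ⟨u, hu, hu'⟩ := exists_mem_segment_re hlt h2 h3
  have : z = u := Complex.ext hu'.symm (by rw [h1, him u hu])
  rwa [this]

theorem exists_edge (A : IsArch v K) {x : ℝ} (h0 : (v 0).re ≤ x) (h1 : x ≤ (v K).re) :
    ∃ i < K, ∃ w ∈ segment ℝ (v i) (v (i + 1)), w.re = x := by
  have key : ∀ k ≤ K, 0 < k → x ≤ (v k).re →
      ∃ i < K, ∃ w ∈ segment ℝ (v i) (v (i + 1)), w.re = x := by
    intro k
    induction k with
    | zero => simp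
    | succ k ih =>
      intro hk _ hx
      by_cases h : x ≤ (v k).re
      · rcases Nat.eq_zero_or_pos k with rfl | hpos
        · exact ⟨0, by omega, v 0, left_mem_segment _ _ _, le_antisymm h0 h⟩
        · exact ih (by omega) hpos h
      · exact ⟨k, hk, exists_mem_segment_re (A.re_lt k hk) (not_le.mp h).le hx⟩
  exact key K le_rfl (by have := A.two_le; omega) h1

theorem im_nonneg (A : IsArch v K) {i : ℕ} (hi : i ≤ K) : 0 ≤ (v i).im := by
  rcases Nat.eq_zero_or_pos i with rfl | h0
  · exact A.im_zero.ge
  · rcases hi.eq_or_lt with rfl | h1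
    · exact A.im_last.ge
    · exact (A.im_pos i h0 h1).le

theorem im_nonneg_of_mem (A : IsArch v K) {i : ℕ} (hi : i < K) {w : ℂ}
    (hw : w ∈ segment ℝ (v i) (v (i + 1))) : 0 ≤ w.im := by
  obtain ⟨a, b, ha, hb, hab, rfl⟩ := hw
  have h1 := A.im_nonneg hi.le
  have h2 := A.im_nonneg (Nat.succ_le_of_lt hi)
  simp only [Complex.add_im, Complex.real_smul, Complex.mul_im, Complex.ofReal_re,
    Complex.ofReal_im, zero_mul, add_zero]
  positivity

theorem re_mem_of_mem (A : IsArch v K) {i : ℕ} (hi : i < K) {w : ℂ}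
    (hw : w ∈ segment ℝ (v i) (v (i + 1))) : (v 0).re ≤ w.re ∧ w.re ≤ (v K).re := by
  have h := re_mem_Icc_of_mem_segment (A.re_lt i hi).le hw
  exact ⟨(A.re_mono (Nat.zero_le i) hi.le).trans h.1, h.2.trans (A.re_mono hi le_rfl)⟩

/-- Ordinates on an edge are convex combinations of nonnegative numbers, and inner vertices have
positive ordinate, so the whole weight sits on an end of the chain. This controls the contact of the
chain with the base edge. -/
theorem eq_end_of_im_eq_zero (A : IsArch v K) {i : ℕ} (hi : i < K) {w : ℂ}
    (hw : w ∈ segment ℝ (v i) (v (i + 1))) (h0 : w.im = 0) :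
    (i = 0 ∧ w = v 0) ∨ (i + 1 = K ∧ w = v K) := by
  obtain ⟨a, b, ha, hb, hab, rfl⟩ := hw
  have h1 := A.im_nonneg hi.le
  have h2 := A.im_nonneg (Nat.succ_le_of_lt hi)
  have hK := A.two_le
  simp only [Complex.add_im, Complex.real_smul, Complex.mul_im, Complex.ofReal_re,
    Complex.ofReal_im, zero_mul, add_zero] at h0
  have ha' := mul_nonneg ha h1
  have hb' := mul_nonneg hb h2
  rcases Nat.eq_zero_or_pos i with rfl | hpos
  · left
    have h3 := A.im_pos 1 (by omega) (by omega)
    have : b = 0 := by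
      rcases mul_eq_zero.mp (show b * (v (0 + 1)).im = 0 by linarith) with h | h
      · exact h
      · simp at h; linarith
    subst this
    simp at hab
    simp [hab]
  · right
    have h3 := A.im_pos i (by omega) (by omega)
    have : a = 0 := by
      rcases mul_eq_zero.mp (show a * (v i).im = 0 by linarith) with h | h
      · exact h
      · linarith
    subst this
    simp at hab
    subst hab
    have : i + 1 = K := by
      by_contra hne
      have := A.im_pos (i + 1) (by omega) (by omega)
      linarith
    subst this
    simp

/-- Abscissas increase along the chain, so two chain edges can only share the vertex between them;
the base edge touches the chain only at its two ends. -/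
theorem isSimplePolygon (A : IsArch v K) : IsSimplePolygon (archPolygon v K) := by
  have hK := A.two_le
  obtain ⟨h, -, -, hh⟩ := exists_chain_function v K A.re_lt
  have hinj : Function.Injective (archPolygon v K).vertices := by
    intro i j hij
    have hij : v i = v j := hij
    rcases lt_trichotomy (i : ℕ) j with hlt | heq | hlt
    · exact absurd (congrArg Complex.re hij) (A.re_strictMono hlt (by omega)).ne
    · exact Fin.ext heq
    · exact absurd (congrArg Complex.re hij) (A.re_strictMono hlt (by omega)).ne'
  refine ⟨by omega, hinj, ?_⟩
  have key : ∀ i j : Fin (K + 1), i < j →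
      (archPolygon v K).edgeSet ℝ i ∩ (archPolygon v K).edgeSet ℝ j ⊆
      {(archPolygon v K).vertices i, (archPolygon v K).vertices (finRotate (K + 1) i)} ∩
      {(archPolygon v K).vertices j, (archPolygon v K).vertices (finRotate (K + 1) j)} := by
    rintro i j hij z ⟨hzi, hzj⟩
    have hij' : (i : ℕ) < j := hij
    have hiK : (i : ℕ) < K := by omega
    have hri : ((finRotate (K + 1) i : Fin (K + 1)) : ℕ) = i + 1 :=
      coe_finRotate_of_ne_last (by rintro rfl; simp at hiK)
    rw [archPolygon_edgeSet_of_lt _ _ _ hiK] at hzi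
    by_cases hjK : (j : ℕ) < K
    · have hrj : ((finRotate (K + 1) j : Fin (K + 1)) : ℕ) = j + 1 :=
        coe_finRotate_of_ne_last (by rintro rfl; simp at hjK)
      rw [archPolygon_edgeSet_of_lt _ _ _ hjK] at hzj
      have h1 := re_mem_Icc_of_mem_segment (A.re_lt i hiK).le hzi
      have h2 := re_mem_Icc_of_mem_segment (A.re_lt j hjK).le hzj
      have h3 := A.re_mono (Nat.succ_le_of_lt hij') (by omega)
      have hj : (j : ℕ) = i + 1 := by
        by_contra hne
        have := A.re_strictMono (show (i : ℕ) + 1 < j by omega) (by omega)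
        linarith
      have hz : z = v j := by
        have hre : z.re = (v j).re := le_antisymm (h1.2.trans h3) h2.1
        refine Complex.ext hre ?_
        rw [← hh _ hjK _ hzj, hre, hh _ hjK _ (left_mem_segment _ _ _)]
      subst hz
      simp [archPolygon, hri, hj, -finRotate_apply]
    · have hj : j = Fin.last K := Fin.ext (by simp; omega)
      subst hj
      rw [archPolygon_edgeSet_last, A.mem_base] at hzj
      rcases A.eq_end_of_im_eq_zero hiK hzi hzj.1 with ⟨h0, rfl⟩ | ⟨h0, rfl⟩
      · simp [archPolygon, h0]
      · simp [archPolygon, hri, h0, -finRotate_apply]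
  intro i j hij
  rcases lt_or_gt_of_ne hij with hlt | hlt
  · exact key i j hlt
  · rw [Set.inter_comm, Set.inter_comm {_, _}]
    exact key j i hlt

theorem mem_boundary (A : IsArch v K) {z : ℂ} :
    z ∈ (archPolygon v K).boundary ℝ ↔
      (∃ i < K, z ∈ segment ℝ (v i) (v (i + 1))) ∨
      (z.im = 0 ∧ (v 0).re ≤ z.re ∧ z.re ≤ (v K).re) := by
  rw [Polygon.boundary, Set.mem_iUnion, ← A.mem_base]
  constructor
  · rintro ⟨i, hi⟩
    by_cases hiK : (i : ℕ) < K
    · rw [archPolygon_edgeSet_of_lt _ _ _ hiK] at hi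
      exact Or.inl ⟨i, hiK, hi⟩
    · have : i = Fin.last K := Fin.ext (by simp; omega)
      subst this
      rw [archPolygon_edgeSet_last] at hi
      exact Or.inr hi
  · rintro (⟨i, hi, hz⟩ | hz)
    · refine ⟨⟨i, by omega⟩, ?_⟩
      rw [archPolygon_edgeSet_of_lt _ _ _ hi]
      exact hz
    · refine ⟨Fin.last K, ?_⟩
      rw [archPolygon_edgeSet_last]
      exact hz

/-- A ray is connected, so it lies in the component of its origin. Vertical rays will show that
nothing outside the arch belongs to a bounded component. -/
theorem not_isBounded_of_ray {s : Set ℂ} (z d : ℂ) (hd : d ≠ 0)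
    (h : ∀ t : ℝ, 0 ≤ t → z + t * d ∈ s) :
    ¬ Bornology.IsBounded (connectedComponentIn s z) := by
  intro hb
  have hsub : (fun t : ℝ => z + t * d) '' Set.Ici 0 ⊆ connectedComponentIn s z := by
    refine IsPreconnected.subset_connectedComponentIn ?_ ⟨0, by simp, by simp⟩ ?_
    · exact isPreconnected_Ici.image _ (by fun_prop)
    · rintro _ ⟨t, ht, rfl⟩
      exact h t ht
  obtain ⟨R, hR⟩ := (hb.subset hsub).exists_norm_le
  have hpos : 0 < ‖d‖ := norm_pos_iff.mpr hd
  have hR0 : 0 ≤ R := (norm_nonneg _).trans (hR _ ⟨0, by simp, rfl⟩)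
  have ht : 0 ≤ (R + ‖z‖ + 1) / ‖d‖ := by positivity
  have h1 := hR _ ⟨(R + ‖z‖ + 1) / ‖d‖, ht, rfl⟩
  have h2 : ‖(((R + ‖z‖ + 1) / ‖d‖ : ℝ) : ℂ) * d‖ = R + ‖z‖ + 1 := by
    rw [norm_mul, Complex.norm_real, Real.norm_of_nonneg ht]
    field_simp
  have h3 := norm_sub_norm_le ((((R + ‖z‖ + 1) / ‖d‖ : ℝ) : ℂ) * d) (-z)
  rw [sub_neg_eq_add, add_comm _ z, norm_neg, h2] at h3
  simp only at h1
  linarith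

/-- The closed region bounded by an arch polygon consists of the points above the real axis and
below the chain. -/
theorem mem_region (A : IsArch v K) {z : ℂ} :
    z ∈ polygonRegion (archPolygon v K) ↔
      ∃ i < K, ∃ w ∈ segment ℝ (v i) (v (i + 1)), w.re = z.re ∧ 0 ≤ z.im ∧ z.im ≤ w.im := by
  obtain ⟨h, hc, -, hh⟩ := exists_chain_function v K A.re_lt
  have hK : 0 < K := by have := A.two_le; omega
  set x₀ := (v 0).re with hx₀
  set x₁ := (v K).re with hx₁
  have hh0 : h x₀ = 0 := by rw [hx₀, hh 0 hK _ (left_mem_segment _ _ _), A.im_zero]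
  have hh1 : h x₁ = 0 := by
    have := hh (K - 1) (by omega) _ (right_mem_segment _ _ _)
    rw [Nat.sub_add_cancel hK] at this
    rw [hx₁, this, A.im_last]
  have hnonneg : ∀ x, x₀ ≤ x → x ≤ x₁ → 0 ≤ h x := by
    intro x h0 h1
    obtain ⟨i, hi, w, hw, rfl⟩ := A.exists_edge h0 h1
    rw [hh i hi w hw]
    exact A.im_nonneg_of_mem hi hw
  have hbd : ∀ {z : ℂ}, z ∈ (archPolygon v K).boundary ℝ ↔
      x₀ ≤ z.re ∧ z.re ≤ x₁ ∧ (z.im = 0 ∨ z.im = h z.re) := by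
    intro z
    rw [A.mem_boundary]
    constructor
    · rintro (⟨i, hi, hz⟩ | ⟨h0, h1, h2⟩)
      · have := A.re_mem_of_mem hi hz
        exact ⟨this.1, this.2, Or.inr (hh i hi z hz).symm⟩
      · exact ⟨h1, h2, Or.inl h0⟩
    · rintro ⟨h1, h2, h0 | h0⟩
      · exact Or.inr ⟨h0, h1, h2⟩
      · obtain ⟨i, hi, w, hw, hwz⟩ := A.exists_edge h1 h2
        have : z = w := Complex.ext hwz.symm (by rw [h0, ← hwz, hh i hi w hw])
        exact Or.inl ⟨i, hi, this ▸ hw⟩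
  have hrhs : (∃ i < K, ∃ w ∈ segment ℝ (v i) (v (i + 1)),
      w.re = z.re ∧ 0 ≤ z.im ∧ z.im ≤ w.im) ↔
      x₀ ≤ z.re ∧ z.re ≤ x₁ ∧ 0 ≤ z.im ∧ z.im ≤ h z.re := by
    constructor
    · rintro ⟨i, hi, w, hw, h1, h2, h3⟩
      have := A.re_mem_of_mem hi hw
      rw [← h1]
      exact ⟨this.1, this.2, h2, by rwa [hh i hi w hw]⟩
    · rintro ⟨h1, h2, h3, h4⟩
      obtain ⟨i, hi, w, hw, hwz⟩ := A.exists_edge h1 h2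
      exact ⟨i, hi, w, hw, hwz, h3, by rwa [← hh i hi w hw, hwz]⟩
  rw [hrhs]
  constructor
  · rintro (hz | ⟨hz, hbdd⟩)
    · obtain ⟨h1, h2, h3⟩ := hbd.mp hz
      have := hnonneg _ h1 h2
      rcases h3 with h3 | h3
      · exact ⟨h1, h2, h3.ge, h3 ▸ this⟩
      · exact ⟨h1, h2, h3 ▸ this, h3.le⟩
    · by_contra hcon
      -- Points below the axis escape downwards, since the boundary has no negative ordinates. Other
      -- points escape upwards: a boundary point above `z` would place `z` between the axis and the
      -- chain.
      by_cases him : z.im < 0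
      · refine not_isBounded_of_ray z (-Complex.I) (by simp) ?_ hbdd
        intro t ht hmem
        obtain ⟨h1, h2, h3⟩ := hbd.mp hmem
        have := hnonneg _ h1 h2
        simp at h1 h2 h3 this
        rcases h3 with h3 | h3 <;> linarith
      · refine not_isBounded_of_ray z Complex.I (by simp) ?_ hbdd
        intro t ht hmem
        obtain ⟨h1, h2, h3⟩ := hbd.mp hmem
        have := hnonneg _ h1 h2
        simp at h1 h2 h3 this
        refine hcon ⟨h1, h2, by linarith, ?_⟩
        rcases h3 with h3 | h3 <;> linarith
  · rintro ⟨h1, h2, h3, h4⟩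
    by_cases hz : z ∈ (archPolygon v K).boundary ℝ
    · exact Or.inl hz
    refine Or.inr ⟨hz, ?_⟩
    let U : Set ℂ := {z | x₀ < z.re ∧ z.re < x₁ ∧ 0 < z.im ∧ z.im < h z.re}
    let D : Set ℂ := {z | x₀ ≤ z.re ∧ z.re ≤ x₁ ∧ 0 ≤ z.im ∧ z.im ≤ h z.re}
    have hcre := Complex.continuous_re
    have hcim := Complex.continuous_im
    have hU : IsOpen U := by
      refine (isOpen_lt continuous_const hcre).inter ((isOpen_lt hcre continuous_const).inter
        ((isOpen_lt continuous_const hcim).inter (isOpen_lt hcim (hc.comp hcre))))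
    have hD : IsClosed D := by
      refine (isClosed_le continuous_const hcre).inter ((isClosed_le hcre continuous_const).inter
        ((isClosed_le continuous_const hcim).inter (isClosed_le hcim (hc.comp hcre))))
    have hDU : ∀ w ∈ D, w ∉ (archPolygon v K).boundary ℝ → w ∈ U := by
      rintro w ⟨g1, g2, g3, g4⟩ hw
      have e3 : w.im ≠ 0 := fun h => hw (hbd.mpr ⟨g1, g2, Or.inl h⟩)
      have e4 : w.im ≠ h w.re := fun h => hw (hbd.mpr ⟨g1, g2, Or.inr h⟩)
      have e3' := lt_of_le_of_ne g3 e3.symm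
      refine ⟨lt_of_le_of_ne g1 ?_, lt_of_le_of_ne g2 ?_, e3', lt_of_le_of_ne g4 e4⟩
      · intro h5; rw [← h5, hh0] at g4; linarith
      · intro h5; rw [h5, hh1] at g4; linarith
    -- `U` and the complement of `D` are disjoint open sets that cover the complement of the
    -- boundary, so the component of a point of `U` stays in `U`, which is bounded.
    have hsub : connectedComponentIn ((archPolygon v K).boundary ℝ)ᶜ z ⊆ U := by
      refine isPreconnected_connectedComponentIn.subset_left_of_subset_union hU hD.isOpen_compl
        ?_ ?_ ⟨z, mem_connectedComponentIn hz, hDU z ⟨h1, h2, h3, h4⟩ hz⟩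
      · rw [Set.disjoint_left]
        rintro w ⟨g1, g2, g3, g4⟩ hw
        exact hw ⟨g1.le, g2.le, g3.le, g4.le⟩
      · intro w hw
        have hw := connectedComponentIn_subset _ _ hw
        by_cases hwD : w ∈ D
        · exact Or.inl (hDU w hwD hw)
        · exact Or.inr hwD
    obtain ⟨C, hC⟩ := (isCompact_Icc (a := x₀) (b := x₁)).bddAbove_image hc.continuousOn
    refine ((Bornology.IsBounded.reProdIm (Metric.isBounded_Icc x₀ x₁)
      (Metric.isBounded_Icc 0 C)).subset ?_)
    intro w hw
    obtain ⟨g1, g2, g3, g4⟩ := hsub hw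
    exact ⟨⟨g1.le, g2.le⟩, ⟨g3.le, g4.le.trans (hC ⟨w.re, ⟨g1.le, g2.le⟩, rfl⟩)⟩⟩

end IsArch

/-! ### The unit circle: chords inside, tangents outside. -/

/-- The point of the unit circle whose clockwise angle from the positive imaginary axis is `ψ`. -/
noncomputable def circ (ψ : ℝ) : ℂ := ⟨Real.sin ψ, Real.cos ψ⟩

/-- The intersection of the tangents to the unit circle at `circ α` and `circ β`. -/
noncomputable def tangentPt (α β : ℝ) : ℂ :=
  ⟨Real.sin ((α + β) / 2) / Real.cos ((β - α) / 2), Real.cos ((α + β) / 2) / Real.cos ((β - α) / 2)⟩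

@[simp] theorem circ_re (ψ : ℝ) : (circ ψ).re = Real.sin ψ := rfl
@[simp] theorem circ_im (ψ : ℝ) : (circ ψ).im = Real.cos ψ := rfl

theorem norm_eq_one_iff_sq (z : ℂ) : ‖z‖ = 1 ↔ z.re ^ 2 + z.im ^ 2 = 1 := by
  have := Complex.sq_norm z
  rw [Complex.normSq_apply] at this
  constructor
  · intro h; rw [h] at this; linarith
  · intro h
    have h1 : ‖z‖ ^ 2 = 1 := by linarith
    have h0 := norm_nonneg z
    nlinarith

@[simp] theorem norm_circ (ψ : ℝ) : ‖circ ψ‖ = 1 := by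
  rw [norm_eq_one_iff_sq]
  simp

/-- The bound 1 is a rational substitute for π/2 that is inherited by half sums and half
differences. It keeps all angles where the cosine is positive and the sine increasing. -/
theorem abs_le_one_lt_pi {x : ℝ} (h : |x| ≤ 1) : -(Real.pi / 2) < x ∧ x < Real.pi / 2 := by
  have := Real.pi_gt_three
  rw [abs_le] at h
  constructor <;> linarith

theorem cos_pos_of_abs_le_one {x : ℝ} (h : |x| ≤ 1) : 0 < Real.cos x :=
  Real.cos_pos_of_mem_Ioo (abs_le_one_lt_pi h)

theorem sin_lt_sin_of_abs_le_one {x y : ℝ} (hx : |x| ≤ 1) (hy : |y| ≤ 1) (h : x < y) :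
    Real.sin x < Real.sin y :=
  Real.sin_lt_sin_of_lt_of_le_pi_div_two (abs_le_one_lt_pi hx).1.le (abs_le_one_lt_pi hy).2.le h

/-- A point of the unit circle that is not above a chord of the unit disc is an end of the chord. -/
theorem eq_end_of_below_chord {u w p z : ℂ} (hu : ‖u‖ ≤ 1) (hw : ‖w‖ ≤ 1) (huw : u ≠ w)
    (hp : p ∈ segment ℝ u w) (hz : ‖z‖ = 1) (hre : p.re = z.re) (h0 : 0 ≤ z.im)
    (him : z.im ≤ p.im) : z = u ∨ z = w := by
  have hp1 : ‖p‖ ≤ 1 := by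
    have := (convex_closedBall (0 : ℂ) 1).segment_subset (by simpa using hu) (by simpa using hw) hp
    simpa using this
  have h1 := Complex.sq_norm p
  rw [Complex.normSq_apply] at h1
  have h2 := (norm_eq_one_iff_sq z).mp hz
  -- On a vertical line in the upper half plane, no point of the disc is higher than the point of
  -- the circle; hence `p = z`.
  have h3 : p.im ≤ z.im := by
    have hp2 : ‖p‖ ^ 2 ≤ 1 := pow_le_one₀ (norm_nonneg p) hp1
    rw [hre] at h1
    exact (pow_le_pow_iff_left₀ (h0.trans him) h0 two_ne_zero).mp (by nlinarith)
  have h4 : p = z := Complex.ext hre (le_antisymm h3 him)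
  subst h4
  obtain ⟨a, b, ha, hb, hab, hab'⟩ := hp
  rcases ha.eq_or_lt with rfl | ha
  · right; simp at hab; simp [← hab', hab]
  rcases hb.eq_or_lt with rfl | hb
  · left; simp at hab; simp [← hab', hab]
  -- Strict convexity: an inner point of a chord has norm less than 1.
  have := norm_combo_lt_of_ne hu hw huw ha hb hab
  rw [hab'] at this
  linarith

section Tangent

variable {α β : ℝ}

theorem abs_half_diff_le (hα : |α| ≤ 1) (hβ : |β| ≤ 1) : |(β - α) / 2| ≤ 1 := by
  rw [abs_le] at *; constructor <;> linarith

theorem abs_half_sum_le (hα : |α| ≤ 1) (hβ : |β| ≤ 1) : |(α + β) / 2| ≤ 1 := by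
  rw [abs_le] at *; constructor <;> linarith

theorem tangentPt_im_pos (hα : |α| ≤ 1) (hβ : |β| ≤ 1) : 0 < (tangentPt α β).im :=
  div_pos (cos_pos_of_abs_le_one (abs_half_sum_le hα hβ))
    (cos_pos_of_abs_le_one (abs_half_diff_le hα hβ))

/-- From the point of contact one moves along the tangent by the tangent function of half the angle.
This form, with its counterpart at `β`, shows that the intersection lies between the contact points.
-/
theorem tangentPt_re_left (hα : |α| ≤ 1) (hβ : |β| ≤ 1) :
    (tangentPt α β).re = Real.sin α + Real.cos α * Real.tan ((β - α) / 2) := by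
  have h := cos_pos_of_abs_le_one (abs_half_diff_le hα hβ)
  have : (α + β) / 2 = α + (β - α) / 2 := by ring
  simp only [tangentPt]
  rw [this, Real.sin_add, Real.tan_eq_sin_div_cos]
  field_simp

theorem tangentPt_re_right (hα : |α| ≤ 1) (hβ : |β| ≤ 1) :
    (tangentPt α β).re = Real.sin β - Real.cos β * Real.tan ((β - α) / 2) := by
  have h := cos_pos_of_abs_le_one (abs_half_diff_le hα hβ)
  have : (α + β) / 2 = β - (β - α) / 2 := by ring
  simp only [tangentPt]
  rw [this, Real.sin_sub, Real.tan_eq_sin_div_cos]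
  field_simp

theorem tangentPt_re_mem (hα : |α| ≤ 1) (hβ : |β| ≤ 1) (h : α < β) :
    Real.sin α < (tangentPt α β).re ∧ (tangentPt α β).re < Real.sin β := by
  have ht : 0 < Real.tan ((β - α) / 2) :=
    Real.tan_pos_of_pos_of_lt_pi_div_two (by linarith)
      (abs_le_one_lt_pi (abs_half_diff_le hα hβ)).2
  have h1 := mul_pos (cos_pos_of_abs_le_one hα) ht
  have h2 := mul_pos (cos_pos_of_abs_le_one hβ) ht
  constructor
  · rw [tangentPt_re_left hα hβ]; linarith
  · rw [tangentPt_re_right hα hβ]; linarith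

/-- The tangent at `circ α` has the equation x sin α + y cos α = 1. Since (α + β)/2 - α = (β - α)/2,
the claim is the addition formula for the cosine. -/
theorem tangentPt_dot_left (hα : |α| ≤ 1) (hβ : |β| ≤ 1) :
    (tangentPt α β).re * Real.sin α + (tangentPt α β).im * Real.cos α = 1 := by
  have h := cos_pos_of_abs_le_one (abs_half_diff_le hα hβ)
  have h1 : Real.cos ((β - α) / 2) = Real.cos ((α + β) / 2 - α) := by ring_nf
  have h2 := Real.cos_sub ((α + β) / 2) α
  simp only [tangentPt]
  field_simp
  linarith

theorem tangentPt_dot_right (hα : |α| ≤ 1) (hβ : |β| ≤ 1) :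
    (tangentPt α β).re * Real.sin β + (tangentPt α β).im * Real.cos β = 1 := by
  have h := cos_pos_of_abs_le_one (abs_half_diff_le hα hβ)
  have h1 : Real.cos ((β - α) / 2) = Real.cos (β - (α + β) / 2) := by ring_nf
  have h2 := Real.cos_sub β ((α + β) / 2)
  simp only [tangentPt]
  field_simp
  linarith

/-- A point of the unit circle is not above a tangent. -/
theorem cos_le_im_of_mem_tangent {γ ψ : ℝ} (hγ : |γ| ≤ 1) {u w p : ℂ}
    (hu : u.re * Real.sin γ + u.im * Real.cos γ = 1)
    (hw : w.re * Real.sin γ + w.im * Real.cos γ = 1)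
    (hp : p ∈ segment ℝ u w) (hre : p.re = Real.sin ψ) : Real.cos ψ ≤ p.im := by
  obtain ⟨a, b, ha, hb, hab, rfl⟩ := hp
  have h1 := Real.cos_sub ψ γ
  have h2 := Real.cos_le_one (ψ - γ)
  have h3 := cos_pos_of_abs_le_one hγ
  simp only [Complex.add_re, Complex.real_smul, Complex.mul_re, Complex.ofReal_re,
    Complex.ofReal_im, zero_mul, sub_zero, Complex.add_im, Complex.mul_im, add_zero] at hre ⊢
  -- The segment stays on the tangent line, whereas the point of the circle has scalar product cos
  -- (ψ - γ) ≤ 1 with the normal. As cos γ > 0, this compares the ordinates.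
  have h4 : Real.sin ψ * Real.sin γ + (a * u.im + b * w.im) * Real.cos γ = 1 := by
    rw [← hre]; linear_combination a * hu + b * hw + hab
  nlinarith

theorem circ_dot_self (γ : ℝ) :
    (circ γ).re * Real.sin γ + (circ γ).im * Real.cos γ = 1 := by
  have := Real.sin_sq_add_cos_sq γ
  simp; nlinarith

end Tangent

/-! ### The polygon of the reduction

Positions on a line are transferred to the unit circle by `angle n`. The polygon meets the upper
half of the circle in isolated points, at the positions `t j` and `n + 2 - t j`, and in
three arcs, the windows. -/

/-- The clockwise angle at which the position `x` is placed. -/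
noncomputable def angle (n : ℕ) (x : ℝ) : ℝ := x / (8 * ((n : ℝ) + 1))

/-- The ends of the windows. -/
def IsWindow (n : ℕ) (α β : ℝ) : Prop :=
  (α = -n - 13 / 10 ∧ β = -(3 / 5)) ∨ (α = 3 / 5 ∧ β = (n : ℝ) + 7 / 5) ∨
    (α = (n : ℝ) + 13 / 5 ∧ β = 2 * n + 4)

/-- The positions `t 0 < ⋯ < t (n + 1)` fill the gap between the first two windows. -/
structure IsTips (n : ℕ) (t : ℕ → ℝ) : Prop where
  zero : t 0 = -(3 / 5)
  last : t (n + 1) = 3 / 5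
  lt_succ : ∀ j ≤ n, t j < t (j + 1)

/-- The positions of the polygon's vertices on the unit circle. -/
def tipSet (n : ℕ) (t : ℕ → ℝ) : Set ℝ :=
  {x | (x = -n - 13 / 10 ∨ x = 2 * n + 4) ∨ ∃ j ≤ n + 1, x = t j ∨ x = n + 2 - t j}

/-- The positions on the unit circle that belong to the polygon. -/
def goodSet (n : ℕ) (t : ℕ → ℝ) : Set ℝ :=
  {x | (∃ j ≤ n + 1, x = t j ∨ x = n + 2 - t j) ∨ ∃ α β, IsWindow n α β ∧ α ≤ x ∧ x ≤ β}

/-- The vertices of the polygon. -/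
noncomputable def gadgetVertex (n : ℕ) (t : ℕ → ℝ) (k : ℕ) : ℂ :=
  if k = 0 then ⟨-(9 / 10), 0⟩
  else if k = 1 then circ (angle n (-n - 13 / 10))
  else if k = 2 then tangentPt (angle n (-n - 13 / 10)) (angle n (-(3 / 5)))
  else if k < n + 5 then circ (angle n (t (k - 3)))
  else if k = n + 5 then tangentPt (angle n (3 / 5)) (angle n ((n : ℝ) + 7 / 5))
  else if k < 2 * n + 8 then circ (angle n ((n : ℝ) + 2 - t (2 * n + 7 - k)))
  else if k = 2 * n + 8 then tangentPt (angle n ((n : ℝ) + 13 / 5)) (angle n (2 * n + 4))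
  else if k = 2 * n + 9 then circ (angle n (2 * n + 4))
  else ⟨9 / 10, 0⟩

/-- All positions in use lie in this range, so their angles are at most 3/4. Then the sines stay
below 9/10, the abscissa of the feet of the arch, and differences of angles stay below π. -/
theorem angle_abs_le {n : ℕ} {x : ℝ} (h1 : -(6 * n + 6) ≤ x) (h2 : x ≤ 6 * n + 6) :
    |angle n x| ≤ 3 / 4 := by
  have hn : (0 : ℝ) < 8 * ((n : ℝ) + 1) := by positivity
  rw [angle, abs_le, le_div_iff₀ hn, div_le_iff₀ hn]
  constructor <;> linarith

theorem angle_lt {n : ℕ} {x y : ℝ} (h : x < y) : angle n x < angle n y := by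
  have hn : (0 : ℝ) < 8 * ((n : ℝ) + 1) := by positivity
  exact div_lt_div_of_pos_right h hn

namespace IsTips

variable {n : ℕ} {t : ℕ → ℝ}

theorem mono (T : IsTips n t) {i j : ℕ} (hij : i ≤ j) (hj : j ≤ n + 1) : t i ≤ t j := by
  induction hij using Nat.decreasingInduction with
  | self => exact le_rfl
  | of_succ k hk ih => exact (T.lt_succ k (by omega)).le.trans ih

theorem mem_Icc (T : IsTips n t) {j : ℕ} (hj : j ≤ n + 1) : -(3 / 5) ≤ t j ∧ t j ≤ 3 / 5 := by
  rw [← T.zero, ← T.last]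
  exact ⟨T.mono (Nat.zero_le j) hj, T.mono hj le_rfl⟩

theorem abs_angle_le_of_tipSet (T : IsTips n t) {x : ℝ} (hx : x ∈ tipSet n t) :
    |angle n x| ≤ 3 / 4 := by
  have hn : (0 : ℝ) ≤ n := by positivity
  rcases hx with (rfl | rfl) | ⟨j, hj, rfl | rfl⟩
  · apply angle_abs_le <;> linarith
  · apply angle_abs_le <;> linarith
  · have := T.mem_Icc hj
    apply angle_abs_le <;> linarith
  · have := T.mem_Icc hj
    apply angle_abs_le <;> linarith

theorem abs_angle_le_of_goodSet (T : IsTips n t) {x : ℝ} (hx : x ∈ goodSet n t) :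
    |angle n x| ≤ 3 / 4 := by
  have hn : (0 : ℝ) ≤ n := by positivity
  rcases hx with h | ⟨α, β, h, h1, h2⟩
  · exact T.abs_angle_le_of_tipSet (Or.inr h)
  · rcases h with ⟨rfl, rfl⟩ | ⟨rfl, rfl⟩ | ⟨rfl, rfl⟩ <;> apply angle_abs_le <;> linarith

theorem window_lt {α β : ℝ} (h : IsWindow n α β) : α < β := by
  have hn : (0 : ℝ) ≤ n := by positivity
  rcases h with ⟨rfl, rfl⟩ | ⟨rfl, rfl⟩ | ⟨rfl, rfl⟩ <;> linarith

theorem window_mem (T : IsTips n t) {α β : ℝ} (h : IsWindow n α β) :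
    α ∈ tipSet n t ∧ β ∈ tipSet n t := by
  rcases h with ⟨rfl, rfl⟩ | ⟨rfl, rfl⟩ | ⟨rfl, rfl⟩
  · exact ⟨Or.inl (Or.inl rfl), Or.inr ⟨0, by omega, Or.inl T.zero.symm⟩⟩
  · exact ⟨Or.inr ⟨n + 1, le_rfl, Or.inl T.last.symm⟩,
      Or.inr ⟨n + 1, le_rfl, Or.inr (by rw [T.last]; ring)⟩⟩
  · exact ⟨Or.inr ⟨0, by omega, Or.inr (by rw [T.zero]; ring)⟩, Or.inl (Or.inr rfl)⟩

theorem tipSet_subset {x : ℝ} (hx : x ∈ tipSet n t) : x ∈ goodSet n t := by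
  rcases hx with (rfl | rfl) | h
  · exact Or.inr ⟨_, _, Or.inl ⟨rfl, rfl⟩, le_rfl, (window_lt (n := n) (Or.inl ⟨rfl, rfl⟩)).le⟩
  · exact Or.inr ⟨_, _, Or.inr (Or.inr ⟨rfl, rfl⟩),
      (window_lt (n := n) (Or.inr (Or.inr ⟨rfl, rfl⟩))).le, le_rfl⟩
  · exact Or.inl h

/-- Every edge has one of five shapes: the two edges at the feet, chords between tips, and the left
and right tangents over a window. Later arguments use only the shape and not the index. -/
theorem edge_cases (T : IsTips n t) {k : ℕ} (hk : k < 2 * n + 10) :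
    (k = 0 ∧ gadgetVertex n t k = ⟨-(9 / 10), 0⟩ ∧
      ∃ x ∈ tipSet n t, gadgetVertex n t (k + 1) = circ (angle n x)) ∨
    (gadgetVertex n t (k + 1) = ⟨9 / 10, 0⟩ ∧
      ∃ x ∈ tipSet n t, gadgetVertex n t k = circ (angle n x)) ∨
    (∃ x ∈ tipSet n t, ∃ y ∈ tipSet n t, x < y ∧ gadgetVertex n t k = circ (angle n x) ∧
      gadgetVertex n t (k + 1) = circ (angle n y)) ∨
    (∃ α β, IsWindow n α β ∧ gadgetVertex n t k = circ (angle n α) ∧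
      gadgetVertex n t (k + 1) = tangentPt (angle n α) (angle n β)) ∨
    (∃ α β, IsWindow n α β ∧ gadgetVertex n t k = tangentPt (angle n α) (angle n β) ∧
      gadgetVertex n t (k + 1) = circ (angle n β)) := by
  by_cases h0 : k = 0
  · subst h0
    left
    exact ⟨rfl, by simp [gadgetVertex], _, Or.inl (Or.inl rfl), by simp [gadgetVertex]⟩
  by_cases h1 : k = 1
  · subst h1
    right; right; right; left
    exact ⟨_, _, Or.inl ⟨rfl, rfl⟩, by simp [gadgetVertex], by simp [gadgetVertex]⟩
  by_cases h2 : k = 2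
  · subst h2
    right; right; right; right
    exact ⟨_, _, Or.inl ⟨rfl, rfl⟩, by simp [gadgetVertex], by simp [gadgetVertex, T.zero]⟩
  by_cases h3 : k < n + 4
  · right; right; left
    refine ⟨t (k - 3), Or.inr ⟨k - 3, by omega, Or.inl rfl⟩, t (k - 3 + 1),
      Or.inr ⟨k - 3 + 1, by omega, Or.inl rfl⟩, T.lt_succ _ (by omega), ?_, ?_⟩
    · simp [gadgetVertex, h0, h1, h2, show k < n + 5 by omega]
    · simp [gadgetVertex, h0, h3, show k + 1 ≠ 2 by omega,
        show k + 1 - 3 = k - 3 + 1 by omega]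
  by_cases h4 : k = n + 4
  · subst h4
    right; right; right; left
    refine ⟨_, _, Or.inr (Or.inl ⟨rfl, rfl⟩), ?_, ?_⟩
    · simp [gadgetVertex, T.last]
    · simp [gadgetVertex]
  by_cases h5 : k = n + 5
  · subst h5
    right; right; right; right
    refine ⟨_, _, Or.inr (Or.inl ⟨rfl, rfl⟩), ?_, ?_⟩
    · simp [gadgetVertex]
    · have : 2 * n + 7 - (n + 5 + 1) = n + 1 := by omega
      have h : n + 5 + 1 < 2 * n + 8 := by omega
      have e : (n : ℝ) + 2 - 3 / 5 = n + 7 / 5 := by ring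
      simp [gadgetVertex, this, T.last, h, e]
  by_cases h6 : k < 2 * n + 7
  · right; right; left
    -- On the mirrored side the tips are used in reverse order, so that the positions `n + 2 - t j`
    -- increase along the chain.
    have e : 2 * n + 7 - k = 2 * n + 7 - (k + 1) + 1 := by omega
    refine ⟨(n : ℝ) + 2 - t (2 * n + 7 - k), Or.inr ⟨2 * n + 7 - k, by omega, Or.inr rfl⟩,
      (n : ℝ) + 2 - t (2 * n + 7 - (k + 1)),
      Or.inr ⟨2 * n + 7 - (k + 1), by omega, Or.inr rfl⟩, ?_, ?_, ?_⟩
    · have := T.lt_succ (2 * n + 7 - (k + 1)) (by omega)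
      rw [e]; linarith
    · simp [gadgetVertex, h0, h1, h2, h5, show ¬ k < n + 5 by omega, show k < 2 * n + 8 by omega]
    · simp [gadgetVertex, h0, show k + 1 ≠ 2 by omega, show ¬ k + 1 < n + 5 by omega,
        show k ≠ n + 4 by omega, show k + 1 < 2 * n + 8 by omega]
  by_cases h7 : k = 2 * n + 7
  · subst h7
    right; right; right; left
    refine ⟨_, _, Or.inr (Or.inr ⟨rfl, rfl⟩), ?_, ?_⟩
    · have h : ¬ 2 * n + 7 < n + 5 := by omega
      have h' : 2 * n + 7 ≠ n + 5 := by omega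
      have e : (n : ℝ) + 2 + 3 / 5 = n + 13 / 5 := by ring
      simp [gadgetVertex, T.zero, h, h', e]
    · have h : ¬ 2 * n + 7 + 1 < n + 5 := by omega
      simp [gadgetVertex, h]
      intro; omega
  by_cases h8 : k = 2 * n + 8
  · subst h8
    right; right; right; right
    have h : ¬ 2 * n + 8 < n + 5 := by omega
    have h' : 2 * n + 8 ≠ n + 5 := by omega
    have g : ¬ 2 * n + 8 + 1 < n + 5 := by omega
    exact ⟨_, _, Or.inr (Or.inr ⟨rfl, rfl⟩), by simp [gadgetVertex, h, h'],
      by simp [gadgetVertex, g]; intro; omega⟩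
  · have : k = 2 * n + 9 := by omega
    subst this
    right; left
    have h : ¬ 2 * n + 9 < n + 5 := by omega
    have h' : 2 * n + 9 ≠ n + 5 := by omega
    have g : ¬ 2 * n + 9 + 1 < n + 5 := by omega
    exact ⟨by simp [gadgetVertex, g]; intro; omega, _, Or.inl (Or.inr rfl), by simp [gadgetVertex, h, h']⟩

theorem sin_mem_of_tipSet (T : IsTips n t) {x : ℝ} (hx : x ∈ tipSet n t) :
    -(9 / 10) < Real.sin (angle n x) ∧ Real.sin (angle n x) < 9 / 10 := by
  have h := T.abs_angle_le_of_tipSet hx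
  have h' := Real.abs_sin_le_abs (x := angle n x)
  have h2 := abs_le.mp (h'.trans h)
  constructor <;> linarith

theorem abs_le_one_of_tipSet (T : IsTips n t) {x : ℝ} (hx : x ∈ tipSet n t) :
    |angle n x| ≤ 1 := (T.abs_angle_le_of_tipSet hx).trans (by norm_num)

theorem isArch (T : IsTips n t) : IsArch (gadgetVertex n t) (2 * n + 10) where
  two_le := by omega
  re_lt k hk := by
    rcases T.edge_cases hk with ⟨-, e1, x, hx, e2⟩ | ⟨e2, x, hx, e1⟩ |
      ⟨x, hx, y, hy, hxy, e1, e2⟩ | ⟨α, β, hw, e1, e2⟩ | ⟨α, β, hw, e1, e2⟩ <;> rw [e1, e2]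
    · exact (T.sin_mem_of_tipSet hx).1
    · exact (T.sin_mem_of_tipSet hx).2
    · exact sin_lt_sin_of_abs_le_one (T.abs_le_one_of_tipSet hx) (T.abs_le_one_of_tipSet hy)
        (angle_lt hxy)
    · exact (tangentPt_re_mem (T.abs_le_one_of_tipSet (T.window_mem hw).1)
        (T.abs_le_one_of_tipSet (T.window_mem hw).2) (angle_lt (window_lt hw))).1
    · exact (tangentPt_re_mem (T.abs_le_one_of_tipSet (T.window_mem hw).1)
        (T.abs_le_one_of_tipSet (T.window_mem hw).2) (angle_lt (window_lt hw))).2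
  im_zero := by simp [gadgetVertex]
  im_last := by
    have g : ¬ 2 * n + 10 < n + 5 := by omega
    have g' : 2 * n + 10 ≠ n + 5 := by omega
    simp [gadgetVertex, g, g']
  im_pos k h0 hk := by
    rcases T.edge_cases hk with ⟨e0, -⟩ | ⟨-, x, hx, e1⟩ |
      ⟨x, hx, y, hy, hxy, e1, e2⟩ | ⟨α, β, hw, e1, e2⟩ | ⟨α, β, hw, e1, e2⟩
    · omega
    · rw [e1]; exact cos_pos_of_abs_le_one (T.abs_le_one_of_tipSet hx)
    · rw [e1]; exact cos_pos_of_abs_le_one (T.abs_le_one_of_tipSet hx)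
    · rw [e1]; exact cos_pos_of_abs_le_one (T.abs_le_one_of_tipSet (T.window_mem hw).1)
    · rw [e1]
      exact tangentPt_im_pos (T.abs_le_one_of_tipSet (T.window_mem hw).1)
        (T.abs_le_one_of_tipSet (T.window_mem hw).2)

/-- On the upper half of the circle the abscissa determines the point, so the arcsine recovers a
position, and monotonicity places it in the window. Tangent edges need no other information. -/
theorem exists_window_of_sin_mem (T : IsTips n t) {α β ψ : ℝ} (hw : IsWindow n α β)
    (h1 : Real.sin (angle n α) ≤ Real.sin ψ) (h2 : Real.sin ψ ≤ Real.sin (angle n β))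
    (h0 : 0 ≤ Real.cos ψ) : ∃ x ∈ goodSet n t, circ ψ = circ (angle n x) := by
  have hn : (0 : ℝ) < 8 * ((n : ℝ) + 1) := by positivity
  have hα := abs_le_one_lt_pi (T.abs_le_one_of_tipSet (T.window_mem hw).1)
  have hβ := abs_le_one_lt_pi (T.abs_le_one_of_tipSet (T.window_mem hw).2)
  set φ := Real.arcsin (Real.sin ψ) with hφ
  have e1 : angle n α ≤ φ := by
    rw [hφ, Real.le_arcsin_iff_sin_le ⟨hα.1.le, hα.2.le⟩ ⟨Real.neg_one_le_sin _, Real.sin_le_one _⟩]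
    exact h1
  have e2 : φ ≤ angle n β := by
    rw [hφ, Real.arcsin_le_iff_le_sin ⟨Real.neg_one_le_sin _, Real.sin_le_one _⟩ ⟨hβ.1.le, hβ.2.le⟩]
    exact h2
  have e3 : angle n (φ * (8 * (n + 1))) = φ := by
    rw [angle]; field_simp
  refine ⟨φ * (8 * (n + 1)), Or.inr ⟨α, β, hw, ?_, ?_⟩, ?_⟩
  · rwa [angle, div_le_iff₀ hn] at e1
  · rwa [angle, le_div_iff₀ hn] at e2
  · rw [e3]
    have hs : Real.sin φ = Real.sin ψ := Real.sin_arcsin (Real.neg_one_le_sin _) (Real.sin_le_one _)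
    refine Complex.ext hs.symm ?_
    have hc := Real.cos_arcsin (Real.sin ψ)
    rw [← hφ, ← Real.abs_cos_eq_sqrt_one_sub_sin_sq, abs_of_nonneg h0] at hc
    exact hc.symm

/-- A point of the circle under a chord is one of its ends; one under a tangent over a window has
its abscissa in the range of that window. Conversely, tips are vertices, and every point of a window
arc lies under one of the two tangents. -/
theorem circ_mem_region_iff (T : IsTips n t) (ψ : ℝ) :
    circ ψ ∈ polygonRegion (archPolygon (gadgetVertex n t) (2 * n + 10)) ↔
      ∃ x ∈ goodSet n t, circ ψ = circ (angle n x) := by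
  rw [T.isArch.mem_region]
  constructor
  · rintro ⟨k, hk, p, hp, hre, h0, him⟩
    have hne : gadgetVertex n t k ≠ gadgetVertex n t (k + 1) := fun h =>
      (T.isArch.re_lt k hk).ne (congrArg Complex.re h)
    have hpre := re_mem_Icc_of_mem_segment (T.isArch.re_lt k hk).le hp
    have hend : ‖(⟨-(9 / 10), 0⟩ : ℂ)‖ ≤ 1 ∧ ‖(⟨9 / 10, 0⟩ : ℂ)‖ ≤ 1 := by
      constructor <;> refine (Complex.norm_le_abs_re_add_abs_im _).trans ?_ <;>
        norm_num [abs_of_pos]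
    have hendne : circ ψ ≠ ⟨-(9 / 10), 0⟩ ∧ circ ψ ≠ ⟨9 / 10, 0⟩ := by
      constructor <;> intro h <;> have := (norm_eq_one_iff_sq _).mp (h ▸ norm_circ ψ) <;>
        norm_num at this
    rcases T.edge_cases hk with ⟨-, e1, x, hx, e2⟩ | ⟨e2, x, hx, e1⟩ |
      ⟨x, hx, y, hy, hxy, e1, e2⟩ | ⟨α, β, hw, e1, e2⟩ | ⟨α, β, hw, e1, e2⟩ <;>
      rw [e1, e2] at hp hne hpre
    · rcases eq_end_of_below_chord hend.1 (norm_circ _).le hne hp (norm_circ ψ) hre h0 him with h | h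
      · exact absurd h hendne.1
      · exact ⟨x, tipSet_subset hx, h⟩
    · rcases eq_end_of_below_chord (norm_circ _).le hend.2 hne hp (norm_circ ψ) hre h0 him with h | h
      · exact ⟨x, tipSet_subset hx, h⟩
      · exact absurd h hendne.2
    · rcases eq_end_of_below_chord (norm_circ _).le (norm_circ _).le hne hp (norm_circ ψ) hre h0 him
        with h | h
      · exact ⟨x, tipSet_subset hx, h⟩
      · exact ⟨y, tipSet_subset hy, h⟩
    all_goals
      have hα := T.abs_le_one_of_tipSet (T.window_mem hw).1
      have hβ := T.abs_le_one_of_tipSet (T.window_mem hw).2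
      have hT := tangentPt_re_mem hα hβ (angle_lt (window_lt hw))
      rw [hre] at hpre
      simp only [circ_re, circ_im] at hpre h0
      exact T.exists_window_of_sin_mem hw (by linarith) (by linarith) h0
  · rintro ⟨x, hx, hψ⟩
    have hcos : 0 ≤ (circ ψ).im := by
      rw [hψ]
      exact (cos_pos_of_abs_le_one ((T.abs_angle_le_of_goodSet hx).trans (by norm_num))).le
    rw [hψ] at hcos ⊢
    rcases hx with ⟨j, hj, rfl | rfl⟩ | ⟨α, β, hw, h1, h2⟩
    · refine ⟨3 + j, by omega, circ (angle n (t j)), ?_, rfl, hcos, le_rfl⟩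
      have : gadgetVertex n t (3 + j) = circ (angle n (t j)) := by
        simp [gadgetVertex, show 3 + j ≠ 1 by omega, show 3 + j ≠ 2 by omega,
          show 3 + j < n + 5 by omega]
      rw [← this]
      exact left_mem_segment _ _ _
    · refine ⟨2 * n + 7 - j, by omega, circ (angle n (n + 2 - t j)), ?_, rfl, hcos, le_rfl⟩
      have : gadgetVertex n t (2 * n + 7 - j) = circ (angle n (n + 2 - t j)) := by
        simp [gadgetVertex, show 2 * n + 7 - j ≠ 0 by omega, show 2 * n + 7 - j ≠ 1 by omega,
          show 2 * n + 7 - j ≠ 2 by omega, show ¬ 2 * n + 7 - j < n + 5 by omega,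
          show 2 * n + 7 - j ≠ n + 5 by omega, show 2 * n + 7 - j < 2 * n + 8 by omega,
          show 2 * n + 7 - (2 * n + 7 - j) = j by omega]
      rw [← this]
      exact left_mem_segment _ _ _
    · have hα := T.abs_le_one_of_tipSet (T.window_mem hw).1
      have hβ := T.abs_le_one_of_tipSet (T.window_mem hw).2
      have hT := tangentPt_re_mem hα hβ (angle_lt (window_lt hw))
      have hg := T.abs_angle_le_of_goodSet (Or.inr ⟨α, β, hw, h1, h2⟩)
      have hx1 : |angle n x| ≤ 1 := hg.trans (by norm_num)
      have hang : ∀ {y z : ℝ}, y ≤ z → angle n y ≤ angle n z := fun h =>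
        div_le_div_of_nonneg_right h (by positivity)
      have hs1 : Real.sin (angle n α) ≤ Real.sin (angle n x) :=
        Real.sin_le_sin_of_le_of_le_pi_div_two (abs_le_one_lt_pi hα).1.le (abs_le_one_lt_pi hx1).2.le
          (hang h1)
      have hs2 : Real.sin (angle n x) ≤ Real.sin (angle n β) :=
        Real.sin_le_sin_of_le_of_le_pi_div_two (abs_le_one_lt_pi hx1).1.le (abs_le_one_lt_pi hβ).2.le
          (hang h2)
      have hk : ∃ k, k + 1 < 2 * n + 10 ∧ gadgetVertex n t k = circ (angle n α) ∧
          gadgetVertex n t (k + 1) = tangentPt (angle n α) (angle n β) ∧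
          gadgetVertex n t (k + 2) = circ (angle n β) := by
        rcases hw with ⟨rfl, rfl⟩ | ⟨rfl, rfl⟩ | ⟨rfl, rfl⟩
        · exact ⟨1, by omega, by simp [gadgetVertex], by simp [gadgetVertex],
            by simp [gadgetVertex, T.zero]⟩
        · have h : n + 4 + 2 < 2 * n + 8 := by omega
          have h' : 2 * n + 7 - (n + 4 + 2) = n + 1 := by omega
          have e : (n : ℝ) + 2 - 3 / 5 = n + 7 / 5 := by ring
          exact ⟨n + 4, by omega, by simp [gadgetVertex, T.last], by simp [gadgetVertex],
            by simp [gadgetVertex, h, h', T.last, e]⟩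
        · have h : ∀ i, ¬ 2 * n + 7 + i < n + 5 := by omega
          have h' : ∀ i, 2 * n + 7 + i ≠ n + 5 := by omega
          have g := h 0
          have g' := h' 0
          have e : (n : ℝ) + 2 + 3 / 5 = n + 13 / 5 := by ring
          refine ⟨2 * n + 7, by omega, ?_, ?_, ?_⟩
          · simp only [add_zero] at g g'
            simp [gadgetVertex, T.zero, g, g', e]
          · simp [gadgetVertex, h]
            intro; omega
          · simp [gadgetVertex, h]
            intro; omega
      obtain ⟨k, hk, e1, e2, e3⟩ := hk
      -- The side of the tangents' intersection decides which of the two tangents passes above the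
      -- point.
      rcases le_total (Real.sin (angle n x)) (tangentPt (angle n α) (angle n β)).re with hle | hle
      · obtain ⟨p, hp, hpre⟩ := exists_mem_segment_re (z := circ (angle n α)) hT.1 hs1 hle
        refine ⟨k, by omega, p, by rwa [e1, e2], hpre, hcos, ?_⟩
        exact cos_le_im_of_mem_tangent hα (circ_dot_self _) (tangentPt_dot_left hα hβ) hp hpre
      · obtain ⟨p, hp, hpre⟩ := exists_mem_segment_re (w := circ (angle n β)) hT.2 hle hs2
        refine ⟨k + 1, hk, p, by rwa [e2, e3], hpre, hcos, ?_⟩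
        exact cos_le_im_of_mem_tangent hβ (tangentPt_dot_right hα hβ) (circ_dot_self _) hp hpre

end IsTips

/-! ### The points of the instance, and full coverings as zero triples. -/

/-- A strictly increasing sequence `a 0 < ⋯ < a (n - 1)` of small numbers. -/
structure IsScaled (n : ℕ) (a : ℕ → ℝ) : Prop where
  lower : ∀ i < n, -(1 / 10) ≤ a i
  upper : ∀ i < n, a i ≤ 1 / 10
  lt : ∀ i j, i < j → j < n → a i < a j

/-- The sequence `a` with the ends of the adjacent windows attached. -/
noncomputable def tipSeq (n : ℕ) (a : ℕ → ℝ) (j : ℕ) : ℝ :=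
  if j = 0 then -(3 / 5) else if j ≤ n then a (j - 1) else 3 / 5

/-- The positions of the points: two guards, and two points for every element of `a`. -/
noncomputable def pointPos (n : ℕ) (a : ℕ → ℝ) (k : ℕ) : ℝ :=
  if k = 0 then -1 else if k ≤ n then k
  else if k ≤ 2 * n then k + 2 + a (k - (n + 1)) else 2 * n + 47 / 10

theorem rotateCW_circ (θ ψ : ℝ) : rotateCW 0 θ (circ ψ) = circ (ψ + θ) := by
  have h : Complex.exp (-(θ * Complex.I)) = ⟨Real.cos θ, -Real.sin θ⟩ := by
    rw [← neg_mul, ← Complex.ofReal_neg]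
    apply Complex.ext
    · rw [Complex.exp_ofReal_mul_I_re, Real.cos_neg]
    · rw [Complex.exp_ofReal_mul_I_im, Real.sin_neg]
  rw [rotateCW, h]
  apply Complex.ext
  · simp [Real.sin_add]; ring
  · simp [Real.cos_add]; ring

theorem circ_mem_rotateCW_image (R : Set ℂ) (θ ψ : ℝ) :
    circ ψ ∈ rotateCW 0 θ '' R ↔ circ (ψ - θ) ∈ R := by
  constructor
  · rintro ⟨w, hw, h⟩
    have hw' : w = circ (ψ - θ) := by
      have h2 := rotateCW_circ θ (ψ - θ)
      rw [sub_add_cancel, ← h] at h2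
      simpa [rotateCW, Complex.exp_ne_zero] using h2.symm
    rwa [← hw']
  · intro h
    exact ⟨_, h, by rw [rotateCW_circ, sub_add_cancel]⟩

theorem circ_eq_iff {A B : ℝ} :
    circ A = circ B ↔ Real.sin A = Real.sin B ∧ Real.cos A = Real.cos B := Complex.ext_iff

theorem exists_int_of_circ_eq {A B : ℝ} (h : circ A = circ B) : ∃ m : ℤ, m * (2 * Real.pi) = A - B := by
  rw [← Real.cos_eq_one_iff, Real.cos_sub]
  have h1 : Real.sin A = Real.sin B := (circ_eq_iff.mp h).1
  have h2 : Real.cos A = Real.cos B := (circ_eq_iff.mp h).2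
  rw [h1, h2]
  nlinarith [Real.sin_sq_add_cos_sq B]

theorem angle_sub (n : ℕ) (x y : ℝ) : angle n (x - y) = angle n x - angle n y := sub_div _ _ _

theorem angle_injective (n : ℕ) : Function.Injective (angle n) := by
  intro x y h
  rcases lt_trichotomy x y with h1 | h1 | h1
  · exact absurd h (angle_lt h1).ne
  · exact h1
  · exact absurd h (angle_lt h1).ne'

namespace IsScaled

variable {n : ℕ} {a : ℕ → ℝ}

theorem isTips (S : IsScaled n a) : IsTips n (tipSeq n a) where
  zero := by simp [tipSeq]
  last := by simp [tipSeq]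
  lt_succ j hj := by
    rcases Nat.eq_zero_or_pos j with rfl | h0
    · rcases Nat.eq_zero_or_pos n with rfl | hn
      · norm_num [tipSeq]
      · have := S.lower 0 hn
        simp [tipSeq, show 1 ≤ n from hn]
        linarith
    · rcases hj.lt_or_eq with h1 | rfl
      · have := S.lt (j - 1) j (by omega) h1
        simpa [tipSeq, h0.ne', h1.le, Nat.succ_le_of_lt h1] using this
      · have := S.upper (j - 1) (by omega)
        simp [tipSeq, h0.ne']
        linarith

theorem pointPos_lt (S : IsScaled n a) {i j : ℕ} (hij : i < j) (hj : j < 2 * n + 2) :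
    pointPos n a i < pointPos n a j := by
  have hij' : (i : ℝ) + 1 ≤ j := by exact_mod_cast hij
  have hi0 : (0 : ℝ) ≤ i := by positivity
  have hn0 : (0 : ℝ) ≤ n := by positivity
  have low : ∀ k, ¬ k ≤ n → k ≤ 2 * n → -(1 / 10) ≤ a (k - (n + 1)) ∧ a (k - (n + 1)) ≤ 1 / 10 :=
    fun k _ _ => ⟨S.lower _ (by omega), S.upper _ (by omega)⟩
  have cast1 : ∀ k : ℕ, k ≤ n → (k : ℝ) ≤ n := fun k h => by exact_mod_cast h
  have cast2 : ∀ k : ℕ, k ≤ 2 * n → (k : ℝ) ≤ 2 * n := fun k h => by exact_mod_cast h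
  unfold pointPos
  split_ifs with h1 h2 h3 h4 h5 h6 h7 h8 h9 h10 h11 h12 <;> first | omega | skip
  · linarith
  · linarith [low _ h3 h4]
  · linarith
  · exact_mod_cast hij
  · linarith [low _ h7 h8]
  · linarith [cast1 _ h5]
  · linarith [low _ h5 h9, low _ h11 h12]
  · linarith [low _ h5 h9, cast2 _ h9]

theorem pointPos_mem (S : IsScaled n a) {k : ℕ} (hk : k < 2 * n + 2) :
    -1 ≤ pointPos n a k ∧ pointPos n a k ≤ 2 * n + 47 / 10 := by
  constructor
  · rcases Nat.eq_zero_or_pos k with rfl | h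
    · simp [pointPos]
    · have := S.pointPos_lt h hk
      simpa [pointPos] using this.le
  · have hl : pointPos n a (2 * n + 1) = 2 * n + 47 / 10 := by
      simp [pointPos, show ¬ 2 * n + 1 ≤ n by omega]
    rcases (show k ≤ 2 * n + 1 by omega).lt_or_eq with h | rfl
    · rw [← hl]; exact (S.pointPos_lt h (by omega)).le
    · exact hl.le

theorem abs_angle_pointPos_le (S : IsScaled n a) {k : ℕ} (hk : k < 2 * n + 2) :
    |angle n (pointPos n a k)| ≤ 3 / 4 := by
  have hn : (0 : ℝ) ≤ n := by positivity
  have := S.pointPos_mem hk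
  apply angle_abs_le <;> linarith

theorem nodup_points (S : IsScaled n a) :
    ((List.range (2 * n + 2)).map fun k => circ (angle n (pointPos n a k))).Nodup := by
  refine List.Nodup.map_on ?_ List.nodup_range
  have key : ∀ i j, i < j → j < 2 * n + 2 →
      circ (angle n (pointPos n a i)) ≠ circ (angle n (pointPos n a j)) := by
    intro i j hij hj h
    exact (sin_lt_sin_of_abs_le_one ((S.abs_angle_pointPos_le (hij.trans hj)).trans (by norm_num))
      ((S.abs_angle_pointPos_le hj).trans (by norm_num))
      (angle_lt (S.pointPos_lt hij hj))).ne ((circ_eq_iff.mp h).1)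
  intro i hi j hj h
  rw [List.mem_range] at hi hj
  rcases lt_trichotomy i j with hij | hij | hij
  · exact absurd h (key i j hij hj)
  · exact hij
  · exact absurd h.symm (key j i hij hi)

/-- The instance of Fixed MCR that corresponds to a sequence. -/
noncomputable def gadget (S : IsScaled n a) : FixedMCRInst where
  center := 0
  m := 2 * n + 11
  polygon := archPolygon (gadgetVertex n (tipSeq n a)) (2 * n + 10)
  simple := S.isTips.isArch.isSimplePolygon
  points := (List.range (2 * n + 2)).map fun k => circ (angle n (pointPos n a k))
  nodup := S.nodup_points

/-- The rotation by `angle n v` covers all points. -/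
def AllGood (n : ℕ) (a : ℕ → ℝ) (v : ℝ) : Prop :=
  ∀ k < 2 * n + 2, pointPos n a k - v ∈ goodSet n (tipSeq n a)

theorem covered_le (S : IsScaled n a) (θ : ℝ) : S.gadget.covered θ ≤ 2 * n + 2 := by
  classical
  have h : {z | z ∈ S.gadget.points ∧ z ∈ rotateCW S.gadget.center θ ''
      polygonRegion S.gadget.polygon} ⊆ (S.gadget.points.toFinset : Set ℂ) := by
    intro z hz; simpa using hz.1
  refine (Set.ncard_le_ncard h (Finset.finite_toSet _)).trans ?_
  rw [Set.ncard_coe_finset]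
  refine (List.toFinset_card_le _).trans ?_
  simp [gadget]

theorem covered_eq_iff (S : IsScaled n a) (θ : ℝ) : S.gadget.covered θ = 2 * n + 2 ↔
    ∀ k < 2 * n + 2, ∃ x ∈ goodSet n (tipSeq n a),
      circ (angle n (pointPos n a k) - θ) = circ (angle n x) := by
  classical
  have hcard : (S.gadget.points.toFinset : Set ℂ).ncard = 2 * n + 2 := by
    rw [Set.ncard_coe_finset, List.toFinset_card_of_nodup S.gadget.nodup]
    simp [gadget]
  have hsub : {z | z ∈ S.gadget.points ∧ z ∈ rotateCW S.gadget.center θ ''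
      polygonRegion S.gadget.polygon} ⊆ (S.gadget.points.toFinset : Set ℂ) := by
    intro z hz; simpa using hz.1
  have hall : S.gadget.covered θ = 2 * n + 2 ↔ ∀ z ∈ S.gadget.points,
      z ∈ rotateCW S.gadget.center θ '' polygonRegion S.gadget.polygon := by
    constructor
    · intro h z hz
      have := Set.eq_of_subset_of_ncard_le hsub (by rw [hcard]; exact h.ge) (Finset.finite_toSet _)
      have hz' : z ∈ (S.gadget.points.toFinset : Set ℂ) := by simpa using hz
      rw [← this] at hz'
      exact hz'.2
    · intro h
      rw [← hcard, FixedMCRInst.covered]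
      congr 1
      refine hsub.antisymm fun z hz => ?_
      have hz' : z ∈ S.gadget.points := by simpa using hz
      exact ⟨hz', h z hz'⟩
  rw [hall]
  constructor
  · intro h k hk
    have := h (circ (angle n (pointPos n a k)))
      (List.mem_map.mpr ⟨k, List.mem_range.mpr hk, rfl⟩)
    rw [← S.isTips.circ_mem_region_iff]
    exact (circ_mem_rotateCW_image _ _ _).mp this
  · intro h z hz
    obtain ⟨k, hk, rfl⟩ := List.mem_map.mp hz
    refine (circ_mem_rotateCW_image _ _ _).mpr ?_
    exact (S.isTips.circ_mem_region_iff _).mpr (h k (List.mem_range.mp hk))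

theorem le_of_mem_goodSet (S : IsScaled n a) {x : ℝ} (hx : x ∈ goodSet n (tipSeq n a)) :
    -n - 13 / 10 ≤ x ∧ x ≤ 2 * n + 4 := by
  have hn : (0 : ℝ) ≤ n := by positivity
  rcases hx with ⟨j, hj, rfl | rfl⟩ | ⟨α, β, ⟨rfl, rfl⟩ | ⟨rfl, rfl⟩ | ⟨rfl, rfl⟩, h1, h2⟩
  · have := S.isTips.mem_Icc hj; constructor <;> linarith
  · have := S.isTips.mem_Icc hj; constructor <;> linarith
  all_goals constructor <;> linarith

theorem allGood_of_covered (S : IsScaled n a) {θ : ℝ} (hθ : θ ∈ Set.Ico 0 (2 * Real.pi))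
    (h : S.gadget.covered θ = 2 * n + 2) : AllGood n a (θ * (8 * (n + 1))) := by
  rw [S.covered_eq_iff] at h
  have hpi := Real.pi_gt_three
  have hv : angle n (θ * (8 * (n + 1))) = θ := by rw [angle]; field_simp
  -- An angle close to 2π could act like a small negative rotation. This is excluded by the last
  -- guard: it lies beyond every good position, so it has to be turned back by a positive amount,
  -- which is at most 3/4 + 3/4.
  have hθ' : θ ≤ 3 / 2 := by
    obtain ⟨x, hx, hc⟩ := h (2 * n + 1) (by omega)
    have hx1 := abs_le.mp (S.isTips.abs_angle_le_of_goodSet hx)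
    have hp := abs_le.mp (S.abs_angle_pointPos_le (show 2 * n + 1 < 2 * n + 2 by omega))
    have hl : pointPos n a (2 * n + 1) = 2 * n + 47 / 10 := by
      simp [pointPos, show ¬ 2 * n + 1 ≤ n by omega]
    have hlt : angle n x < angle n (pointPos n a (2 * n + 1)) := by
      apply angle_lt
      rw [hl]
      linarith [(S.le_of_mem_goodSet hx).2]
    obtain ⟨m, hm⟩ := exists_int_of_circ_eq hc
    have h0 : (-1 : ℝ) < m := by
      by_contra hcon
      have : (m : ℝ) * (2 * Real.pi) ≤ -1 * (2 * Real.pi) :=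
        mul_le_mul_of_nonneg_right (not_lt.mp hcon) (by linarith)
      linarith [hθ.2]
    have h0' : 0 ≤ m := by
      have : (-1 : ℤ) < m := by exact_mod_cast h0
      omega
    have : 0 ≤ (m : ℝ) * (2 * Real.pi) := mul_nonneg (by exact_mod_cast h0') (by linarith)
    linarith
  intro k hk
  obtain ⟨x, hx, hc⟩ := h k hk
  have hx1 := abs_le.mp (S.isTips.abs_angle_le_of_goodSet hx)
  have hp := abs_le.mp (S.abs_angle_pointPos_le hk)
  obtain ⟨m, hm⟩ := exists_int_of_circ_eq hc
  -- With 0 ≤ θ ≤ 3/2 and the other two angles at most 3/4 in absolute value, the difference is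
  -- smaller than 2π in absolute value.
  have h0 : m = 0 := by
    have h1 : (-1 : ℝ) < m := by
      by_contra hcon
      have : (m : ℝ) * (2 * Real.pi) ≤ -1 * (2 * Real.pi) :=
        mul_le_mul_of_nonneg_right (not_lt.mp hcon) (by linarith)
      linarith
    have h2 : (m : ℝ) < 1 := by
      by_contra hcon
      have : 1 * (2 * Real.pi) ≤ (m : ℝ) * (2 * Real.pi) :=
        mul_le_mul_of_nonneg_right (not_lt.mp hcon) (by linarith)
      linarith [hθ.1]
    have h1' : (-1 : ℤ) < m := by exact_mod_cast h1
    have h2' : m < (1 : ℤ) := by exact_mod_cast h2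
    omega
  have : pointPos n a k - θ * (8 * (n + 1)) = x := by
    apply angle_injective n
    rw [angle_sub, hv]
    simp [h0] at hm
    linarith
  rwa [this]

theorem covered_of_allGood (S : IsScaled n a) {v : ℝ} (h : AllGood n a v) :
    S.gadget.covered (angle n v) = 2 * n + 2 := by
  rw [S.covered_eq_iff]
  exact fun k hk => ⟨_, h k hk, by rw [angle_sub]⟩

/-- The bound 1/2 excludes the tips ±3/5 that end the adjacent windows and leaves only the terms of
the sequence. -/
theorem tipSeq_eq_of_small (n : ℕ) (a : ℕ → ℝ) (j : ℕ)
    (h1 : -(1 / 2) ≤ tipSeq n a j) (h2 : tipSeq n a j ≤ 1 / 2) :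
    ∃ l < n, tipSeq n a j = a l := by
  unfold tipSeq at *
  split_ifs at * with h3 h4
  · linarith
  · exact ⟨j - 1, by omega, rfl⟩
  · linarith

theorem exists_triple_of_allGood (S : IsScaled n a) {v : ℝ} (h : AllGood n a v) :
    ∃ i < n, ∃ j < n, ∃ l < n, v = i + 1 - a j ∧ a i + a j + a l = 0 := by
  have hn : (0 : ℝ) ≤ n := by positivity
  -- The guards must not leave the range of the good set: the last one bounds `v` from below, the
  -- first one from above.
  have hv1 : 7 / 10 ≤ v := by
    have h1 := (S.le_of_mem_goodSet (h (2 * n + 1) (by omega))).2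
    have hl : pointPos n a (2 * n + 1) = 2 * n + 47 / 10 := by
      simp [pointPos, show ¬ 2 * n + 1 ≤ n by omega]
    linarith
  have hv2 : v ≤ n + 3 / 10 := by
    have h1 := (S.le_of_mem_goodSet (h 0 (by omega))).1
    have hl : pointPos n a 0 = -1 := by simp [pointPos]
    linarith
  -- Rounding `v` to the integer `i + 1` gives -1/2 < i + 1 - v ≤ 1/2, so the point `i + 1` lands
  -- strictly inside the first gap.
  have hf1 := Nat.floor_le (show 0 ≤ v - 1 / 2 by linarith)
  have hf2 := Nat.lt_floor_add_one (v - 1 / 2)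
  set i := ⌊v - 1 / 2⌋₊
  have hi : i < n := by
    have : (i : ℝ) < n := by linarith
    exact_mod_cast this
  have hb : ∃ j < n, (i : ℝ) + 1 - v = a j := by
    have hg := h (i + 1) (by omega)
    have hp : pointPos n a (i + 1) = i + 1 := by
      simp [pointPos, Nat.succ_le_of_lt hi]
    rw [hp] at hg
    rcases hg with ⟨j, hj, h1 | h1⟩ | ⟨α, β, ⟨rfl, rfl⟩ | ⟨rfl, rfl⟩ | ⟨rfl, rfl⟩, h1, h2⟩
    · obtain ⟨l, hl, hl'⟩ := tipSeq_eq_of_small n a j (by linarith) (by linarith)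
      exact ⟨l, hl, by rw [h1, hl']⟩
    · have := S.isTips.mem_Icc hj; linarith
    all_goals linarith
  obtain ⟨j, hj, hb⟩ := hb
  have ha1 := S.lower i hi
  have ha2 := S.upper i hi
  have hb1 := S.lower j hj
  have hb2 := S.upper j hj
  refine ⟨i, hi, j, hj, ?_⟩
  -- The partner of the point `i + 1` lands at n + 2 + a i + a j, at distance at most 1/5 from the
  -- middle of the second gap, where only the positions n + 2 - a l are good.
  have hg := h (n + 1 + i) (by omega)
  have hp : pointPos n a (n + 1 + i) = n + 1 + i + 2 + a i := by
    simp [pointPos, show ¬ n + 1 + i ≤ n by omega, show n + 1 + i ≤ 2 * n by omega]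
  rw [hp] at hg
  rcases hg with ⟨l, hl, h1 | h1⟩ | ⟨α, β, ⟨rfl, rfl⟩ | ⟨rfl, rfl⟩ | ⟨rfl, rfl⟩, h1, h2⟩
  · have := S.isTips.mem_Icc hl; linarith
  · obtain ⟨l, hl, hl'⟩ := tipSeq_eq_of_small n a l (by linarith) (by linarith)
    exact ⟨l, hl, by linarith, by linarith⟩
  all_goals linarith

theorem tipSeq_succ {l : ℕ} (hl : l < n) : tipSeq n a (l + 1) = a l := by
  simp [tipSeq, Nat.succ_le_of_lt hl]

/-- The points with k ≤ i go to the first window, those with k > i + 1 to the second; the partners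
with q < i go to the second, those with q > i to the third; the guards go to the outer windows. The
unit spacing minus two perturbations of 1/10 exceeds 3/5, the half-width of a gap. -/
theorem allGood_of_triple (S : IsScaled n a) {i j l : ℕ} (hi : i < n) (hj : j < n) (hl : l < n)
    (h : a i + a j + a l = 0) : AllGood n a (i + 1 - a j) := by
  have hn : (0 : ℝ) ≤ n := by positivity
  have hi' : (i : ℝ) + 1 ≤ n := by exact_mod_cast hi
  have hi0 : (0 : ℝ) ≤ i := by positivity
  have hb1 := S.lower j hj
  have hb2 := S.upper j hj
  intro k hk
  unfold pointPos
  split_ifs with h1 h2 h3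
  · exact Or.inr ⟨_, _, Or.inl ⟨rfl, rfl⟩, by linarith, by linarith⟩
  · have hk' : (k : ℝ) ≤ n := by exact_mod_cast h2
    rcases lt_trichotomy k (i + 1) with hlt | rfl | hlt
    · have : (k : ℝ) + 1 ≤ i + 1 := by exact_mod_cast hlt
      have hk0 : (0 : ℝ) ≤ k := by positivity
      exact Or.inr ⟨_, _, Or.inl ⟨rfl, rfl⟩, by linarith, by linarith⟩
    · refine Or.inl ⟨j + 1, by omega, Or.inl ?_⟩
      rw [tipSeq_succ hj]
      push_cast
      ring
    · have : (i : ℝ) + 1 + 1 ≤ k := by exact_mod_cast hlt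
      exact Or.inr ⟨_, _, Or.inr (Or.inl ⟨rfl, rfl⟩), by linarith, by linarith⟩
  · obtain ⟨q, rfl⟩ : ∃ q, k = n + 1 + q := ⟨k - (n + 1), by omega⟩
    have hq : q < n := by omega
    have hq' : (q : ℝ) + 1 ≤ n := by exact_mod_cast hq
    have hq0 : (0 : ℝ) ≤ q := by positivity
    rw [Nat.add_sub_cancel_left]
    have ha1 := S.lower q hq
    have ha2 := S.upper q hq
    push_cast
    rcases lt_trichotomy q i with hlt | rfl | hlt
    · have : (q : ℝ) + 1 ≤ i := by exact_mod_cast hlt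
      exact Or.inr ⟨_, _, Or.inr (Or.inl ⟨rfl, rfl⟩), by linarith, by linarith⟩
    · refine Or.inl ⟨l + 1, by omega, Or.inr ?_⟩
      rw [tipSeq_succ hl]
      linarith
    · have : (i : ℝ) + 1 ≤ q := by exact_mod_cast hlt
      exact Or.inr ⟨_, _, Or.inr (Or.inr ⟨rfl, rfl⟩), by linarith, by linarith⟩
  · exact Or.inr ⟨_, _, Or.inr (Or.inr ⟨rfl, rfl⟩), by linarith, by linarith⟩

/-- If three terms of the sequence have sum `0`, then an optimal angle reveals such terms. -/
theorem exists_triple_of_correct (S : IsScaled n a) {θ : ℝ} (hθ : fixedMCR.Correct S.gadget θ)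
    (h : ∃ i < n, ∃ j < n, ∃ l < n, a i + a j + a l = 0) :
    ∃ i < n, ∃ j < n, ∃ l < n, θ * (8 * (n + 1)) = i + 1 - a j ∧ a i + a j + a l = 0 := by
  obtain ⟨i, hi, j, hj, l, hl, h⟩ := h
  have hn : (0 : ℝ) ≤ n := by positivity
  have hi' : (i : ℝ) + 1 ≤ n := by exact_mod_cast hi
  have hi0 : (0 : ℝ) ≤ i := by positivity
  have hb1 := S.lower j hj
  have hb2 := S.upper j hj
  have hcov := S.covered_of_allGood (S.allGood_of_triple hi hj hl h)
  have hrange : angle n (i + 1 - a j) ∈ Set.Ico 0 (2 * Real.pi) := by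
    have h1 : |angle n (i + 1 - a j)| ≤ 3 / 4 := by apply angle_abs_le <;> linarith
    have h2 := (abs_le.mp h1).2
    have h3 := Real.pi_gt_three
    exact ⟨div_nonneg (by linarith) (by positivity), by linarith⟩
  have hmax : S.gadget.covered (angle n (i + 1 - a j)) ≤ S.gadget.covered θ := hθ.2 _ hrange
  exact S.exists_triple_of_allGood
    (S.allGood_of_covered hθ.1 (le_antisymm (S.covered_le θ) (hcov ▸ hmax)))

end IsScaled

/-! ### Program logic for the real RAM -/

/-- The program `p` started in `s` asks no questions and halts within `T` steps in a state that
satisfies `R`. -/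
def Runs {F : Set (ℝ → ℝ)} (O : Oracle) (p : Prog F) (s : RamState) (T : ℕ)
    (R : RamState → Prop) : Prop :=
  ∃ s' t, Exec O p s s' t [] ∧ t ≤ T ∧ R s'

/-- The weakest precondition of a program without loops and subroutines. -/
def Prog.wp {F : Set (ℝ → ℝ)} : Prog F → (RamState → Prop) → RamState → Prop
  | .skip, R, s => R s
  | .iset i e, R, s => R (s.setIdx i (e.eval s))
  | .rset x e, R, s => R (s.setVal x (e.eval s))
  | .iput a pos e, R, s => R (s.setIarr a (pos.eval s) (e.eval s))
  | .rput a pos e, R, s => R (s.setRarr a (pos.eval s) (e.eval s))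
  | .seq p q, R, s => p.wp (q.wp R) s
  | .ite b p q, R, s => (b.holds s → p.wp R s) ∧ (¬ b.holds s → q.wp R s)
  | .while _ _, _, _ => False
  | .call _ _ _, _, _ => False
  | .query _ _, _, _ => False

/-- A bound on the running time of a program without loops and subroutines. -/
def Prog.bound {F : Set (ℝ → ℝ)} : Prog F → ℕ
  | .skip => 1
  | .iset _ e => e.cost + 1
  | .rset _ e => e.cost + 1
  | .iput _ pos e => pos.cost + e.cost + 1
  | .rput _ pos e => pos.cost + e.cost + 1
  | .seq p q => p.bound + q.bound
  | .ite b p q => b.cost + (p.bound + q.bound)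
  | .while _ _ => 0
  | .call _ _ _ => 0
  | .query _ _ => 0

/-- A loop in which index register `i` runs from `0` to the value of index register `r`. -/
def Prog.forLoop {F : Set (ℝ → ℝ)} (i r : ℕ) (body : Prog F) : Prog F :=
  .seq (.iset i (.const 0))
    (.while (.ilt (.reg i) (.reg r)) (.seq body (.iset i (.add (.reg i) (.const 1)))))

namespace Runs

variable {F : Set (ℝ → ℝ)} {O : Oracle} {s : RamState}

theorem mono {p : Prog F} {T T' : ℕ} {R R' : RamState → Prop} (h : Runs O p s T R)
    (hT : T ≤ T') (hR : ∀ s', R s' → R' s') : Runs O p s T' R' := by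
  obtain ⟨s', t, he, ht, hr⟩ := h
  exact ⟨s', t, he, ht.trans hT, hR _ hr⟩

theorem seq {p q : Prog F} {T T' : ℕ} {R R' : RamState → Prop} (hp : Runs O p s T R)
    (hq : ∀ s', R s' → Runs O q s' T' R') : Runs O (.seq p q) s (T + T') R' := by
  obtain ⟨s', t, he, ht, hr⟩ := hp
  obtain ⟨s'', t', he', ht', hr'⟩ := hq s' hr
  exact ⟨s'', t + t', he.seq he', Nat.add_le_add ht ht', hr'⟩

/-- Verification of loop-free code thereby becomes evaluation of `wp`. Adding the bounds of both
branches in `bound` is wasteful, but only constants matter. -/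
theorem of_wp {p : Prog F} {R : RamState → Prop} (h : p.wp R s) : Runs O p s p.bound R := by
  induction p generalizing s R with
  | skip => exact ⟨_, _, .skip s, le_rfl, h⟩
  | iset i e => exact ⟨_, _, .iset s i e, le_rfl, h⟩
  | rset x e => exact ⟨_, _, .rset s x e, le_rfl, h⟩
  | iput a pos e => exact ⟨_, _, .iput s a pos e, le_rfl, h⟩
  | rput a pos e => exact ⟨_, _, .rput s a pos e, le_rfl, h⟩
  | seq p q hp hq => exact (hp h).seq fun s' => hq
  | ite b p q hp hq =>
    by_cases hb : b.holds s
    · obtain ⟨s', t, he, ht, hr⟩ := hp (h.1 hb)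
      exact ⟨s', _, .ite_true hb he, by simp only [Prog.bound]; omega, hr⟩
    · obtain ⟨s', t, he, ht, hr⟩ := hq (h.2 hb)
      exact ⟨s', _, .ite_false hb he, by simp only [Prog.bound]; omega, hr⟩
  | _ => exact h.elim

/-- The index of the invariant counts the rounds, and `k < N` under the test is the termination
argument. At most `N` bodies and `N + 1` tests are charged. -/
theorem while_loop {b : Test F} {p : Prog F} {I : ℕ → RamState → Prop} {N c : ℕ}
    (hbody : ∀ k s', I k s' → b.holds s' → k < N ∧ Runs O p s' c (I (k + 1)))
    (h0 : I 0 s) :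
    Runs O (.while b p) s (N * (b.cost + c) + b.cost) fun s' => ¬ b.holds s' ∧ ∃ k, I k s' := by
  have key : ∀ m k s, N - k = m → I k s →
      Runs O (.while b p) s (m * (b.cost + c) + b.cost) fun s' => ¬ b.holds s' ∧ ∃ k, I k s' := by
    intro m
    induction m with
    | zero =>
      intro k s hm hI
      have hb : ¬ b.holds s := fun hb => by have := (hbody k s hI hb).1; omega
      exact ⟨s, _, .while_false hb, by omega, hb, k, hI⟩
    | succ m ih =>
      intro k s hm hI
      by_cases hb : b.holds s
      · obtain ⟨hk, s', t, he, ht, hI'⟩ := hbody k s hI hb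
        obtain ⟨s'', t', he', ht', hr⟩ := ih (k + 1) s' (by omega) hI'
        exact ⟨s'', _, .while_true hb he he', by rw [add_one_mul]; omega, hr⟩
      · exact ⟨s, _, .while_false hb, by omega, hb, k, hI⟩
  simpa using key N 0 s rfl h0

/-- The invariant has to fix the counter and the limit. In the time bound, 7 is the cost of a test
and an increment, and 5 that of the initialization and the last test. -/
theorem forLoop {i r : ℕ} {p : Prog F} {I : ℕ → RamState → Prop} {N c : ℕ}
    (hI : ∀ k s', I k s' → s'.idx i = k ∧ s'.idx r = N)
    (h0 : I 0 (s.setIdx i 0))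
    (hbody : ∀ k < N, ∀ s', I k s' →
      Runs O p s' c fun s'' => I (k + 1) (s''.setIdx i (s''.idx i + 1))) :
    Runs O (.forLoop i r p) s (N * (c + 7) + 5) (I N) := by
  have h1 : Runs O (.iset i (.const 0) : Prog F) s 2 fun s' => s' = s.setIdx i 0 :=
    of_wp (p := .iset i (.const 0)) rfl
  have h2 : Runs O (.while (.ilt (.reg i) (.reg r))
      (.seq p (.iset i (.add (.reg i) (.const 1)))) : Prog F) (s.setIdx i 0)
      (N * (3 + (c + 4)) + 3) fun s' => ¬ (Test.ilt (F := F) (.reg i) (.reg r)).holds s' ∧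
        ∃ k, k ≤ N ∧ I k s' := by
    refine while_loop (I := fun k s' => k ≤ N ∧ I k s') ?_ ⟨Nat.zero_le _, h0⟩
    rintro k s' ⟨-, hk⟩ hb
    have hlt : k < N := by
      simpa [Test.holds, IExp.eval, (hI k s' hk).1, (hI k s' hk).2] using hb
    refine ⟨hlt, (hbody k hlt s' hk).seq fun s'' h => ?_⟩
    exact of_wp (p := .iset i (.add (.reg i) (.const 1))) ⟨hlt, h⟩
  refine (h1.seq fun s' hs' => hs' ▸ h2).mono (by ring_nf; omega) ?_
  rintro s' ⟨hb, k, hk, hIk⟩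
  have : ¬ k < N := by
    simpa [Test.holds, IExp.eval, (hI k s' hIk).1, (hI k s' hIk).2] using hb
  rwa [show N = k by omega]

end Runs

namespace RamState

variable (s : RamState)

@[simp] theorem setIdx_idx (i k : ℕ) : (s.setIdx i k).idx = Function.update s.idx i k := rfl
@[simp] theorem setIdx_val (i k : ℕ) : (s.setIdx i k).val = s.val := rfl
@[simp] theorem setIdx_rarr (i k : ℕ) : (s.setIdx i k).rarr = s.rarr := rfl
@[simp] theorem setVal_idx (x : ℕ) (y : ℝ) : (s.setVal x y).idx = s.idx := rfl
@[simp] theorem setVal_val (x : ℕ) (y : ℝ) : (s.setVal x y).val = Function.update s.val x y := rfl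
@[simp] theorem setVal_rarr (x : ℕ) (y : ℝ) : (s.setVal x y).rarr = s.rarr := rfl
@[simp] theorem setRarr_idx (a j : ℕ) (y : ℝ) : (s.setRarr a j y).idx = s.idx := rfl
@[simp] theorem setRarr_val (a j : ℕ) (y : ℝ) : (s.setRarr a j y).val = s.val := rfl
@[simp] theorem setRarr_rarr (a j : ℕ) (y : ℝ) : (s.setRarr a j y).rarr =
    Function.update s.rarr a (Function.update (s.rarr a) j y) := rfl

end RamState

/-! ### Sorting

The array is divided into blocks whose number and length are about the square root of the number of
entries. The least remaining entry of every block is kept in array `5`. -/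

namespace RamState

variable (s : RamState)

@[simp] theorem setIdx_setIdx (i k k' : ℕ) : (s.setIdx i k).setIdx i k' = s.setIdx i k' := by
  simp [setIdx]

@[simp] theorem setVal_setVal (x : ℕ) (y y' : ℝ) : (s.setVal x y).setVal x y' = s.setVal x y' := by
  simp [setVal]

@[simp] theorem setVal_setIdx (x i k : ℕ) (y : ℝ) :
    (s.setVal x y).setIdx i k = (s.setIdx i k).setVal x y := rfl

end RamState

/-- The entries of `A` greater than `l` at the positions `lo, …, lo + len - 1`, and the
sentinel `M`. -/
def blockSet (A : ℕ → ℝ) (M l : ℝ) (lo len : ℕ) : Set ℝ :=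
  insert M {x | ∃ i < len, x = A (lo + i) ∧ l < x}

theorem isLeast_blockSet_zero (A : ℕ → ℝ) (M l : ℝ) (lo : ℕ) : IsLeast (blockSet A M l lo 0) M := by
  simp [blockSet, IsLeast]

theorem blockSet_succ_subset (A : ℕ → ℝ) (M l : ℝ) (lo k : ℕ) :
    blockSet A M l lo (k + 1) ⊆ insert (A (lo + k)) (blockSet A M l lo k) := by
  rintro x (rfl | ⟨i, hi, rfl, hx⟩)
  · exact Or.inr (Or.inl rfl)
  · rcases Nat.lt_succ_iff_lt_or_eq.mp hi with h | rfl
    · exact Or.inr (Or.inr ⟨i, h, rfl, hx⟩)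
    · exact Or.inl rfl

theorem blockSet_mono (A : ℕ → ℝ) (M l : ℝ) (lo k : ℕ) :
    blockSet A M l lo k ⊆ blockSet A M l lo (k + 1) := by
  rintro x (rfl | ⟨i, hi, rfl, hx⟩)
  · exact Or.inl rfl
  · exact Or.inr ⟨i, by omega, rfl, hx⟩

theorem isLeast_blockSet_succ {A : ℕ → ℝ} {M l : ℝ} {lo k : ℕ} {v : ℝ}
    (h : IsLeast (blockSet A M l lo k) v) (h1 : l < A (lo + k)) (h2 : A (lo + k) < v) :
    IsLeast (blockSet A M l lo (k + 1)) (A (lo + k)) := by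
  refine ⟨Or.inr ⟨k, by omega, rfl, h1⟩, fun x hx => ?_⟩
  rcases blockSet_succ_subset A M l lo k hx with rfl | hx
  · exact le_rfl
  · exact h2.le.trans (h.2 hx)

theorem isLeast_blockSet_succ_of_not {A : ℕ → ℝ} {M l : ℝ} {lo k : ℕ} {v : ℝ}
    (h : IsLeast (blockSet A M l lo k) v) (h' : ¬ (l < A (lo + k) ∧ A (lo + k) < v)) :
    IsLeast (blockSet A M l lo (k + 1)) v := by
  refine ⟨blockSet_mono _ _ _ _ _ h.1, ?_⟩
  rintro x (rfl | ⟨i, hi, rfl, hx⟩)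
  · exact h.2 (Or.inl rfl)
  · rcases Nat.lt_succ_iff_lt_or_eq.mp hi with hlt | rfl
    · exact h.2 (Or.inr ⟨i, hlt, rfl, hx⟩)
    · exact not_lt.mp fun hlt => h' ⟨hx, hlt⟩

section Programs

variable (F : Set (ℝ → ℝ))

/-- Set entry `idx pos` of array `5` to the least entry greater than `val 2` in the block that
starts at position `idx base`. -/
def blockMinProg (pos base : ℕ) : Prog F :=
  .seq (.rset 3 (.reg 1)) (.seq
    (.forLoop 3 4
      (.ite (.rlt (.reg 2) (.get 0 (.add (.reg base) (.reg 3))))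
        (.ite (.rlt (.get 0 (.add (.reg base) (.reg 3))) (.reg 3))
          (.rset 3 (.get 0 (.add (.reg base) (.reg 3)))) .skip) .skip))
    (.rput 5 (.reg pos) (.reg 3)))

/-- Find the least entry of array `5`, its position, and the start of its block. -/
def findMinProg : Prog F :=
  .seq (.rset 4 (.reg 1)) (.seq (.iset 6 (.const 0))
    (.forLoop 2 4 (.seq
      (.ite (.rlt (.get 5 (.reg 2)) (.reg 4))
        (.seq (.rset 4 (.get 5 (.reg 2))) (.seq (.iset 7 (.reg 2)) (.iset 8 (.reg 6)))) .skip)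
      (.iset 6 (.add (.reg 6) (.reg 4))))))

/-- Compute a strict upper bound of the absolute values of the entries. -/
def sentinelProg : Prog F :=
  .seq (.rset 1 (.const 1))
    (.forLoop 1 0 (.rset 1 (.add (.reg 1) (.mul (.get 0 (.reg 1)) (.get 0 (.reg 1))))))

/-- Compute the length of a block and its square. -/
def blockLengthProg : Prog F :=
  .seq (.iset 4 (.const 0)) (.seq (.iset 5 (.const 0))
    (.while (.ilt (.reg 5) (.add (.reg 0) (.const 1)))
      (.seq (.iset 5 (.add (.reg 5) (.add (.add (.reg 4) (.reg 4)) (.const 1))))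
        (.iset 4 (.add (.reg 4) (.const 1))))))

/-- Fill the incomplete blocks with the sentinel. -/
def padProg : Prog F :=
  .forLoop 1 5 (.ite (.ilt (.reg 1) (.reg 0)) .skip (.rput 0 (.reg 1) (.reg 1)))

/-- Compute the least entries of all blocks. -/
def initBlocksProg : Prog F :=
  .seq (.rset 2 (.sub (.const 0) (.reg 1))) (.seq (.iset 6 (.const 0))
    (.forLoop 2 4 (.seq (blockMinProg F 2 6) (.iset 6 (.add (.reg 6) (.reg 4))))))

/-- Extract the entries in increasing order to array `6`. -/
def extractProg : Prog F :=
  .forLoop 1 0 (.seq (findMinProg F) (.seq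
    (.seq (.rput 6 (.reg 1) (.reg 4)) (.rset 2 (.reg 4))) (blockMinProg F 7 8)))

/-- Sort array `0` into array `6`. -/
def sortProg : Prog F :=
  .seq (sentinelProg F) (.seq (blockLengthProg F) (.seq (padProg F) (.seq (initBlocksProg F)
    (extractProg F))))

end Programs

section Verification

variable {F : Set (ℝ → ℝ)} {O : Oracle} {s : RamState} {A : ℕ → ℝ} {B n : ℕ} {M : ℝ}

theorem runs_blockMin {pos base : ℕ} (hpos : pos ≠ 3) (hbase : base ≠ 3) (hA : s.rarr 0 = A)
    (hB : s.idx 4 = B) (hM : s.val 1 = M) :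
    Runs O (blockMinProg F pos base) s (B * 40 + 20) fun s' =>
      ∃ v, IsLeast (blockSet A M (s.val 2) (s.idx base) B) v ∧
        s' = ((s.setIdx 3 B).setVal 3 v).setRarr 5 (s.idx pos) v := by
  have h1 : Runs O (.rset 3 (.reg 1) : Prog F) s 2 fun s' => s' = s.setVal 3 M :=
    .of_wp (p := .rset 3 (.reg 1)) (by simp [Prog.wp, RExp.eval, hM])
  refine (h1.seq fun s₁ hs₁ => ((Runs.forLoop (N := B) (c := 26)
    (I := fun k s' => ∃ v, IsLeast (blockSet A M (s.val 2) (s.idx base) k) v ∧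
      s' = (s.setIdx 3 k).setVal 3 v) ?_ ?_ ?_).seq fun s₂ hs₂ =>
        .of_wp (p := .rput 5 (.reg pos) (.reg 3)) ?_)).mono ?_ fun _ h => h
  · rintro k s' ⟨v, -, rfl⟩
    simp [hB]
  · exact ⟨M, isLeast_blockSet_zero _ _ _ _, by rw [hs₁]; rfl⟩
  · rintro k hk s' ⟨v, hv, rfl⟩
    refine (Runs.of_wp ?_).mono (T := Prog.bound _) (by simp [Prog.bound, Test.cost, RExp.cost, IExp.cost]) fun _ h => h
    simp only [Prog.wp, Test.holds, RExp.eval, IExp.eval, RamState.setVal_val,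
      RamState.setIdx_val, RamState.setVal_rarr, RamState.setIdx_rarr, RamState.setVal_idx,
      RamState.setIdx_idx, hA, Function.update_self, Function.update_of_ne hbase,
      Function.update_of_ne (show (2 : ℕ) ≠ 3 by decide)]
    refine ⟨fun h => ⟨fun h' => ?_, fun h' => ?_⟩, fun h => ?_⟩
    · exact ⟨_, isLeast_blockSet_succ hv h h', by simp⟩
    · exact ⟨v, isLeast_blockSet_succ_of_not hv fun hc => h' hc.2, by simp⟩
    · exact ⟨v, isLeast_blockSet_succ_of_not hv fun hc => h hc.1, by simp⟩
  · obtain ⟨v, hv, rfl⟩ := hs₂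
    refine ⟨v, hv, ?_⟩
    simp [IExp.eval, RExp.eval, Function.update_of_ne hpos]
  · simp [Prog.bound, RExp.cost, IExp.cost]
    omega

/-- The position registers are set only when an entry below `M` occurs, hence the condition in the
last clause. The start of the block is tracked by additions because index expressions have no
product. -/
theorem runs_findMin (hB : s.idx 4 = B) (hM : s.val 1 = M) :
    Runs O (findMinProg F) s (B * 40 + 20) fun s' =>
      (∀ i, i ≠ 2 → i ≠ 6 → i ≠ 7 → i ≠ 8 → s'.idx i = s.idx i) ∧
      (∀ x, x ≠ 4 → s'.val x = s.val x) ∧ s'.rarr = s.rarr ∧ s'.val 4 ≤ M ∧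
      (∀ j < B, s'.val 4 ≤ s.rarr 5 j) ∧
      (s'.val 4 < M → s'.idx 7 < B ∧ s'.idx 8 = s'.idx 7 * B ∧ s'.val 4 = s.rarr 5 (s'.idx 7)) := by
  have h1 : Runs O (.rset 4 (.reg 1) : Prog F) s 2 fun s' => s' = s.setVal 4 M :=
    .of_wp (p := .rset 4 (.reg 1)) (by simp [Prog.wp, RExp.eval, hM])
  refine (h1.seq fun s₁ hs₁ => (Runs.of_wp (p := .iset 6 (.const 0))
    (R := fun s' => s' = (s.setVal 4 M).setIdx 6 0) ?_).seq fun s₂ hs₂ =>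
    (Runs.forLoop (N := B) (c := 33) (I := fun k s' =>
      s'.idx 2 = k ∧ s'.idx 6 = k * B ∧
      (∀ i, i ≠ 2 → i ≠ 6 → i ≠ 7 → i ≠ 8 → s'.idx i = s.idx i) ∧
      (∀ x, x ≠ 4 → s'.val x = s.val x) ∧ s'.rarr = s.rarr ∧ s'.val 4 ≤ M ∧
      (∀ j < k, s'.val 4 ≤ s.rarr 5 j) ∧
      (s'.val 4 < M → s'.idx 7 < k ∧ s'.idx 8 = s'.idx 7 * B ∧ s'.val 4 = s.rarr 5 (s'.idx 7)))
      ?_ ?_ ?_)).mono ?_ ?_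
  · simp [Prog.wp, IExp.eval, hs₁]
  · rintro k s' ⟨h2, -, h3, -⟩
    exact ⟨h2, by rw [h3 4 (by decide) (by decide) (by decide) (by decide), hB]⟩
  · subst hs₂
    refine ⟨by simp, by simp, ?_, ?_, rfl, by simp, by simp, by simp⟩
    · intro i h2 h6 _ _
      simp [Function.update_of_ne h2, Function.update_of_ne h6]
    · intro x hx
      simp [Function.update_of_ne hx]
  · rintro k hk s' ⟨h2, h6, hidx, hval, hr, hle, hmin, harg⟩
    refine (Runs.of_wp ?_).mono (T := Prog.bound _)
      (by simp [Prog.bound, Test.cost, RExp.cost, IExp.cost]) fun _ h => h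
    have h4 : s'.idx 4 = B := by rw [hidx 4 (by decide) (by decide) (by decide) (by decide), hB]
    simp only [Prog.wp, Test.holds, RExp.eval, IExp.eval, hr, h2]
    refine ⟨fun h => ?_, fun h => ?_⟩
    · refine ⟨by simp [h2], by simp [h6, h4, add_one_mul],
        ?_, ?_, ?_, ?_, ?_, ?_⟩
      · intro i i2 i6 i7 i8
        simp [i2, i6, i7, i8, hidx]
      · intro x hx
        simp [hx, hval]
      · simp [hr]
      · simpa using h.le.trans hle
      · intro j hj
        rcases Nat.lt_succ_iff_lt_or_eq.mp hj with hj | rfl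
        · simpa using h.le.trans (hmin j hj)
        · simp
      · simp [h6, h2]
    · refine ⟨by simp [h2], by simp [h6, h4, add_one_mul],
        ?_, ?_, ?_, ?_, ?_, ?_⟩
      · intro i i2 i6 i7 i8
        simp [i2, i6, hidx i i2 i6 i7 i8]
      · intro x hx
        simp [hx, hval]
      · simp [hr]
      · simpa using hle
      · intro j hj
        rcases Nat.lt_succ_iff_lt_or_eq.mp hj with hj | rfl
        · simpa using hmin j hj
        · simpa using h
      · intro hlt
        obtain ⟨g1, g2, g3⟩ := harg (by simpa using hlt)
        simp
        exact ⟨by omega, g2, g3⟩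
  · simp [Prog.bound, IExp.cost]
    omega
  · rintro s' ⟨-, -, g3, g4, g5, g6, g7, g8⟩
    exact ⟨g3, g4, g5, g6, g7, g8⟩

end Verification

section Verification

variable {F : Set (ℝ → ℝ)} {O : Oracle} {s : RamState} {A : ℕ → ℝ} {B n : ℕ} {M : ℝ}

/-- Since |x| < 1 + x², one plus the sum of the squares exceeds all absolute values. -/
theorem runs_sentinel (hn : s.idx 0 = n) :
    Runs O (sentinelProg F) s (n * 20 + 20) fun s' =>
      s'.idx 0 = n ∧ s'.rarr = s.rarr ∧ 1 ≤ s'.val 1 ∧ ∀ i < n, |s.rarr 0 i| < s'.val 1 := by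
  refine ((Runs.of_wp (p := .rset 1 (.const 1)) (R := fun s' => s' = s.setVal 1 1) ?_).seq
    fun s₁ hs₁ => Runs.forLoop (N := n) (c := 9) (I := fun k s' => s'.idx 1 = k ∧ s'.idx 0 = n ∧
      s'.rarr = s.rarr ∧ 1 ≤ s'.val 1 ∧ ∀ i < k, |s.rarr 0 i| < s'.val 1) ?_ ?_ ?_).mono ?_ ?_
  · simp [Prog.wp, RExp.eval]
  · rintro k s' ⟨h1, h2, -⟩
    exact ⟨h1, h2⟩
  · subst hs₁
    simp [hn]
  · rintro k hk s' ⟨h1, h0, hr, hone, hlt⟩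
    refine (Runs.of_wp ?_).mono (T := Prog.bound _)
      (by simp [Prog.bound, RExp.cost, IExp.cost]) fun _ h => h
    simp only [Prog.wp, RExp.eval, IExp.eval, hr, h1]
    have hsq : 0 ≤ s.rarr 0 k * s.rarr 0 k := mul_self_nonneg _
    refine ⟨by simp [h1], by simp [h0], by simp [hr], by simp; linarith, ?_⟩
    intro i hi
    simp only [RamState.setIdx_val, RamState.setVal_val, Function.update_self]
    rcases Nat.lt_succ_iff_lt_or_eq.mp hi with hi | rfl
    · linarith [hlt i hi]
    · nlinarith [sq_nonneg (|s.rarr 0 i| - 1), abs_mul_abs_self (s.rarr 0 i)]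
  · simp [Prog.bound, RExp.cost]
    omega
  · rintro s' ⟨-, h⟩
    exact h

/-- Squares are built by (k + 1)² = k² + (2k + 1). The loop stops at the first k with k² > n. -/
theorem runs_blockLength (hn : s.idx 0 = n) :
    Runs O (blockLengthProg F) s ((Nat.sqrt n + 1) * 20 + 20) fun s' =>
      s'.idx 0 = n ∧ s'.idx 4 = Nat.sqrt n + 1 ∧ s'.idx 5 = (Nat.sqrt n + 1) * (Nat.sqrt n + 1) ∧
        s'.val = s.val ∧ s'.rarr = s.rarr := by
  refine ((Runs.of_wp (p := .iset 4 (.const 0)) (R := fun s' => s' = s.setIdx 4 0) ?_).seq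
    fun s₁ hs₁ => (Runs.of_wp (p := .iset 5 (.const 0))
    (R := fun s' => s' = (s.setIdx 4 0).setIdx 5 0) ?_).seq fun s₂ hs₂ =>
    (Runs.while_loop (N := Nat.sqrt n + 1) (c := 12)
      (I := fun k s' => k ≤ Nat.sqrt n + 1 ∧ s'.idx 0 = n ∧ s'.idx 4 = k ∧ s'.idx 5 = k * k ∧
        s'.val = s.val ∧ s'.rarr = s.rarr) ?_ ?_)).mono ?_ ?_
  · simp [Prog.wp, IExp.eval]
  · simp [Prog.wp, IExp.eval, hs₁]
  · rintro k s' ⟨-, h0, h4, h5, hv, hr⟩ hb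
    simp only [Test.holds, IExp.eval, h0, h5] at hb
    have hk : k ≤ Nat.sqrt n := Nat.le_sqrt.mpr (by omega)
    refine ⟨by omega, ?_⟩
    refine (Runs.of_wp ?_).mono (T := Prog.bound _)
      (by simp [Prog.bound, IExp.cost]) fun _ h => h
    simp only [Prog.wp, IExp.eval, h4, h5]
    exact ⟨by omega, by simp [h0], by simp [h4], by simp; ring, by simp [hv], by simp [hr]⟩
  · subst hs₂
    simp [hn]
  · simp [Prog.bound, Test.cost, IExp.cost]
    omega
  · rintro s' ⟨hb, k, hk, h0, h4, h5, hv, hr⟩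
    simp only [Test.holds, IExp.eval, h0, h5, not_lt] at hb
    have hk' : k = Nat.sqrt n + 1 := by
      have : Nat.sqrt n < k := Nat.sqrt_lt.mpr (by omega)
      omega
    subst hk'
    exact ⟨h0, h4, h5, hv, hr⟩

/-- Full blocks make bounds checks superfluous. The padding does not disturb the sort, because the
sentinel exceeds all entries. -/
theorem runs_pad {N : ℕ} (hn : s.idx 0 = n) (hN : s.idx 5 = N) :
    Runs O (padProg F) s (N * 20 + 5) fun s' =>
      s'.idx 0 = n ∧ s'.idx 4 = s.idx 4 ∧ s'.val = s.val ∧ (∀ i < n, s'.rarr 0 i = s.rarr 0 i) ∧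
        ∀ i, n ≤ i → i < N → s'.rarr 0 i = s.val 1 := by
  refine (Runs.forLoop (N := N) (c := 13) (I := fun k s' => s'.idx 1 = k ∧ s'.idx 0 = n ∧
      s'.idx 5 = N ∧ s'.idx 4 = s.idx 4 ∧ s'.val = s.val ∧ (∀ i < n, s'.rarr 0 i = s.rarr 0 i) ∧
        ∀ i, n ≤ i → i < k → s'.rarr 0 i = s.val 1) ?_ ?_ ?_).mono le_rfl ?_
  · rintro k s' ⟨h1, h0, h5, -⟩
    exact ⟨h1, h5⟩
  · simp [hn, hN]
  · rintro k hk s' ⟨h1, h0, h5, h4, hv, ha, hb⟩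
    refine (Runs.of_wp ?_).mono (T := Prog.bound _)
      (by simp [Prog.bound, Test.cost, RExp.cost, IExp.cost]) fun _ h => h
    simp only [Prog.wp, Test.holds, RExp.eval, IExp.eval, h1, h0, hv]
    refine ⟨fun h => ?_, fun h => ?_⟩
    · refine ⟨by simp, by simp [h0], by simp [h5], by simp [h4], by simp [hv], ?_, ?_⟩
      · simpa using ha
      · intro i hi hik
        simpa using hb i hi (by omega)
    · refine ⟨by simp [h1], by simp [h0], by simp [h5], by simp [h4], by simp [hv], ?_, ?_⟩
      · intro i hi
        simp [show i ≠ k by omega, ha i hi]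
      · intro i hi hik
        by_cases hik' : i = k
        · simp [hik']
        · simp [hik', hb i hi (by omega)]
  · rintro s' ⟨-, h0, -, h4, hv, ha, hb⟩
    exact ⟨h0, h4, hv, ha, hb⟩

theorem runs_initBlocks (hn : s.idx 0 = n) (hA : s.rarr 0 = A) (hB : s.idx 4 = B)
    (hM : s.val 1 = M) :
    Runs O (initBlocksProg F) s (B * (B * 40 + 40) + 20) fun s' =>
      s'.idx 0 = n ∧ s'.rarr 0 = A ∧ s'.idx 4 = B ∧ s'.val 1 = M ∧ s'.val 2 = -M ∧
      ∀ j < B, IsLeast (blockSet A M (-M) (j * B) B) (s'.rarr 5 j) := by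
  refine ((Runs.of_wp (p := .rset 2 (.sub (.const 0) (.reg 1)))
    (R := fun s' => s' = s.setVal 2 (-M)) ?_).seq fun s₁ hs₁ =>
    (Runs.of_wp (p := .iset 6 (.const 0))
    (R := fun s' => s' = (s.setVal 2 (-M)).setIdx 6 0) ?_).seq fun s₂ hs₂ =>
    (Runs.forLoop (N := B) (c := B * 40 + 20 + 4)
      (I := fun k s' => s'.idx 2 = k ∧ s'.idx 6 = k * B ∧
        s'.idx 0 = n ∧ s'.rarr 0 = A ∧ s'.idx 4 = B ∧ s'.val 1 = M ∧ s'.val 2 = -M ∧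
        ∀ j < k, IsLeast (blockSet A M (-M) (j * B) B) (s'.rarr 5 j)) ?_ ?_ ?_)).mono ?_ ?_
  · simp [Prog.wp, RExp.eval, hM]
  · simp [Prog.wp, IExp.eval, hs₁]
  · rintro k s' ⟨h2, -, -, -, h4, -⟩
    exact ⟨h2, h4⟩
  · subst hs₂
    simp [hn, hA, hB, hM]
  · rintro k hk s' ⟨h2, h6, h0, hA', h4, h1, hl, hj⟩
    refine (runs_blockMin (pos := 2) (base := 6) (by decide) (by decide) hA' h4 h1).seq
      fun s₃ hs₃ => (Runs.of_wp ?_).mono (T := Prog.bound _)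
        (by simp [Prog.bound, IExp.cost]) fun _ h => h
    obtain ⟨v, hv, rfl⟩ := hs₃
    simp only [Prog.wp, IExp.eval]
    refine ⟨by simp [h2], by simp [h6, h4, add_one_mul], by simp [h0], by simp [hA'], by simp [h4],
      by simp [h1], by simp [hl], ?_⟩
    intro j hjk
    by_cases hjk' : j = k
    · subst hjk'
      rw [hl, h6] at hv
      simpa [h2] using hv
    · simpa [h2, hjk'] using hj j (by omega)
  · simp [Prog.bound, RExp.cost, IExp.cost]
    ring_nf
    omega
  · rintro s' ⟨-, -, h⟩
    exact h

/-- `o 0 < ⋯ < o (k - 1)` are the smallest of the numbers `A 0, …, A (n - 1)`, namely those that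
are at most `l`. -/
structure IsSortedPrefix (A : ℕ → ℝ) (n : ℕ) (l : ℝ) (k : ℕ) (o : ℕ → ℝ) : Prop where
  mem : ∀ i < k, ∃ j < n, o i = A j
  lt : ∀ i j, i < j → j < k → o i < o j
  le : ∀ i < k, o i ≤ l
  exists_eq : ∀ j < n, A j ≤ l → ∃ i < k, A j = o i

/-- Pigeonhole: otherwise `n` distinct values would be among `k < n` extracted ones. -/
theorem IsSortedPrefix.exists_gt {l : ℝ} {k : ℕ} {o : ℕ → ℝ} (h : IsSortedPrefix A n l k o)
    (hinj : ∀ i < n, ∀ j < n, A i = A j → i = j) (hk : k < n) : ∃ j < n, l < A j := by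
  by_contra! hcon
  have : (Finset.range n).card ≤ (Finset.range k).card := by
    have hsub : (Finset.range n).image A ⊆ (Finset.range k).image o := by
      intro x hx
      obtain ⟨j, hj, rfl⟩ := Finset.mem_image.mp hx
      obtain ⟨i, hi, h'⟩ := h.exists_eq j (Finset.mem_range.mp hj) (hcon j (Finset.mem_range.mp hj))
      exact Finset.mem_image.mpr ⟨i, Finset.mem_range.mpr hi, h'.symm⟩
    have hcard : ((Finset.range n).image A).card = (Finset.range n).card :=
      Finset.card_image_of_injOn fun i hi j hj hij =>
        hinj i (by simpa using hi) j (by simpa using hj) hij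
    rw [← hcard]
    exact (Finset.card_le_card hsub).trans Finset.card_image_le
  simp at this
  omega

theorem IsSortedPrefix.surjective {l : ℝ} {o : ℕ → ℝ} (h : IsSortedPrefix A n l n o) :
    ∀ j < n, ∃ i < n, A j = o i := by
  have hsub : (Finset.range n).image o ⊆ (Finset.range n).image A := by
    intro x hx
    obtain ⟨i, hi, rfl⟩ := Finset.mem_image.mp hx
    obtain ⟨j, hj, h'⟩ := h.mem i (Finset.mem_range.mp hi)
    exact Finset.mem_image.mpr ⟨j, Finset.mem_range.mpr hj, h'.symm⟩
  have hcard : ((Finset.range n).image o).card = (Finset.range n).card := by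
    refine Finset.card_image_of_injOn fun i hi j hj hij => ?_
    have hi : i < n := by simpa using hi
    have hj : j < n := by simpa using hj
    rcases lt_trichotomy i j with hlt | heq | hlt
    · exact absurd hij (h.lt i j hlt hj).ne
    · exact heq
    · exact absurd hij (h.lt j i hlt hi).ne'
  have heq := Finset.eq_of_subset_of_card_le hsub (by rw [hcard]; exact Finset.card_image_le)
  intro j hj
  have : A j ∈ (Finset.range n).image o := by
    rw [heq]; exact Finset.mem_image_of_mem _ (Finset.mem_range.mpr hj)
  obtain ⟨i, hi, h'⟩ := Finset.mem_image.mp this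
  exact ⟨i, Finset.mem_range.mp hi, h'.symm⟩

theorem IsSortedPrefix.snoc {l v : ℝ} {k q : ℕ} {o : ℕ → ℝ} (h : IsSortedPrefix A n l k o)
    (hq : q < n) (hv : v = A q) (hlv : l < v) (hmin : ∀ j < n, l < A j → v ≤ A j) :
    IsSortedPrefix A n v (k + 1) (Function.update o k v) where
  mem i hi := by
    by_cases hik : i = k
    · exact ⟨q, hq, by simp [hik, hv]⟩
    · simpa [hik] using h.mem i (by omega)
  lt i j hij hj := by
    have hik : i ≠ k := by omega
    by_cases hjk : j = k
    · simpa [hik, hjk] using (h.le i (by omega)).trans_lt hlv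
    · simpa [hik, hjk] using h.lt i j hij (by omega)
  le i hi := by
    by_cases hik : i = k
    · simp [hik]
    · simpa [hik] using (h.le i (by omega)).trans hlv.le
  exists_eq j hj hle := by
    by_cases hl : A j ≤ l
    · obtain ⟨i, hi, h'⟩ := h.exists_eq j hj hl
      exact ⟨i, by omega, by simp [show i ≠ k by omega, h']⟩
    · exact ⟨k, by omega, by simpa using le_antisymm hle (hmin j hj (not_le.mp hl))⟩

/-- The memory between two extractions. -/
structure ExtractInv (A : ℕ → ℝ) (B n : ℕ) (M : ℝ) (k : ℕ) (s : RamState) : Prop where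
  counter : s.idx 1 = k
  length : s.idx 0 = n
  block : s.idx 4 = B
  sentinel : s.val 1 = M
  input : s.rarr 0 = A
  least : ∀ j < B, IsLeast (blockSet A M (s.val 2) (j * B) B) (s.rarr 5 j)
  sorted : IsSortedPrefix A n (s.val 2) k (s.rarr 6)

/-- Raising the threshold `val 2` to the extracted value deletes that value, because the entries are
distinct. One scan of the block minima and one scan of a single block suffice. -/
theorem runs_extract_step {k : ℕ} (hk : k < n) (hnB : n ≤ B * B)
    (hinj : ∀ i < n, ∀ j < n, A i = A j → i = j) (hlt : ∀ i < n, A i < M)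
    (hpad : ∀ i, n ≤ i → i < B * B → A i = M) (h : ExtractInv A B n M k s) :
    Runs O (.seq (findMinProg F) (.seq
      (.seq (.rput 6 (.reg 1) (.reg 4)) (.rset 2 (.reg 4))) (blockMinProg F 7 8))) s
      ((B * 40 + 20) + (6 + (B * 40 + 20)))
      fun s' => ExtractInv A B n M (k + 1) (s'.setIdx 1 (s'.idx 1 + 1)) := by
  refine (runs_findMin h.block h.sentinel).seq fun s₁ hs₁ => ?_
  obtain ⟨hidx, hval, hr, hle, hmin, harg⟩ := hs₁
  have hBpos : 0 < B := by
    rcases Nat.eq_zero_or_pos B with rfl | hB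
    · omega
    · exact hB
  set v := s₁.val 4 with hv
  have hvmin : ∀ j < n, s.val 2 < A j → v ≤ A j := by
    intro j hj hlj
    have hdiv : j / B < B := Nat.div_lt_of_lt_mul (by omega)
    have hmod := Nat.mod_lt j hBpos
    have hj' : j / B * B + j % B = j := by rw [mul_comm]; exact Nat.div_add_mod j B
    exact (hmin _ hdiv).trans ((h.least _ hdiv).2 (Or.inr ⟨j % B, hmod, by rw [hj'], hlj⟩))
  obtain ⟨p, hp, hlp⟩ := h.sorted.exists_gt hinj hk
  -- Some entry is still to be extracted, so the minimum found is not the sentinel.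
  have hvM : v < M := (hvmin p hp hlp).trans_lt (hlt p hp)
  obtain ⟨h7, h8, hv7⟩ := harg hvM
  set b := s₁.idx 7 with hb
  have hidxlt : ∀ {j i : ℕ}, j < B → i < B → j * B + i < B * B := by
    intro j i hj hi
    calc j * B + i < j * B + B := by omega
      _ = (j + 1) * B := by ring
      _ ≤ B * B := Nat.mul_le_mul_right _ hj
  have hltn : ∀ {j i : ℕ}, j < B → i < B → A (j * B + i) < M → j * B + i < n := by
    intro j i hj hi hA
    by_contra hcon
    exact hA.ne (hpad _ (not_lt.mp hcon) (hidxlt hj hi))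
  have hvmem := (h.least b h7).1
  rw [← hv7] at hvmem
  obtain ⟨e, he, hve, hlv⟩ : ∃ e < B, v = A (b * B + e) ∧ s.val 2 < v := by
    rcases hvmem with h' | h'
    · exact absurd h' hvM.ne
    · exact h'
  have hq : b * B + e < n := hltn h7 he (hve ▸ hvM)
  -- By injectivity the value `v` occurs in block `b` only, so the minima stored for the other
  -- blocks exceed the new threshold and remain valid.
  have hother : ∀ j < B, j ≠ b → IsLeast (blockSet A M v (j * B) B) (s.rarr 5 j) := by
    intro j hj hjb
    have hold := h.least j hj
    constructor
    · rcases hold.1 with h' | ⟨i, hi, hA', hl'⟩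
      · exact Or.inl h'
      · refine Or.inr ⟨i, hi, hA', lt_of_le_of_ne (hmin j hj) fun heq => hjb ?_⟩
        have h1 : A (j * B + i) = A (b * B + e) := by rw [← hA', ← heq, hve]
        have h2 := hinj _ (hltn hj hi (by rw [h1, ← hve]; exact hvM)) _ hq h1
        have h3 : (j * B + i) / B = (b * B + e) / B := by rw [h2]
        rwa [add_comm, Nat.add_mul_div_right _ _ hBpos, add_comm (b * B),
          Nat.add_mul_div_right _ _ hBpos, Nat.div_eq_of_lt hi, Nat.div_eq_of_lt he,
          zero_add, zero_add] at h3
    · rintro x (rfl | ⟨i, hi, rfl, hx⟩)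
      · exact hold.2 (Or.inl rfl)
      · exact hold.2 (Or.inr ⟨i, hi, rfl, hlv.trans hx⟩)
  have g0 : s₁.idx 0 = n := by rw [hidx 0 (by decide) (by decide) (by decide) (by decide), h.length]
  have g1 : s₁.idx 1 = k := by
    rw [hidx 1 (by decide) (by decide) (by decide) (by decide), h.counter]
  have g4 : s₁.idx 4 = B := by rw [hidx 4 (by decide) (by decide) (by decide) (by decide), h.block]
  have gM : s₁.val 1 = M := by rw [hval 1 (by decide), h.sentinel]
  refine ((Runs.of_wp (p := .seq (.rput 6 (.reg 1) (.reg 4)) (.rset 2 (.reg 4)))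
    (R := fun s' => s' = (s₁.setRarr 6 k v).setVal 2 v) ?_).mono (T' := 6)
    (by simp [Prog.bound, RExp.cost, IExp.cost]) fun _ h => h).seq fun s₂ hs₂ =>
    (runs_blockMin (F := F) (pos := 7) (base := 8) (A := A) (B := B) (M := M)
      (by decide) (by decide) ?_ ?_ ?_).mono le_rfl fun s₃ hs₃ => ?_
  · simp [Prog.wp, RExp.eval, IExp.eval, g1, hv]
  · rw [hs₂]; simp [hr, h.input]
  · rw [hs₂]; simp [g4]
  · rw [hs₂]; simp [gM]
  · obtain ⟨w, hw, rfl⟩ := hs₃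
    subst hs₂
    simp only [RamState.setVal_val, Function.update_self, RamState.setVal_idx,
      RamState.setRarr_idx, h8] at hw
    refine ⟨by simp [g1], by simp [g0], by simp [g4], by simp [gM], by simp [hr, h.input], ?_, ?_⟩
    · intro j hj
      by_cases hjb : j = b
      · rw [hjb]
        simpa [hr, ← hb] using hw
      · simpa [hr, ← hb, hjb] using hother j hj hjb
    · simpa [hr] using h.sorted.snoc hq hve hlv hvmin

theorem runs_extract (hnB : n ≤ B * B)
    (hinj : ∀ i < n, ∀ j < n, A i = A j → i = j) (hlt : ∀ i < n, |A i| < M)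
    (hpad : ∀ i, n ≤ i → i < B * B → A i = M) (hn : s.idx 0 = n) (hA : s.rarr 0 = A)
    (hB : s.idx 4 = B) (hM : s.val 1 = M) (hl : s.val 2 = -M)
    (hleast : ∀ j < B, IsLeast (blockSet A M (-M) (j * B) B) (s.rarr 5 j)) :
    Runs O (extractProg F) s (n * (B * 80 + 60) + 5) fun s' => ExtractInv A B n M n s' := by
  refine (Runs.forLoop (N := n) (c := (B * 40 + 20) + (6 + (B * 40 + 20)))
    (I := fun k s' => ExtractInv A B n M k s') ?_ ?_ ?_).mono ?_ fun _ h => h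
  · exact fun k s' h => ⟨h.counter, h.length⟩
  · refine ⟨by simp, by simp [hn], by simp [hB], by simp [hM], by simp [hA], ?_, ?_⟩
    · simpa [hl] using hleast
    -- The initial threshold `-M` is below all entries, so nothing counts as extracted.
    · refine ⟨by simp, by simp, by simp, fun j hj h => ?_⟩
      have := (abs_lt.mp (hlt j hj)).1
      simp only [RamState.setIdx_val, hl] at h
      linarith
  · intro k hk s' h
    exact runs_extract_step hk hnB hinj (fun i hi => (abs_lt.mp (hlt i hi)).2) hpad h
  · refine Nat.add_le_add_right (Nat.mul_le_mul_left _ ?_) _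
    omega

/-- The sorting program works in time `O(n ^ (3 / 2))`. -/
theorem runs_sort (hn : s.idx 0 = n) (hA : s.rarr 0 = A)
    (hinj : ∀ i < n, ∀ j < n, A i = A j → i = j) :
    Runs O (sortProg F) s (400 * ((n + 1) * (Nat.sqrt n + 1))) fun s' =>
      s'.idx 0 = n ∧ 1 ≤ s'.val 1 ∧ (∀ i < n, |A i| < s'.val 1) ∧
      (∀ i < n, ∃ j < n, s'.rarr 6 i = A j) ∧ (∀ j < n, ∃ i < n, A j = s'.rarr 6 i) ∧
      ∀ i j, i < j → j < n → s'.rarr 6 i < s'.rarr 6 j := by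
  set B := Nat.sqrt n + 1 with hB
  have hnB : n ≤ B * B := (Nat.lt_succ_sqrt n).le
  let R : RamState → Prop := fun s' => ∃ A' M, (∀ i < n, A' i = A i) ∧ 1 ≤ M ∧
    (∀ i < n, |A i| < M) ∧ ExtractInv A' B n M n s'
  refine ((runs_sentinel hn).seq fun s₁ ⟨a0, a1, a2, a3⟩ =>
    (runs_blockLength a0).seq fun s₂ ⟨b0, b1, b2, b3, b4⟩ =>
    (runs_pad b0 b2).seq fun s₃ ⟨c0, c1, c2, c3, c4⟩ =>
    (runs_initBlocks c0 rfl (c1.trans b1) rfl).seq (R' := R)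
      (T' := n * (B * 80 + 60) + 5) fun s₄ ⟨d0, d1, d2, d3, d4, d5⟩ => ?_).mono ?_ ?_
  · have hAeq : ∀ i < n, s₃.rarr 0 i = A i := fun i hi => by rw [c3 i hi, b4, a1, hA]
    have hlt : ∀ i < n, |A i| < s₃.val 1 := fun i hi => by rw [c2, b3, ← hA]; exact a3 i hi
    refine (runs_extract (A := s₃.rarr 0) (M := s₃.val 1) hnB ?_ ?_ ?_ d0 d1 d2 d3 d4 d5).mono
      le_rfl fun s' h => ⟨s₃.rarr 0, s₃.val 1, hAeq, by rw [c2, b3]; exact a2, hlt, h⟩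
    · intro i hi j hj hij
      rw [hAeq i hi, hAeq j hj] at hij
      exact hinj i hi j hj hij
    · intro i hi
      rw [hAeq i hi]
      exact hlt i hi
    · intro i hi hiB
      rw [c4 i hi hiB, c2]
  · have h1 : 1 ≤ B := by omega
    have h2 : B ≤ n + 1 := by have := Nat.sqrt_le_self n; omega
    have h3 : B * B ≤ (n + 1) * B := Nat.mul_le_mul_right _ h2
    have h4 : (n + 1) * 1 ≤ (n + 1) * B := Nat.mul_le_mul_left _ h1
    have h5 : 1 * B ≤ (n + 1) * B := Nat.mul_le_mul_right _ (by omega)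
    rw [← hB]
    clear_value B
    linarith
  · rintro s' ⟨A', M, hA', hM, hlt, h⟩
    refine ⟨h.length, by rw [h.sentinel]; exact hM, by rw [h.sentinel]; exact hlt, ?_, ?_,
      h.sorted.lt⟩
    · intro i hi
      obtain ⟨j, hj, h'⟩ := h.sorted.mem i hi
      exact ⟨j, hj, by rw [h', hA' j hj]⟩
    · intro j hj
      obtain ⟨i, hi, h'⟩ := h.sorted.surjective j hj
      exact ⟨i, hi, by rw [← h', hA' j hj]⟩

end Verification

/-! ### Building the instance of Fixed MCR -/

/-- Index expressions do not read real arrays, so the positions of later writes can be computed in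
the initial state. -/
theorem IExp.eval_setRarr (s : RamState) (c j : ℕ) (y : ℝ) (e : IExp) :
    e.eval (s.setRarr c j y) = e.eval s := by
  induction e with
  | const c => rfl
  | reg i => rfl
  | get a e ih => simp [IExp.eval, ih]; rfl
  | add e₁ e₂ h₁ h₂ => simp [IExp.eval, h₁, h₂]
  | sub e₁ e₂ h₁ h₂ => simp [IExp.eval, h₁, h₂]

/-- A write of a point of the plane to a pair of arrays: the position and the coordinates. -/
structure PointWrite (F : Set (ℝ → ℝ)) where
  pos : IExp
  re : RExp F
  im : RExp F

/-- Write a list of points to the arrays `c` (abscissas) and `d` (ordinates). -/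
def writeProg {F : Set (ℝ → ℝ)} (c d : ℕ) : List (PointWrite F) → Prog F
  | [] => .skip
  | w :: ws => .seq (.seq (.rput c w.pos w.re) (.rput d w.pos w.im)) (writeProg c d ws)

/-- The facts that the expressions in the construction of the instance depend on. -/
structure BuildBase (n : ℕ) (a : ℕ → ℝ) (j : ℕ) (s : RamState) : Prop where
  length : s.idx 0 = n
  counter : s.idx 1 = j
  scale : s.val 5 = 8 * ((n : ℝ) + 1)
  input : s.rarr 7 = a

theorem BuildBase.setRarr {n : ℕ} {a : ℕ → ℝ} {j : ℕ} {s : RamState} (h : BuildBase n a j s)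
    {c : ℕ} (hc : c ≠ 7) (i : ℕ) (y : ℝ) : BuildBase n a j (s.setRarr c i y) :=
  ⟨h.length, h.counter, h.scale, by simp [hc.symm, h.input]⟩

/-- The write puts the values of `f` in place. -/
def PointWrite.IsFor {F : Set (ℝ → ℝ)} (w : PointWrite F) (n : ℕ) (a : ℕ → ℝ) (j : ℕ) (f : ℕ → ℂ) :
    Prop :=
  ∀ s, BuildBase n a j s →
    w.re.eval s = (f (w.pos.eval s)).re ∧ w.im.eval s = (f (w.pos.eval s)).im

/-- Entry `k` of the arrays `c` and `d` contains the coordinates of `f k`. -/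
def HoldsAt (s : RamState) (c d : ℕ) (f : ℕ → ℂ) (k : ℕ) : Prop :=
  s.rarr c k = (f k).re ∧ s.rarr d k = (f k).im

/-- Each write puts the correct value for its own position, so correct entries stay correct and
writes may even overlap. Array 7 is excluded as a target because the expressions read the sequence
from it. -/
theorem wp_writeProg {F : Set (ℝ → ℝ)} {n : ℕ} {a : ℕ → ℝ} {j c d : ℕ} {f : ℕ → ℂ} (hc : c ≠ 7)
    (hd : d ≠ 7) (hcd : c ≠ d) {ws : List (PointWrite F)} {s : RamState} {R : RamState → Prop}
    (hs : BuildBase n a j s) (hws : ∀ w ∈ ws, w.IsFor n a j f)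
    (hR : ∀ s', BuildBase n a j s' → s'.idx = s.idx →
      (∀ e, e ≠ c → e ≠ d → s'.rarr e = s.rarr e) →
      (∀ k, HoldsAt s c d f k → HoldsAt s' c d f k) →
      (∀ w ∈ ws, HoldsAt s' c d f (w.pos.eval s)) → R s') :
    (writeProg c d ws).wp R s := by
  induction ws generalizing s with
  | nil => exact hR s hs rfl (fun _ _ _ => rfl) (fun _ h => h) (by simp)
  | cons w ws ih =>
    simp only [writeProg, Prog.wp, IExp.eval_setRarr]
    set k₀ := w.pos.eval s with hk₀
    set s₁ := s.setRarr c k₀ (w.re.eval s) with hs₁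
    have hb₁ : BuildBase n a j s₁ := hs.setRarr hc _ _
    have hre : w.re.eval s = (f k₀).re := (hws w (by simp) s hs).1
    have him : w.im.eval s₁ = (f k₀).im := by
      have := (hws w (by simp) s₁ hb₁).2
      rwa [hs₁, IExp.eval_setRarr] at this
    refine ih (hb₁.setRarr hd _ _) (fun w' hw' => hws w' (by simp [hw'])) ?_
    intro s' hs' hidx hother hkeep hnew
    have hstep : ∀ k, (k = k₀ ∨ HoldsAt s c d f k) →
        HoldsAt (s₁.setRarr d k₀ (w.im.eval s₁)) c d f k := by
      intro k hk
      rw [HoldsAt, him]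
      by_cases hkk : k = k₀
      · subst hkk
        simp [hcd, hs₁, hre]
      · have := hk.resolve_left hkk
        simpa [HoldsAt, hcd, hcd.symm, hs₁, hkk] using this
    refine hR s' hs' (by rw [hidx]; rfl) ?_ ?_ ?_
    · intro e hec hed
      rw [hother e hec hed]
      simp [hs₁, hec, hed]
    · exact fun k hk => hkeep k (hstep k (Or.inr hk))
    · intro w' hw'
      rcases List.mem_cons.mp hw' with rfl | hw'
      · exact hkeep _ (hstep _ (Or.inl rfl))
      · have := hnew w' hw'
        rwa [IExp.eval_setRarr, hs₁, IExp.eval_setRarr] at this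

section Writes

variable {F : Set (ℝ → ℝ)} (sn cs : F)

/-- The quotient of two integers. -/
def RExp.ratio (p q : ℤ) : RExp F := .div (.const p) (.const q)

/-- The length of the input, as a real number. -/
def RExp.length : RExp F := .cast (.reg 0)

/-- Write the point of the circle at position `x`. -/
def circWrite (pos : IExp) (x : RExp F) : PointWrite F :=
  ⟨pos, .app sn (.div x (.reg 5)), .app cs (.div x (.reg 5))⟩

/-- Write the intersection of the tangents at positions `x` and `y`. -/
def tangentWrite (pos : IExp) (x y : RExp F) : PointWrite F :=
  ⟨pos, .div (.app sn (.div (.add (.div x (.reg 5)) (.div y (.reg 5))) (.const 2)))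
      (.app cs (.div (.sub (.div y (.reg 5)) (.div x (.reg 5))) (.const 2))),
    .div (.app cs (.div (.add (.div x (.reg 5)) (.div y (.reg 5))) (.const 2)))
      (.app cs (.div (.sub (.div y (.reg 5)) (.div x (.reg 5))) (.const 2)))⟩

/-- The vertices that belong to the term `idx 1` of the sequence. -/
def termVertexWrites : List (PointWrite F) :=
  [circWrite sn cs (.add (.reg 1) (.const 4)) (.get 7 (.reg 1)),
    circWrite sn cs (.sub (.add (.add (.reg 0) (.reg 0)) (.const 6)) (.reg 1))
      (.sub (.add .length (.const 2)) (.get 7 (.reg 1)))]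

/-- The points that belong to the term `idx 1` of the sequence. -/
def termPointWrites : List (PointWrite F) :=
  [circWrite sn cs (.add (.reg 1) (.const 1)) (.add (.cast (.reg 1)) (.const 1)),
    circWrite sn cs (.add (.reg 0) (.add (.const 1) (.reg 1)))
      (.add (.add (.add .length (.add (.const 1) (.cast (.reg 1)))) (.const 2)) (.get 7 (.reg 1)))]

/-- The vertices that do not belong to a term of the sequence. -/
def fixedVertexWrites : List (PointWrite F) :=
  [⟨.const 0, .ratio (-9) 10, .const 0⟩,
    circWrite sn cs (.const 1) (.sub (.sub (.const 0) .length) (.ratio 13 10)),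
    tangentWrite sn cs (.const 2) (.sub (.sub (.const 0) .length) (.ratio 13 10)) (.ratio (-3) 5),
    circWrite sn cs (.const 3) (.ratio (-3) 5),
    circWrite sn cs (.add (.reg 0) (.const 4)) (.ratio 3 5),
    tangentWrite sn cs (.add (.reg 0) (.const 5)) (.ratio 3 5) (.add .length (.ratio 7 5)),
    circWrite sn cs (.add (.reg 0) (.const 6)) (.add .length (.ratio 7 5)),
    circWrite sn cs (.add (.add (.reg 0) (.reg 0)) (.const 7)) (.add .length (.ratio 13 5)),
    tangentWrite sn cs (.add (.add (.reg 0) (.reg 0)) (.const 8)) (.add .length (.ratio 13 5))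
      (.add (.add .length .length) (.const 4)),
    circWrite sn cs (.add (.add (.reg 0) (.reg 0)) (.const 9))
      (.add (.add .length .length) (.const 4)),
    ⟨.add (.add (.reg 0) (.reg 0)) (.const 10), .ratio 9 10, .const 0⟩]

/-- The two guards. -/
def guardWrites : List (PointWrite F) :=
  [circWrite sn cs (.const 0) (.const (-1)),
    circWrite sn cs (.add (.add (.reg 0) (.reg 0)) (.const 1))
      (.add (.add .length .length) (.ratio 47 10))]

variable {sn cs} {n j : ℕ} {a : ℕ → ℝ} {f : ℕ → ℂ}

theorem isFor_circWrite (hs : sn.1 = Real.sin) (hc : cs.1 = Real.cos) {pos : IExp} {x : RExp F}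
    {k : ℕ} {y : ℝ} (hk : ∀ s, BuildBase n a j s → pos.eval s = k)
    (hx : ∀ s, BuildBase n a j s → x.eval s = y) (hf : f k = circ (angle n y)) :
    (circWrite sn cs pos x).IsFor n a j f := by
  intro s h
  simp only [circWrite, RExp.eval, hs, hc, hx s h, h.scale, hk s h, hf]
  exact ⟨rfl, rfl⟩

theorem isFor_tangentWrite (hs : sn.1 = Real.sin) (hc : cs.1 = Real.cos) {pos : IExp}
    {x₁ x₂ : RExp F} {k : ℕ} {y₁ y₂ : ℝ} (hk : ∀ s, BuildBase n a j s → pos.eval s = k)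
    (hx₁ : ∀ s, BuildBase n a j s → x₁.eval s = y₁)
    (hx₂ : ∀ s, BuildBase n a j s → x₂.eval s = y₂)
    (hf : f k = tangentPt (angle n y₁) (angle n y₂)) :
    (tangentWrite sn cs pos x₁ x₂).IsFor n a j f := by
  intro s h
  simp only [tangentWrite, RExp.eval, hs, hc, hx₁ s h, hx₂ s h, h.scale, hk s h, hf, Int.cast_ofNat]
  exact ⟨rfl, rfl⟩

/-- The term `j` is the tip `j + 1`; it occurs once at vertex `j + 4` and once, mirrored, at vertex
`2n + 6 - j`. -/
theorem isFor_termVertexWrites (hs : sn.1 = Real.sin) (hc : cs.1 = Real.cos) (hj : j < n) :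
    ∀ w ∈ termVertexWrites sn cs, w.IsFor n a j (gadgetVertex n (tipSeq n a)) := by
  simp only [termVertexWrites, List.forall_mem_cons, List.not_mem_nil, false_imp_iff, implies_true,
    and_true]
  constructor
  · refine isFor_circWrite hs hc (k := j + 4) (y := a j) ?_ ?_ ?_
    · intro s h; simp [IExp.eval, h.counter]
    · intro s h; simp [RExp.eval, IExp.eval, h.counter, h.input]
    · simp [gadgetVertex, show j + 4 < n + 5 by omega, IsScaled.tipSeq_succ hj]
  · refine isFor_circWrite hs hc (k := 2 * n + 6 - j) (y := n + 2 - a j) ?_ ?_ ?_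
    · intro s h; simp [IExp.eval, h.counter, h.length]; omega
    · intro s h; simp [RExp.eval, RExp.length, IExp.eval, h.counter, h.input, h.length]
    · rw [gadgetVertex, if_neg (by omega), if_neg (by omega), if_neg (by omega), if_neg (by omega),
        if_neg (by omega), if_pos (by omega), show 2 * n + 7 - (2 * n + 6 - j) = j + 1 by omega,
        IsScaled.tipSeq_succ hj]

theorem isFor_termPointWrites (hs : sn.1 = Real.sin) (hc : cs.1 = Real.cos) (hj : j < n) :
    ∀ w ∈ termPointWrites sn cs, w.IsFor n a j fun k => circ (angle n (pointPos n a k)) := by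
  simp only [termPointWrites, List.forall_mem_cons, List.not_mem_nil, false_imp_iff, implies_true,
    and_true]
  constructor
  · refine isFor_circWrite hs hc (k := j + 1) (y := j + 1) ?_ ?_ ?_
    · intro s h; simp [IExp.eval, h.counter]
    · intro s h; simp [RExp.eval, IExp.eval, h.counter]
    · simp [pointPos, Nat.succ_le_of_lt hj]
  · refine isFor_circWrite hs hc (k := n + (1 + j)) (y := n + (1 + j) + 2 + a j) ?_ ?_ ?_
    · intro s h; simp [IExp.eval, h.counter, h.length]
    · intro s h; simp [RExp.eval, RExp.length, IExp.eval, h.counter, h.input, h.length]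
    · simp only [pointPos]
      rw [if_neg (by omega), if_neg (by omega), if_pos (by omega),
        show n + (1 + j) - (n + 1) = j by omega]
      push_cast
      rfl

theorem isFor_guardWrites (hs : sn.1 = Real.sin) (hc : cs.1 = Real.cos) :
    ∀ w ∈ guardWrites sn cs, w.IsFor n a j fun k => circ (angle n (pointPos n a k)) := by
  simp only [guardWrites, List.forall_mem_cons, List.not_mem_nil, false_imp_iff, implies_true,
    and_true]
  constructor
  · refine isFor_circWrite hs hc (k := 0) (y := -1) ?_ ?_ ?_
    · intro s h; simp [IExp.eval]
    · intro s h; simp [RExp.eval]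
    · simp [pointPos]
  · refine isFor_circWrite hs hc (k := 2 * n + 1) (y := 2 * n + 47 / 10) ?_ ?_ ?_
    · intro s h; simp [IExp.eval, h.length]; omega
    · intro s h; simp [RExp.eval, RExp.length, RExp.ratio, IExp.eval, h.length]; ring
    · simp only [pointPos]
      rw [if_neg (by omega), if_neg (by omega), if_neg (by omega)]

theorem isFor_fixedVertexWrites (hs : sn.1 = Real.sin) (hc : cs.1 = Real.cos) :
    ∀ w ∈ fixedVertexWrites sn cs, w.IsFor n a j (gadgetVertex n (tipSeq n a)) := by
  simp only [fixedVertexWrites, List.forall_mem_cons, List.not_mem_nil, false_imp_iff, implies_true,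
    and_true]
  have t0 : tipSeq n a 0 = -(3 / 5) := by simp [tipSeq]
  have t1 : tipSeq n a (n + 1) = 3 / 5 := by simp [tipSeq]
  refine ⟨?_, ?_, ?_, ?_, ?_, ?_, ?_, ?_, ?_, ?_, ?_⟩
  · intro s h
    simp [RExp.eval, RExp.ratio, IExp.eval, gadgetVertex]
    ring
  · refine isFor_circWrite hs hc (k := 1) (y := -n - 13 / 10) ?_ ?_ ?_
    · intro s h; simp [IExp.eval]
    · intro s h; simp [RExp.eval, RExp.length, RExp.ratio, IExp.eval, h.length]
    · simp [gadgetVertex]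
  · refine isFor_tangentWrite hs hc (k := 2) (y₁ := -n - 13 / 10) (y₂ := -(3 / 5)) ?_ ?_ ?_ ?_
    · intro s h; simp [IExp.eval]
    · intro s h; simp [RExp.eval, RExp.length, RExp.ratio, IExp.eval, h.length]
    · intro s h; simp [RExp.eval, RExp.ratio]; ring
    · simp [gadgetVertex]
  · refine isFor_circWrite hs hc (k := 3) (y := -(3 / 5)) ?_ ?_ ?_
    · intro s h; simp [IExp.eval]
    · intro s h; simp [RExp.eval, RExp.ratio]; ring
    · simp [gadgetVertex, t0]
  · refine isFor_circWrite hs hc (k := n + 4) (y := 3 / 5) ?_ ?_ ?_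
    · intro s h; simp [IExp.eval, h.length]
    · intro s h; simp [RExp.eval, RExp.ratio]
    · simp [gadgetVertex, t1]
  · refine isFor_tangentWrite hs hc (k := n + 5) (y₁ := 3 / 5) (y₂ := n + 7 / 5) ?_ ?_ ?_ ?_
    · intro s h; simp [IExp.eval, h.length]
    · intro s h; simp [RExp.eval, RExp.ratio]
    · intro s h; simp [RExp.eval, RExp.length, RExp.ratio, IExp.eval, h.length]
    · simp [gadgetVertex]
  · refine isFor_circWrite hs hc (k := n + 6) (y := n + 7 / 5) ?_ ?_ ?_
    · intro s h; simp [IExp.eval, h.length]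
    · intro s h; simp [RExp.eval, RExp.length, RExp.ratio, IExp.eval, h.length]
    · rw [gadgetVertex, if_neg (by omega), if_neg (by omega), if_neg (by omega), if_neg (by omega),
        if_neg (by omega), if_pos (by omega), show 2 * n + 7 - (n + 6) = n + 1 by omega, t1,
        show (n : ℝ) + 2 - 3 / 5 = n + 7 / 5 by ring]
  · refine isFor_circWrite hs hc (k := 2 * n + 7) (y := n + 13 / 5) ?_ ?_ ?_
    · intro s h; simp [IExp.eval, h.length]; omega
    · intro s h; simp [RExp.eval, RExp.length, RExp.ratio, IExp.eval, h.length]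
    · rw [gadgetVertex, if_neg (by omega), if_neg (by omega), if_neg (by omega), if_neg (by omega),
        if_neg (by omega), if_pos (by omega), Nat.sub_self, t0,
        show (n : ℝ) + 2 - -(3 / 5) = n + 13 / 5 by ring]
  · refine isFor_tangentWrite hs hc (k := 2 * n + 8) (y₁ := n + 13 / 5) (y₂ := 2 * n + 4) ?_ ?_ ?_ ?_
    · intro s h; simp [IExp.eval, h.length]; omega
    · intro s h; simp [RExp.eval, RExp.length, RExp.ratio, IExp.eval, h.length]
    · intro s h; simp [RExp.eval, RExp.length, IExp.eval, h.length]; ring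
    · rw [gadgetVertex, if_neg (by omega), if_neg (by omega), if_neg (by omega), if_neg (by omega),
        if_neg (by omega), if_neg (by omega), if_pos rfl]
  · refine isFor_circWrite hs hc (k := 2 * n + 9) (y := 2 * n + 4) ?_ ?_ ?_
    · intro s h; simp [IExp.eval, h.length]; omega
    · intro s h; simp [RExp.eval, RExp.length, IExp.eval, h.length]; ring
    · rw [gadgetVertex, if_neg (by omega), if_neg (by omega), if_neg (by omega), if_neg (by omega),
        if_neg (by omega), if_neg (by omega), if_neg (by omega), if_pos rfl]
  · intro s h
    have hk : n + n + 10 = 2 * n + 10 := by omega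
    simp only [RExp.eval, RExp.ratio, IExp.eval, h.length, hk]
    rw [gadgetVertex, if_neg (by omega), if_neg (by omega), if_neg (by omega), if_neg (by omega),
      if_neg (by omega), if_neg (by omega), if_neg (by omega), if_neg (by omega)]
    simp

end Writes

/-! ### The reduction program and the verification of its oracle input. -/

section Reduction

variable {F : Set (ℝ → ℝ)} (sn cs : F)

variable (F) in
/-- Scale the sorted array and set the scale of the angles. -/
def scaleProg : Prog F :=
  .seq (.forLoop 1 0 (.rput 7 (.reg 1) (.div (.get 6 (.reg 1)) (.mul (.const 10) (.reg 1)))))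
    (.rset 5 (.mul (.const 8) (.add .length (.const 1))))

/-- Write the vertices and the points that belong to terms of the sequence. -/
def termsProg : Prog F :=
  .forLoop 1 0 (.seq (writeProg 1 2 (termVertexWrites sn cs))
    (writeProg 3 4 (termPointWrites sn cs)))

/-- Write the other vertices and points, the center and the lengths of the arrays. -/
def finishProg : Prog F :=
  .seq (writeProg 1 2 (fixedVertexWrites sn cs)) (.seq (writeProg 3 4 (guardWrites sn cs))
    (.seq (.seq (.rput 8 (.const 0) (.const 0)) (.rput 8 (.const 1) (.const 0)))
      (.seq (.iset 10 (.const 2)) (.seq (.iset 11 (.add (.add (.reg 0) (.reg 0)) (.const 11)))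
        (.iset 12 (.add (.add (.reg 0) (.reg 0)) (.const 2)))))))

/-- The arrays passed to the oracle. -/
def queryArgs : List (ℕ × ℕ) := [(8, 10), (1, 11), (2, 11), (3, 12), (4, 12)]

variable (F) in
/-- Find the two terms of the sequence that the angle in register `6` reveals. -/
def decodeProg : Prog F :=
  .seq (.seq (.rset 6 (.mul (.reg 6) (.reg 5))) (.rset 7 (.get 7 (.const 0))))
    (.forLoop 1 0
      (.ite (.rlt (.sub (.add (.cast (.reg 1)) (.const 1)) (.reg 6)) (.ratio 1 4))
        (.ite (.rlt (.ratio (-1) 4) (.sub (.add (.cast (.reg 1)) (.const 1)) (.reg 6)))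
          (.seq (.rset 7 (.get 7 (.reg 1)))
            (.rset 8 (.sub (.add (.cast (.reg 1)) (.const 1)) (.reg 6)))) .skip) .skip))

variable (F) in
/-- Test whether registers `7` and `8` can be completed to a solution of 3SUM. -/
def verifyProg : Prog F :=
  .seq (.seq (.rset 9 (.const 0)) (.rset 10 (.const 0))) (.seq
    (.forLoop 1 0 (.seq
      (.ite (.rlt (.const 0) (.mul (.sub (.get 7 (.reg 1)) (.reg 8))
        (.sub (.get 7 (.reg 1)) (.reg 8)))) .skip (.rset 9 (.const 1)))
      (.ite (.rlt (.const 0) (.mul (.add (.get 7 (.reg 1)) (.add (.reg 7) (.reg 8)))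
        (.add (.get 7 (.reg 1)) (.add (.reg 7) (.reg 8))))) .skip (.rset 10 (.const 1)))))
    (.rset 0 (.mul (.reg 9) (.reg 10))))

/-- The reduction of 3SUM to Fixed MCR. -/
def reductionProg : Prog F :=
  .seq (.seq (sortProg F) (.seq (scaleProg F) (.seq (termsProg sn cs) (finishProg sn cs))))
    (.seq (.query queryArgs 6) (.seq (decodeProg F) (verifyProg F)))

variable {sn cs} {O : Oracle} {s : RamState} {n : ℕ} {a : ℕ → ℝ}

theorem runs_scale (hn : s.idx 0 = n) :
    Runs O (scaleProg F) s (n * 20 + 20) fun s' =>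
      s'.idx 0 = n ∧ s'.val 5 = 8 * ((n : ℝ) + 1) ∧
        ∀ i < n, s'.rarr 7 i = s.rarr 6 i / (10 * s.val 1) := by
  refine ((Runs.forLoop (N := n) (c := 8) (I := fun k s' => s'.idx 1 = k ∧ s'.idx 0 = n ∧
    s'.val = s.val ∧ s'.rarr 6 = s.rarr 6 ∧ ∀ i < k, s'.rarr 7 i = s.rarr 6 i / (10 * s.val 1))
    ?_ ?_ ?_).seq fun s₁ hs₁ => Runs.of_wp ?_).mono ?_ fun _ h => h
  · exact fun k s' h => ⟨h.1, h.2.1⟩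
  · simp [hn]
  · rintro k hk s' ⟨h1, h0, hv, h6, h7⟩
    refine (Runs.of_wp ?_).mono (T := Prog.bound _)
      (by simp [Prog.bound, RExp.cost, IExp.cost]) fun _ h => h
    simp only [Prog.wp, RExp.eval, IExp.eval, h1, h6, hv]
    refine ⟨by simp [h1], by simp [h0], by simp [hv], by simp [h6], ?_⟩
    intro i hi
    by_cases hik : i = k
    · simp [hik]
    · simp [hik, h7 i (by omega)]
  · obtain ⟨-, h0, -, -, h7⟩ := hs₁
    exact ⟨h0, by simp [RExp.eval, RExp.length, IExp.eval, h0], h7⟩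
  · simp [Prog.bound, RExp.length, RExp.cost, IExp.cost]
    omega

/-- The factor 10 produces the bound 1/10 on which the margins of the geometric construction rest.
-/
theorem isScaled_div {M : ℝ} {o : ℕ → ℝ} (hM : 1 ≤ M) (hlt : ∀ i < n, |o i| < M)
    (hmono : ∀ i j, i < j → j < n → o i < o j) (ha : ∀ i < n, a i = o i / (10 * M)) :
    IsScaled n a where
  lower i hi := by
    have := (abs_lt.mp (hlt i hi)).1
    rw [ha i hi, le_div_iff₀ (by positivity)]
    linarith
  upper i hi := by
    have := (abs_lt.mp (hlt i hi)).2
    rw [ha i hi, div_le_iff₀ (by positivity)]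
    linarith
  lt i j hij hj := by
    rw [ha i (by omega), ha j hj]
    exact div_lt_div_of_pos_right (hmono i j hij hj) (by positivity)

theorem runs_terms (hs : sn.1 = Real.sin) (hc : cs.1 = Real.cos) (hn : s.idx 0 = n)
    (h5 : s.val 5 = 8 * ((n : ℝ) + 1)) (ha : s.rarr 7 = a) :
    Runs O (termsProg sn cs) s (n * 300 + 5) fun s' => BuildBase n a n s' ∧ ∀ j < n,
      HoldsAt s' 1 2 (gadgetVertex n (tipSeq n a)) (j + 4) ∧
      HoldsAt s' 1 2 (gadgetVertex n (tipSeq n a)) (2 * n + 6 - j) ∧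
      HoldsAt s' 3 4 (fun k => circ (angle n (pointPos n a k))) (j + 1) ∧
      HoldsAt s' 3 4 (fun k => circ (angle n (pointPos n a k))) (n + 1 + j) := by
  refine (Runs.forLoop (N := n) (c := 200) (I := fun k s' => BuildBase n a k s' ∧ ∀ j < k,
      HoldsAt s' 1 2 (gadgetVertex n (tipSeq n a)) (j + 4) ∧
      HoldsAt s' 1 2 (gadgetVertex n (tipSeq n a)) (2 * n + 6 - j) ∧
      HoldsAt s' 3 4 (fun k => circ (angle n (pointPos n a k))) (j + 1) ∧
      HoldsAt s' 3 4 (fun k => circ (angle n (pointPos n a k))) (n + 1 + j)) ?_ ?_ ?_).mono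
      (by omega) fun _ h => h
  · exact fun k s' h => ⟨h.1.counter, h.1.length⟩
  · exact ⟨⟨by simp [hn], by simp, by simp [h5], by simp [ha]⟩, by simp⟩
  · rintro k hk s' ⟨hb, hold⟩
    refine (Runs.of_wp ?_).mono (T := Prog.bound _)
      (by simp [Prog.bound, writeProg, termVertexWrites, termPointWrites, circWrite, RExp.length,
        RExp.cost, IExp.cost]) fun _ h => h
    refine wp_writeProg (by decide) (by decide) (by decide) hb (isFor_termVertexWrites hs hc hk) ?_
    intro s₁ hb₁ hidx₁ hr₁ hkeep₁ hnew₁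
    refine wp_writeProg (by decide) (by decide) (by decide) hb₁ (isFor_termPointWrites hs hc hk) ?_
    intro s₂ hb₂ hidx₂ hr₂ hkeep₂ hnew₂
    refine ⟨⟨by simp [hb₂.length], by simp [hb₂.counter], by simp [hb₂.scale],
      by simp [hb₂.input]⟩, ?_⟩
    have hV : ∀ m, HoldsAt s₁ 1 2 (gadgetVertex n (tipSeq n a)) m →
        HoldsAt s₂ 1 2 (gadgetVertex n (tipSeq n a)) m := by
      intro m hm
      rw [HoldsAt, hr₂ 1 (by decide) (by decide), hr₂ 2 (by decide) (by decide)]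
      exact hm
    have hP : ∀ m, HoldsAt s' 3 4 (fun k => circ (angle n (pointPos n a k))) m →
        HoldsAt s₁ 3 4 (fun k => circ (angle n (pointPos n a k))) m := by
      intro m hm
      rw [HoldsAt, hr₁ 3 (by decide) (by decide), hr₁ 4 (by decide) (by decide)]
      exact hm
    intro j hj
    rcases Nat.lt_succ_iff_lt_or_eq.mp hj with hj | rfl
    · obtain ⟨g1, g2, g3, g4⟩ := hold j hj
      exact ⟨hV _ (hkeep₁ _ g1), hV _ (hkeep₁ _ g2), hkeep₂ _ (hP _ g3), hkeep₂ _ (hP _ g4)⟩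
    · simp only [termVertexWrites, circWrite, List.forall_mem_cons, List.not_mem_nil, IExp.eval,
        false_imp_iff, implies_true, and_true, hb.counter, hb.length, ← two_mul] at hnew₁
      simp only [termPointWrites, circWrite, List.forall_mem_cons, List.not_mem_nil, IExp.eval,
        false_imp_iff, implies_true, and_true, hb₁.counter, hb₁.length, ← add_assoc] at hnew₂
      exact ⟨hV _ hnew₁.1, hV _ hnew₁.2, hnew₂.1, hnew₂.2⟩

/-- The input of the oracle is in place. -/
structure QueryReady (n : ℕ) (a : ℕ → ℝ) (s : RamState) : Prop where
  base : s.idx 0 = n ∧ s.val 5 = 8 * ((n : ℝ) + 1) ∧ s.rarr 7 = a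
  lengths : s.idx 10 = 2 ∧ s.idx 11 = 2 * n + 11 ∧ s.idx 12 = 2 * n + 2
  center : s.rarr 8 0 = 0 ∧ s.rarr 8 1 = 0
  vertices : ∀ k < 2 * n + 11, HoldsAt s 1 2 (gadgetVertex n (tipSeq n a)) k
  points : ∀ k < 2 * n + 2, HoldsAt s 3 4 (fun k => circ (angle n (pointPos n a k))) k

theorem runs_finish (hs : sn.1 = Real.sin) (hc : cs.1 = Real.cos) {j : ℕ} (hb : BuildBase n a j s)
    (hold : ∀ j < n, HoldsAt s 1 2 (gadgetVertex n (tipSeq n a)) (j + 4) ∧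
      HoldsAt s 1 2 (gadgetVertex n (tipSeq n a)) (2 * n + 6 - j) ∧
      HoldsAt s 3 4 (fun k => circ (angle n (pointPos n a k))) (j + 1) ∧
      HoldsAt s 3 4 (fun k => circ (angle n (pointPos n a k))) (n + 1 + j)) :
    Runs O (finishProg sn cs) s 1000 (QueryReady n a) := by
  refine (Runs.of_wp ?_).mono (T := Prog.bound _)
    (by simp [finishProg, Prog.bound, writeProg, fixedVertexWrites, guardWrites, circWrite, tangentWrite,
      RExp.length, RExp.ratio, RExp.cost, IExp.cost]) fun _ h => h
  refine wp_writeProg (by decide) (by decide) (by decide) hb (isFor_fixedVertexWrites hs hc) ?_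
  intro s₁ hb₁ hidx₁ hr₁ hkeep₁ hnew₁
  refine wp_writeProg (by decide) (by decide) (by decide) hb₁ (isFor_guardWrites hs hc) ?_
  intro s₂ hb₂ hidx₂ hr₂ hkeep₂ hnew₂
  simp only [fixedVertexWrites, circWrite, tangentWrite, List.forall_mem_cons, List.not_mem_nil,
    IExp.eval, false_imp_iff, implies_true, and_true, hb.length, ← two_mul] at hnew₁
  simp only [guardWrites, circWrite, List.forall_mem_cons, List.not_mem_nil, IExp.eval,
    false_imp_iff, implies_true, and_true, hb₁.length, ← two_mul] at hnew₂
  obtain ⟨w0, w1, w2, w3, w4, w5, w6, w7, w8, w9, w10⟩ := hnew₁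
  have hV : ∀ k < 2 * n + 11, HoldsAt s₁ 1 2 (gadgetVertex n (tipSeq n a)) k := by
    intro k hk
    by_cases h1 : 4 ≤ k ∧ k < n + 4
    · obtain ⟨i, rfl⟩ : ∃ i, k = i + 4 := ⟨k - 4, by omega⟩
      exact hkeep₁ _ (hold i (by omega)).1
    by_cases h2 : n + 7 ≤ k ∧ k < 2 * n + 7
    · obtain ⟨i, hi, rfl⟩ : ∃ i < n, k = 2 * n + 6 - i := ⟨2 * n + 6 - k, by omega, by omega⟩
      exact hkeep₁ _ (hold i hi).2.1
    -- Outside the two runs of term vertices there remain the two feet, the six ends of windows and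
    -- the three intersections of tangents.
    have hcases : k = 0 ∨ k = 1 ∨ k = 2 ∨ k = 3 ∨ k = n + 4 ∨ k = n + 5 ∨ k = n + 6 ∨
        k = 2 * n + 7 ∨ k = 2 * n + 8 ∨ k = 2 * n + 9 ∨ k = 2 * n + 10 := by omega
    rcases hcases with rfl | rfl | rfl | rfl | rfl | rfl | rfl | rfl | rfl | rfl | rfl <;> assumption
  have hP : ∀ k < 2 * n + 2, HoldsAt s₂ 3 4 (fun k => circ (angle n (pointPos n a k))) k := by
    have hP' : ∀ m, HoldsAt s 3 4 (fun k => circ (angle n (pointPos n a k))) m →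
        HoldsAt s₂ 3 4 (fun k => circ (angle n (pointPos n a k))) m := by
      intro m hm
      refine hkeep₂ m ?_
      rw [HoldsAt, hr₁ 3 (by decide) (by decide), hr₁ 4 (by decide) (by decide)]
      exact hm
    intro k hk
    rcases Nat.eq_zero_or_pos k with rfl | h0
    · exact hnew₂.1
    by_cases h1 : k ≤ n
    · obtain ⟨i, rfl⟩ : ∃ i, k = i + 1 := ⟨k - 1, by omega⟩
      exact hP' _ (hold i (by omega)).2.2.1
    by_cases h2 : k ≤ 2 * n
    · obtain ⟨i, rfl⟩ : ∃ i, k = n + 1 + i := ⟨k - (n + 1), by omega⟩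
      exact hP' _ (hold i (by omega)).2.2.2
    · rw [show k = 2 * n + 1 by omega]
      exact hnew₂.2
  simp only [Prog.wp, RExp.eval, IExp.eval]
  refine ⟨⟨by simp [hb₂.length], by simp [hb₂.scale], by simp [hb₂.input]⟩,
    ⟨by simp, by simp [hb₂.length, ← two_mul], by simp [hb₂.length, ← two_mul]⟩,
    ⟨by simp, by simp⟩, ?_, ?_⟩
  · intro k hk
    have := hV k hk
    rw [HoldsAt, ← hr₂ 1 (by decide) (by decide), ← hr₂ 2 (by decide) (by decide)] at this
    simpa [HoldsAt] using this
  · intro k hk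
    simpa [HoldsAt] using hP k hk

/-- The oracle is only known to be correct on encodings of instances, so the arrays passed must
agree with such an encoding exactly. -/
theorem pass_queryArgs (S : IsScaled n a) (h : QueryReady n a s) :
    s.pass queryArgs = fixedMCR.encode S.gadget := by
  obtain ⟨-, ⟨l10, l11, l12⟩, ⟨c0, c1⟩, hV, hP⟩ := h
  have hof : ∀ (N : ℕ) (g : ℕ → ℝ), (List.ofFn fun i : Fin N => g i) = (List.range N).map g := by
    intro N g
    apply List.ext_getElem <;> simp
  simp only [RamState.pass, queryArgs, List.map_cons, List.map_nil, l10, l11, l12, fixedMCR]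
  refine List.cons_eq_cons.mpr ⟨?_, List.cons_eq_cons.mpr ⟨?_, List.cons_eq_cons.mpr ⟨?_,
    List.cons_eq_cons.mpr ⟨?_, List.cons_eq_cons.mpr ⟨?_, rfl⟩⟩⟩⟩⟩
  · simp [IsScaled.gadget, List.range_succ, c0, c1]
  · refine Eq.trans ?_ (hof _ fun k => (gadgetVertex n (tipSeq n a) k).re).symm
    exact List.map_congr_left fun k hk => (hV k (List.mem_range.mp hk)).1
  · refine Eq.trans ?_ (hof _ fun k => (gadgetVertex n (tipSeq n a) k).im).symm
    exact List.map_congr_left fun k hk => (hV k (List.mem_range.mp hk)).2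
  · simp only [IsScaled.gadget, List.map_map]
    exact List.map_congr_left fun k hk => (hP k (List.mem_range.mp hk)).1
  · simp only [IsScaled.gadget, List.map_map]
    exact List.map_congr_left fun k hk => (hP k (List.mem_range.mp hk)).2

end Reduction

/-! ### Reading a triple off the angle. -/

section Decode

variable {F : Set (ℝ → ℝ)} {O : Oracle} {s : RamState} {n : ℕ} {a : ℕ → ℝ}

/-- If v = i + 1 - a j with |a j| ≤ 1/10, then `i + 1` is the only integer within 1/4 of `v`, and
the difference is `a j`. For any other angle, loading `a 0` at the start ensures that register 7
still holds a term when there is one; soundness needs no more. -/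
theorem runs_decode {v : ℝ} (hn : s.idx 0 = n) (ha : s.rarr 7 = a) (hv : s.val 6 * s.val 5 = v) :
    Runs O (decodeProg F) s (n * 80 + 20) fun s' =>
      s'.idx 0 = n ∧ s'.rarr 7 = a ∧ (0 < n → ∃ i < n, s'.val 7 = a i) ∧
      ∀ i < n, (i : ℝ) + 1 - v < 1 / 4 → -(1 / 4) < (i : ℝ) + 1 - v →
        s'.val 7 = a i ∧ s'.val 8 = (i : ℝ) + 1 - v := by
  refine ((Runs.of_wp (p := .seq (.rset 6 (.mul (.reg 6) (.reg 5))) (.rset 7 (.get 7 (.const 0))))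
    (R := fun s' => s' = (s.setVal 6 v).setVal 7 (a 0)) ?_).seq fun s₁ hs₁ =>
    Runs.forLoop (N := n) (c := 60) (I := fun k s' => s'.idx 1 = k ∧ s'.idx 0 = n ∧
      s'.rarr 7 = a ∧ s'.val 6 = v ∧ (0 < n → ∃ i < n, s'.val 7 = a i) ∧
      ∀ i < k, (i : ℝ) + 1 - v < 1 / 4 → -(1 / 4) < (i : ℝ) + 1 - v →
        s'.val 7 = a i ∧ s'.val 8 = (i : ℝ) + 1 - v) ?_ ?_ ?_).mono ?_ ?_
  · simp [Prog.wp, RExp.eval, IExp.eval, hv, ha]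
  · exact fun k s' h => ⟨h.1, h.2.1⟩
  · subst hs₁
    refine ⟨by simp, by simp [hn], by simp [ha], by simp, fun h => ⟨0, h, by simp⟩, by simp⟩
  · rintro k hk s' ⟨h1, h0, h7, h6, hex, hall⟩
    refine (Runs.of_wp ?_).mono (T := Prog.bound _)
      (by simp [Prog.bound, Test.cost, RExp.ratio, RExp.cost, IExp.cost]) fun _ h => h
    simp only [Prog.wp, Test.holds, RExp.ratio, RExp.eval, IExp.eval, h1, h6, h7, Int.cast_one,
      Int.cast_ofNat, Int.cast_neg, neg_div]
    refine ⟨fun hlt => ⟨fun hgt => ?_, fun hgt => ?_⟩, fun hlt => ?_⟩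
    · refine ⟨by simp [h1], by simp [h0], by simp [h7], by simp [h6], fun _ => ⟨k, hk, by simp⟩, ?_⟩
      intro i hi hi1 hi2
      rcases Nat.lt_succ_iff_lt_or_eq.mp hi with hi | rfl
      · have : (i : ℝ) + 1 ≤ k := by exact_mod_cast hi
        linarith
      · simp [h1, h6]
    · refine ⟨by simp, by simp [h0], by simp [h7], by simp [h6], by simpa using hex, ?_⟩
      intro i hi hi1 hi2
      rcases Nat.lt_succ_iff_lt_or_eq.mp hi with hi | rfl
      · simpa using hall i hi hi1 hi2
      · exact absurd hi2 hgt
    · refine ⟨by simp, by simp [h0], by simp [h7], by simp [h6], by simpa using hex, ?_⟩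
      intro i hi hi1 hi2
      rcases Nat.lt_succ_iff_lt_or_eq.mp hi with hi | rfl
      · simpa using hall i hi hi1 hi2
      · exact absurd hi1 hlt
  · simp [Prog.bound, RExp.cost, IExp.cost]
    omega
  · rintro s' ⟨-, h0, h7, -, hex, hall⟩
    exact ⟨h0, h7, hex, hall⟩

/-- `y` is the truth value of `P`. -/
def IsIndicator (y : ℝ) (P : Prop) : Prop := (y = 1 ∧ P) ∨ (y = 0 ∧ ¬ P)

theorem IsIndicator.and {y z : ℝ} {P Q : Prop} (hy : IsIndicator y P) (hz : IsIndicator z Q) :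
    IsIndicator (y * z) (P ∧ Q) := by
  rcases hy with ⟨rfl, hP⟩ | ⟨rfl, hP⟩
  · rcases hz with ⟨rfl, hQ⟩ | ⟨rfl, hQ⟩
    · exact Or.inl ⟨by simp, hP, hQ⟩
    · exact Or.inr ⟨by simp, fun h => hQ h.2⟩
  · exact Or.inr ⟨by simp, fun h => hP h.1⟩

theorem isIndicator_exists_succ {y : ℝ} {k : ℕ} {P : ℕ → Prop}
    (h : IsIndicator y (∃ j < k, P j)) (hk : ¬ P k) : IsIndicator y (∃ j < k + 1, P j) := by
  have : (∃ j < k + 1, P j) ↔ ∃ j < k, P j := by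
    constructor
    · rintro ⟨j, hj, hP⟩
      rcases Nat.lt_succ_iff_lt_or_eq.mp hj with hj | rfl
      · exact ⟨j, hj, hP⟩
      · exact absurd hP hk
    · rintro ⟨j, hj, hP⟩
      exact ⟨j, by omega, hP⟩
  rwa [this]

/-- Strict inequality is the only comparison, so z = 0 is tested as the failure of 0 < z². The
product of the two flags is their conjunction. -/
theorem runs_verify {x y : ℝ} (hn : s.idx 0 = n) (ha : s.rarr 7 = a) (h7 : s.val 7 = x)
    (h8 : s.val 8 = y) :
    Runs O (verifyProg F) s (n * 80 + 20) fun s' =>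
      IsIndicator (s'.val 0) ((∃ j < n, a j = y) ∧ ∃ j < n, a j + (x + y) = 0) := by
  refine ((Runs.of_wp (p := .seq (.rset 9 (.const 0)) (.rset 10 (.const 0)))
    (R := fun s' => s' = (s.setVal 9 0).setVal 10 0) ?_).seq fun s₁ hs₁ =>
    (Runs.forLoop (N := n) (c := 50) (I := fun k s' => s'.idx 1 = k ∧ s'.idx 0 = n ∧
      s'.rarr 7 = a ∧ s'.val 7 = x ∧ s'.val 8 = y ∧ IsIndicator (s'.val 9) (∃ j < k, a j = y) ∧
      IsIndicator (s'.val 10) (∃ j < k, a j + (x + y) = 0)) ?_ ?_ ?_).seq fun s₂ hs₂ =>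
    Runs.of_wp (p := .rset 0 (.mul (.reg 9) (.reg 10))) ?_).mono ?_ fun _ h => h
  · simp [Prog.wp, RExp.eval]
  · exact fun k s' h => ⟨h.1, h.2.1⟩
  · subst hs₁
    simp [hn, ha, h7, h8, IsIndicator]
  · rintro k hk s' ⟨h1, h0, hr, g7, g8, h9, h10⟩
    have hsq : ∀ z : ℝ, 0 < z * z ↔ z ≠ 0 := fun z => mul_self_pos
    refine ((Runs.of_wp (p := .ite (.rlt (.const 0) (.mul (.sub (.get 7 (.reg 1)) (.reg 8))
        (.sub (.get 7 (.reg 1)) (.reg 8)))) .skip (.rset 9 (.const 1)))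
        (R := fun s' => s'.idx 1 = k ∧ s'.idx 0 = n ∧ s'.rarr 7 = a ∧ s'.val 7 = x ∧ s'.val 8 = y ∧
          IsIndicator (s'.val 9) (∃ j < k + 1, a j = y) ∧
          IsIndicator (s'.val 10) (∃ j < k, a j + (x + y) = 0)) ?_).seq
      fun s₃ hs₃ => Runs.of_wp ?_).mono
        (by simp [Prog.bound, Test.cost, RExp.cost, IExp.cost]) fun _ h => h
    · simp only [Prog.wp, Test.holds, RExp.eval, IExp.eval, h1, hr, g8, Int.cast_zero, hsq,
        sub_ne_zero]
      refine ⟨fun h => ⟨trivial, h0, trivial, g7, trivial, isIndicator_exists_succ h9 h, h10⟩, fun h => ?_⟩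
      rw [not_not] at h
      exact ⟨h1, h0, hr, by simp [g7], by simp [g8], Or.inl ⟨by simp, k, by omega, h⟩,
        by simpa using h10⟩
    · obtain ⟨h1, h0, hr, g7, g8, h9, h10⟩ := hs₃
      simp only [Prog.wp, Test.holds, RExp.eval, IExp.eval, h1, hr, g7, g8, Int.cast_zero, hsq]
      refine ⟨fun h => ?_, fun h => ?_⟩
      · exact ⟨by simp, by simp [h0], by simp [hr], by simp [g7], by simp [g8], by simpa using h9,
          by simpa using isIndicator_exists_succ h10 h⟩
      · rw [not_not] at h
        exact ⟨by simp [h1], by simp [h0], by simp [hr], by simp [g7], by simp [g8],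
          by simpa using h9, Or.inl ⟨by simp, k, by omega, h⟩⟩
  · obtain ⟨-, -, -, -, -, h9, h10⟩ := hs₂
    simpa only [Prog.wp, RExp.eval, RamState.setVal_val, Function.update_self] using h9.and h10
  · simp [Prog.bound, RExp.cost]
    omega

end Decode

/-! ### Subquadratic bounds and correctness of the reduction. -/

section Correctness

variable {F : Set (ℝ → ℝ)} {n : ℕ}

theorem subquadratic_of_le {f : ℕ → ℕ} {δ A : ℝ} (hδ : 0 < δ) (hδ' : δ ≤ 2)
    (h : ∀ n, (f n : ℝ) ≤ A * ((n : ℝ) + 1) ^ (2 - δ)) : Subquadratic f := by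
  have hA : 0 ≤ A := by have := (Nat.cast_nonneg (f 0)).trans (h 0); simpa using this
  refine ⟨δ, hδ, IsBigO.of_bound (A * 2 ^ (2 - δ)) ?_⟩
  filter_upwards [eventually_ge_atTop 1] with n hn
  have hn' : (1 : ℝ) ≤ n := by exact_mod_cast hn
  rw [Real.norm_of_nonneg (by positivity), Real.norm_of_nonneg (by positivity), mul_assoc,
    ← Real.mul_rpow (by norm_num) (by positivity)]
  exact (h n).trans (mul_le_mul_of_nonneg_left
    (Real.rpow_le_rpow (by positivity) (by linarith) (by linarith)) hA)

/-- A bound in terms of n + 1 can hold for all n; the constant absorbs the finitely many early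
values. Replacing δ by min δ 1 keeps the exponent nonnegative, so the power is monotone in its base.
-/
theorem Subquadratic.exists_le {f : ℕ → ℕ} (h : Subquadratic f) :
    ∃ δ A : ℝ, 0 < δ ∧ δ ≤ 1 ∧ 0 ≤ A ∧ ∀ n, (f n : ℝ) ≤ A * ((n : ℝ) + 1) ^ (2 - δ) := by
  obtain ⟨δ, hδ, hO⟩ := h
  obtain ⟨c, hc0, hc⟩ := hO.exists_nonneg
  obtain ⟨N, hN⟩ := eventually_atTop.mp hc.bound
  refine ⟨min δ 1, c + ∑ i ∈ Finset.range (N + 1), (f i : ℝ), by positivity, min_le_right _ _,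
    by positivity, fun n => ?_⟩
  have hbase : (1 : ℝ) ≤ (n : ℝ) + 1 := by have := Nat.cast_nonneg (α := ℝ) n; linarith
  have hexp : 0 ≤ 2 - min δ 1 := by have := min_le_right δ 1; linarith
  have hone : 1 ≤ ((n : ℝ) + 1) ^ (2 - min δ 1) := Real.one_le_rpow hbase hexp
  have hS : 0 ≤ ∑ i ∈ Finset.range (N + 1), (f i : ℝ) := by positivity
  by_cases hn : n < N + 1
  · have h1 : (f n : ℝ) ≤ ∑ i ∈ Finset.range (N + 1), (f i : ℝ) :=
      Finset.single_le_sum (f := fun i => (f i : ℝ)) (fun i _ => Nat.cast_nonneg _)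
        (Finset.mem_range.mpr hn)
    nlinarith
  · have h1 := hN n (by omega)
    rw [Real.norm_of_nonneg (by positivity), Real.norm_of_nonneg (by positivity)] at h1
    have hn1 : (1 : ℝ) ≤ n := by exact_mod_cast (by omega : 1 ≤ n)
    have h2 : (n : ℝ) ^ (2 - δ) ≤ ((n : ℝ) + 1) ^ (2 - min δ 1) :=
      (Real.rpow_le_rpow_of_exponent_le hn1 (by have := min_le_left δ 1; linarith)).trans
        (Real.rpow_le_rpow (by positivity) (by linarith) hexp)
    nlinarith [mul_le_mul_of_nonneg_left h2 hc0]

theorem subquadratic_sqrt (c : ℕ) : Subquadratic fun n => c * ((n + 1) * (Nat.sqrt n + 1)) := by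
  refine subquadratic_of_le (δ := 1 / 2) (A := c * 2) (by norm_num) (by norm_num) fun n => ?_
  have h1 : (Nat.sqrt n : ℝ) ≤ √((n : ℝ) + 1) :=
    Real.nat_sqrt_le_real_sqrt.trans (Real.sqrt_le_sqrt (by linarith))
  have h2 : (1 : ℝ) ≤ √((n : ℝ) + 1) := by
    rw [Real.one_le_sqrt]; have := Nat.cast_nonneg (α := ℝ) n; linarith
  have h3 : ((n : ℝ) + 1) ^ (2 - 1 / 2 : ℝ) = ((n : ℝ) + 1) * √((n : ℝ) + 1) := by
    rw [Real.sqrt_eq_rpow, show (2 - 1 / 2 : ℝ) = 1 + 1 / 2 by norm_num,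
      Real.rpow_add (by positivity), Real.rpow_one]
  rw [h3]
  push_cast
  have h4 : ((n : ℝ) + 1) * ((Nat.sqrt n : ℝ) + 1) ≤ ((n : ℝ) + 1) * (2 * √((n : ℝ) + 1)) :=
    mul_le_mul_of_nonneg_left (by linarith) (by positivity)
  calc (c : ℝ) * (((n : ℝ) + 1) * ((Nat.sqrt n : ℝ) + 1))
      ≤ c * (((n : ℝ) + 1) * (2 * √((n : ℝ) + 1))) := mul_le_mul_of_nonneg_left h4 (by positivity)
    _ = c * 2 * (((n : ℝ) + 1) * √((n : ℝ) + 1)) := by ring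

theorem passCost_gadget {a : ℕ → ℝ} (S : IsScaled n a) :
    passCost (fixedMCR.encode S.gadget) = 8 * n + 33 := by
  simp [passCost, fixedMCR, IsScaled.gadget]
  ring

theorem exists_getD_of_mem {l : List ℝ} {x : ℝ} (hx : x ∈ l) : ∃ i < l.length, x = l.getD i 0 := by
  obtain ⟨i, hi, rfl⟩ := List.mem_iff_getElem.mp hx
  exact ⟨i, hi, by simp [hi]⟩

theorem getD_mem {l : List ℝ} {i : ℕ} (hi : i < l.length) : l.getD i 0 ∈ l := by
  simp [hi]

/-- 3SUM is not affected by sorting and scaling. -/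
theorem exists_triple_iff {l : List ℝ} {o a : ℕ → ℝ} {c : ℝ} (hc : 0 < c) (hn : l.length = n)
    (h1 : ∀ i < n, ∃ j < n, o i = l.getD j 0) (h2 : ∀ j < n, ∃ i < n, l.getD j 0 = o i)
    (ha : ∀ i < n, a i = o i / c) :
    (∃ x ∈ l, ∃ y ∈ l, ∃ z ∈ l, x + y + z = 0) ↔
      ∃ i < n, ∃ j < n, ∃ k < n, a i + a j + a k = 0 := by
  have hmem : ∀ x ∈ l, ∃ i < n, a i = x / c := by
    intro x hx
    obtain ⟨j, hj, rfl⟩ := exists_getD_of_mem hx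
    obtain ⟨i, hi, h⟩ := h2 j (hn ▸ hj)
    exact ⟨i, hi, by rw [ha i hi, h]⟩
  have hmem' : ∀ i < n, c * a i ∈ l := by
    intro i hi
    obtain ⟨j, hj, h⟩ := h1 i hi
    rw [ha i hi, h, mul_div_cancel₀ _ hc.ne']
    exact getD_mem (hn ▸ hj)
  constructor
  · rintro ⟨x, hx, y, hy, z, hz, h⟩
    obtain ⟨i, hi, ei⟩ := hmem x hx
    obtain ⟨j, hj, ej⟩ := hmem y hy
    obtain ⟨k, hk, ek⟩ := hmem z hz
    refine ⟨i, hi, j, hj, k, hk, ?_⟩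
    rw [ei, ej, ek, ← add_div, ← add_div, h, zero_div]
  · rintro ⟨i, hi, j, hj, k, hk, h⟩
    refine ⟨_, hmem' i hi, _, hmem' j hj, _, hmem' k hk, ?_⟩
    rw [← mul_add, ← mul_add, h, mul_zero]

theorem threeSum_reducible (hsin : Real.sin ∈ F) (hcos : Real.cos ∈ F) :
    IsThreeSumHard F fixedMCR := by
  refine ⟨reductionProg ⟨_, hsin⟩ ⟨_, hcos⟩, fun n => 3000 * ((n + 1) * (Nat.sqrt n + 1)), 1, 13,
    subquadratic_sqrt _, ?_⟩
  rintro O hO ⟨l, hl⟩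
  set n := l.length with hn
  set s₀ := RamState.init (threeSum.encode ⟨l, hl⟩) with hs₀
  have hlen : s₀.idx 0 = n := rfl
  have harr : s₀.rarr 0 = fun i => l.getD i 0 := rfl
  have hinj : ∀ i < n, ∀ j < n, l.getD i 0 = l.getD j 0 → i = j := by
    intro i hi j hj hij
    rw [List.getD_eq_getElem _ _ hi, List.getD_eq_getElem _ _ hj] at hij
    exact (List.Nodup.getElem_inj_iff hl).mp hij
  have hprep : Runs O (.seq (sortProg F) (.seq (scaleProg F) (.seq (termsProg ⟨_, hsin⟩ ⟨_, hcos⟩)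
      (finishProg ⟨_, hsin⟩ ⟨_, hcos⟩)))) s₀
      (400 * ((n + 1) * (Nat.sqrt n + 1)) + ((n * 20 + 20) + ((n * 300 + 5) + 1000)))
      fun s' => ∃ a, IsScaled n a ∧ QueryReady n a s' ∧
        ((∃ x ∈ l, ∃ y ∈ l, ∃ z ∈ l, x + y + z = 0) ↔
          ∃ i < n, ∃ j < n, ∃ k < n, a i + a j + a k = 0) := by
    refine (runs_sort hlen harr hinj).seq fun s₁ ⟨a0, a1, a2, a3, a4, a5⟩ =>
      (runs_scale a0).seq fun s₂ ⟨b0, b1, b2⟩ => (runs_terms rfl rfl b0 b1 rfl).seq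
      fun s₃ ⟨c0, c1⟩ => (runs_finish rfl rfl c0 c1).mono le_rfl fun s' h => ?_
    refine ⟨_, isScaled_div a1 ?_ a5 b2, h, exists_triple_iff (by positivity) rfl a3 a4 b2⟩
    intro i hi
    obtain ⟨j, hj, h'⟩ := a3 i hi
    rw [h']
    exact a2 j hj
  obtain ⟨s₁, t₁, he₁, ht₁, a, S, hq, hiff⟩ := hprep
  obtain ⟨θ, hθ, hcorrect⟩ := hO S.gadget
  have hpass := pass_queryArgs S hq
  rw [← hpass] at hθ
  have hquery : Exec (F := F) O (.query queryArgs 6) s₁ _ _ _ := .query queryArgs 6 hθ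
  have hdec : Runs O (.seq (decodeProg F) (verifyProg F)) (s₁.setVal 6 θ)
      ((n * 80 + 20) + (n * 80 + 20)) fun s' => threeSum.Correct ⟨l, hl⟩ (s'.val 0) := by
    refine (runs_decode (n := n) (a := a) (v := θ * (8 * (n + 1))) ?_ ?_ ?_).seq
      fun s₂ ⟨d0, d1, d2, d3⟩ => (runs_verify d0 d1 rfl rfl).mono le_rfl fun s' h => ?_
    · simp [hq.base.1]
    · simp [hq.base.2.2]
    · simp [hq.base.2.1]
    · have hequiv : ((∃ j < n, a j = s₂.val 8) ∧ ∃ j < n, a j + (s₂.val 7 + s₂.val 8) = 0) ↔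
          ∃ x ∈ l, ∃ y ∈ l, ∃ z ∈ l, x + y + z = 0 := by
        rw [hiff]
        constructor
        · rintro ⟨⟨j, hj, ej⟩, k, hk, h⟩
          obtain ⟨i, hi, ei⟩ := d2 (by omega)
          exact ⟨i, hi, j, hj, k, hk, by rw [← ei, ej]; linarith⟩
        · intro hex
          obtain ⟨i, hi, j, hj, k, hk, hv, h⟩ := S.exists_triple_of_correct hcorrect hex
          have hb1 := S.lower j hj
          have hb2 := S.upper j hj
          obtain ⟨e7, e8⟩ := d3 i hi (by rw [hv]; linarith) (by rw [hv]; linarith)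
          exact ⟨⟨j, hj, by rw [e8, hv]; ring⟩, k, hk, by rw [e7, e8, hv]; linarith⟩
      rw [IsIndicator, hequiv] at h
      exact h
  obtain ⟨s₂, t₂, he₂, ht₂, hfinal⟩ := hdec
  refine ⟨s₂, _, _, he₁.seq (hquery.seq he₂), hfinal, ?_, by simp, ?_⟩
  · rw [hpass, passCost_gadget]
    have h1 : (n + 1) * 1 ≤ (n + 1) * (Nat.sqrt n + 1) := Nat.mul_le_mul_left _ (by omega)
    simp only [threeSum]
    rw [← hn]
    generalize (n + 1) * (Nat.sqrt n + 1) = p at *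
    omega
  · intro L hL
    refine ⟨S.gadget, by simpa [hpass] using hL, ?_⟩
    -- The size is (2n + 2) + (2n + 11) = 4n + 13.
    simp only [fixedMCR, IsScaled.gadget, threeSum, List.length_map, List.length_range]
    omega

end Correctness

/-! ### Replacing the oracle by a subroutine -/

/-- Replace every question to the oracle by a call of the program `q`. -/
def Prog.replaceQuery {F : Set (ℝ → ℝ)} : Prog F → Prog F → Prog F
  | .seq p₁ p₂, q => .seq (p₁.replaceQuery q) (p₂.replaceQuery q)
  | .ite b p₁ p₂, q => .ite b (p₁.replaceQuery q) (p₂.replaceQuery q)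
  | .while b p, q => .while b (p.replaceQuery q)
  | .call body args x, q => .call (body.replaceQuery q) args x
  | .query args x, q => .call q args x
  | p, _ => p

section Transfer

variable {F : Set (ℝ → ℝ)}

/-- This makes the answer selected by choice in `oracleOf` the answer of every halting run. -/
theorem Exec.deterministic {O : Oracle} {p : Prog F} {s s₁ s₂ : RamState} {t₁ t₂ : ℕ}
    {Q₁ Q₂ : List (List (List ℝ))} (h₁ : Exec O p s s₁ t₁ Q₁) (h₂ : Exec O p s s₂ t₂ Q₂) :
    s₁ = s₂ ∧ t₁ = t₂ := by
  induction h₁ generalizing s₂ t₂ Q₂ with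
  | skip s => cases h₂; exact ⟨rfl, rfl⟩
  | iset s i e => cases h₂; exact ⟨rfl, rfl⟩
  | rset s x e => cases h₂; exact ⟨rfl, rfl⟩
  | iput s a pos e => cases h₂; exact ⟨rfl, rfl⟩
  | rput s a pos e => cases h₂; exact ⟨rfl, rfl⟩
  | seq hp hq ihp ihq =>
    cases h₂ with
    | seq hp' hq' =>
      obtain ⟨rfl, rfl⟩ := ihp hp'
      obtain ⟨rfl, rfl⟩ := ihq hq'
      exact ⟨rfl, rfl⟩
  | ite_true hb hp ih =>
    cases h₂ with
    | ite_true hb' hp' =>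
      obtain ⟨rfl, rfl⟩ := ih hp'
      exact ⟨rfl, rfl⟩
    | ite_false hb' hp' => exact absurd hb hb'
  | ite_false hb hp ih =>
    cases h₂ with
    | ite_true hb' hp' => exact absurd hb' hb
    | ite_false hb' hp' =>
      obtain ⟨rfl, rfl⟩ := ih hp'
      exact ⟨rfl, rfl⟩
  | while_false hb =>
    cases h₂ with
    | while_false hb' => exact ⟨rfl, rfl⟩
    | while_true hb' hp' hw' => exact absurd hb' hb
  | while_true hb hp hw ihp ihw =>
    cases h₂ with
    | while_false hb' => exact absurd hb hb'
    | while_true hb' hp' hw' =>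
      obtain ⟨rfl, rfl⟩ := ihp hp'
      obtain ⟨rfl, rfl⟩ := ihw hw'
      exact ⟨rfl, rfl⟩
  | call args x hp ih =>
    cases h₂ with
    | call _ _ hp' =>
      obtain ⟨rfl, rfl⟩ := ih hp'
      exact ⟨rfl, rfl⟩
  | query args x hy =>
    cases h₂ with
    | query _ _ hy' =>
      rw [hy] at hy'
      cases hy'
      exact ⟨rfl, rfl⟩

/-- The program `q` returns the answer of the oracle `O` to the question `L` within `T` steps. -/
def Simulates (q : Prog F) (O : Oracle) (T : ℕ) (L : List (List ℝ)) : Prop :=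
  ∃ s t, Exec (fun _ => none) q (RamState.init L) s t [] ∧ O L = some (s.val 0) ∧ t ≤ T

/-- A call passes its input at the same price as a question and has the same effect when the answers
agree, so each question adds only the running time of the subroutine. -/
theorem Exec.replaceQuery {O : Oracle} {q p : Prog F} {s s' : RamState} {t T : ℕ}
    {Q : List (List (List ℝ))} (h : Exec O p s s' t Q) (hQ : ∀ L ∈ Q, Simulates q O T L) :
    ∃ t', Exec (fun _ => none) (p.replaceQuery q) s s' t' [] ∧ t' ≤ t + Q.length * T := by
  induction h with
  | skip s => exact ⟨_, .skip s, by omega⟩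
  | iset s i e => exact ⟨_, .iset s i e, by omega⟩
  | rset s x e => exact ⟨_, .rset s x e, by omega⟩
  | iput s a pos e => exact ⟨_, .iput s a pos e, by omega⟩
  | rput s a pos e => exact ⟨_, .rput s a pos e, by omega⟩
  | seq hp hq ihp ihq =>
    obtain ⟨t₁, h₁, e₁⟩ := ihp fun L hL => hQ L (List.mem_append_left _ hL)
    obtain ⟨t₂, h₂, e₂⟩ := ihq fun L hL => hQ L (List.mem_append_right _ hL)
    exact ⟨_, h₁.seq h₂, by rw [List.length_append, add_mul]; omega⟩
  | ite_true hb hp ih =>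
    obtain ⟨t₁, h₁, e₁⟩ := ih hQ
    exact ⟨_, .ite_true hb h₁, by omega⟩
  | ite_false hb hp ih =>
    obtain ⟨t₁, h₁, e₁⟩ := ih hQ
    exact ⟨_, .ite_false hb h₁, by omega⟩
  | while_false hb => exact ⟨_, .while_false hb, by omega⟩
  | while_true hb hp hw ihp ihw =>
    obtain ⟨t₁, h₁, e₁⟩ := ihp fun L hL => hQ L (List.mem_append_left _ hL)
    obtain ⟨t₂, h₂, e₂⟩ := ihw fun L hL => hQ L (List.mem_append_right _ hL)
    exact ⟨_, .while_true hb h₁ h₂, by rw [List.length_append, add_mul]; omega⟩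
  | call args x hp ih =>
    obtain ⟨t₁, h₁, e₁⟩ := ih hQ
    exact ⟨_, .call args x h₁, by omega⟩
  | @query s y args x hy =>
    obtain ⟨s₁, t₁, h₁, e₁, hT⟩ := hQ _ (List.mem_singleton_self _)
    rw [hy] at e₁
    cases e₁
    exact ⟨_, .call args x h₁, by simp; omega⟩

open Classical in
/-- The oracle that answers as the program `q`. -/
noncomputable def oracleOf (q : Prog F) : Oracle := fun L =>
  if h : ∃ s t, Exec (fun _ => none) q (RamState.init L) s t [] then some (h.choose.val 0) else none

theorem oracleOf_eq {q : Prog F} {L : List (List ℝ)} {s : RamState} {t : ℕ}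
    (h : Exec (fun _ => none) q (RamState.init L) s t []) : oracleOf q L = some (s.val 0) := by
  have hex : ∃ s t, Exec (fun _ => none) q (RamState.init L) s t [] := ⟨s, t, h⟩
  rw [oracleOf, dif_pos hex]
  obtain ⟨t', ht'⟩ := hex.choose_spec
  rw [(ht'.deterministic h).1]

/-- The bound `g` need not be monotone, so a call is charged the supremum of `g` over all admissible
sizes; a power bound on `g` controls this supremum. -/
theorem subquadratic_add_sup {f g : ℕ → ℕ} (hf : Subquadratic f) (hg : Subquadratic g) (k C : ℕ) :
    Subquadratic fun n => f n + k * (Finset.range (C * (n + 1) + 1)).sup g := by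
  obtain ⟨δ, A, hδ, hδ1, hA, hf⟩ := hf.exists_le
  obtain ⟨ε, B, hε, hε1, hB, hg⟩ := hg.exists_le
  have hm0 : 0 < min δ ε := lt_min hδ hε
  refine subquadratic_of_le (δ := min δ ε) (A := A + k * (B * ((C : ℝ) + 1) ^ (2 - ε))) hm0
    (by have := min_le_left δ ε; linarith) fun n => ?_
  have hbase : (1 : ℝ) ≤ (n : ℝ) + 1 := by have := Nat.cast_nonneg (α := ℝ) n; linarith
  have hsup : (((Finset.range (C * (n + 1) + 1)).sup g : ℕ) : ℝ) ≤
      B * ((C : ℝ) + 1) ^ (2 - ε) * ((n : ℝ) + 1) ^ (2 - ε) := by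
    obtain ⟨j, hj, hj'⟩ := Finset.exists_mem_eq_sup (Finset.range (C * (n + 1) + 1)) ⟨0, by simp⟩ g
    rw [hj', mul_assoc, ← Real.mul_rpow (by positivity) (by positivity)]
    refine (hg j).trans (mul_le_mul_of_nonneg_left (Real.rpow_le_rpow (by positivity) ?_
      (by linarith)) hB)
    have : j ≤ C * (n + 1) := by rw [Finset.mem_range] at hj; omega
    have : (j : ℝ) ≤ C * (n + 1) := by exact_mod_cast this
    nlinarith
  have h1 : ((n : ℝ) + 1) ^ (2 - δ) ≤ ((n : ℝ) + 1) ^ (2 - min δ ε) :=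
    Real.rpow_le_rpow_of_exponent_le hbase (by have := min_le_left δ ε; linarith)
  have h2 : ((n : ℝ) + 1) ^ (2 - ε) ≤ ((n : ℝ) + 1) ^ (2 - min δ ε) :=
    Real.rpow_le_rpow_of_exponent_le hbase (by have := min_le_right δ ε; linarith)
  have h3 := mul_le_mul_of_nonneg_left h1 hA
  have h4 := mul_le_mul_of_nonneg_left h2
    (show 0 ≤ (k : ℝ) * (B * ((C : ℝ) + 1) ^ (2 - ε)) by positivity)
  have h5 := mul_le_mul_of_nonneg_left hsup (Nat.cast_nonneg (α := ℝ) k)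
  push_cast
  linarith [hf n]

/-- Subquadratic reductions transfer subquadratic algorithms. -/
theorem SubquadraticallyReducible.solvable {A B : RamProblem} (h : SubquadraticallyReducible F A B)
    (hB : SolvableInSubquadraticTime F B) : SolvableInSubquadraticTime F A := by
  obtain ⟨p, f, k, C, hf, hp⟩ := h
  obtain ⟨q, g, hg, hq⟩ := hB
  refine ⟨p.replaceQuery q, _, subquadratic_add_sup hf hg k C, fun I => ?_⟩
  have hO : IsOracleFor (oracleOf q) B := by
    intro J
    obtain ⟨s, t, he, hc, -⟩ := hq J
    exact ⟨_, oracleOf_eq he, hc⟩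
  obtain ⟨s, t, Q, he, hc, ht, hQ, hsize⟩ := hp _ hO I
  obtain ⟨t', he', ht'⟩ := he.replaceQuery (q := q)
    (T := (Finset.range (C * (A.size I + 1) + 1)).sup g) fun L hL => by
      obtain ⟨J, rfl, hJ⟩ := hsize L hL
      obtain ⟨s', τ, hs', -, hτ⟩ := hq J
      exact ⟨s', τ, hs', oracleOf_eq hs',
        hτ.trans (Finset.le_sup (f := g) (Finset.mem_range.mpr (by omega)))⟩
  exact ⟨s, t', he', hc, ht'.trans (Nat.add_le_add ht (Nat.mul_le_mul_right _ hQ))⟩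

end Transfer

theorem theorem1 (F : Set (ℝ → ℝ)) (hsin : Real.sin ∈ F) (hcos : Real.cos ∈ F) :
    IsThreeSumHard F fixedMCR ∧
    (SolvableInSubquadraticTime F fixedMCR → SolvableInSubquadraticTime F threeSum) :=
  ⟨threeSum_reducible hsin hcos, (threeSum_reducible hsin hcos).solvable⟩
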